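/- Let $C_0>0$. There is a constant $C>0$, depending only on $C_0$, such that the following holds. Let $n\in\mathbb N$ and let $X_1,\dots,X_n$ be random variables with values in $\{0,1,2,\dots\}$ that are 1-dependent, i.e. for $1\le s<t\le n$ with $t-s>1$ the $\sigma$-algebras generated by $X_1,\dots,X_s$ and by $X_t,\dots,X_n$ are independent. Put $X_k\equiv 0$ for $k\le 0$, $S_n=X_1+\dots+X_n$, $F_n\{x\}=P(S_n=x)$, $\lambda=\mathbb E S_n$, $\Gamma_2=\frac12(\operatorname{Var}S_n-\mathbb E S_n)$, and $\nu_j(k)=\mathbb E X_k(X_k-1)\cdots(X_k-j+1)$. For random variables $Y_1,Y_2,Y_3$ let $$\hat E^+(Y_1,Y_2)=\mathbb E Y_1Y_2+\mathbb E Y_1\,\mathbb E Y_2,\qquad \hat E^+(Y_1,Y_2,Y_3)=\mathbb E Y_1Y_2Y_3+\mathbb E Y_1\,\mathbb E Y_2Y_3+\hat E^+(Y_1,Y_2)\,\mathbb E Y_3,$$ $$\hat E^+_2(Y_1,Y_2)=\hat E^+(Y_1(Y_1-1),Y_2)+\hat E^+(Y_1,Y_2(Y_2-1)),$$ and let $$R_0=\sum_{k=1}^n\{\nu_2(k)+\nu_1^2(k)+\mathbb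 E X_{k-1}X_k\},$$ $$R_1=\sum_{k=1}^n\{\nu_1^3(k)+\nu_1(k)\nu_2(k)+\nu_3(k)+[\nu_1(k-2)+\nu_1(k-1)+\nu_1(k)]\,\mathbb E X_{k-1}X_k+\hat E_2^+(X_{k-1},X_k)+\hat E^+(X_{k-2},X_{k-1},X_k)\}.$$ Assume $$\nu_1(k)\le \tfrac1{100},\quad \nu_2(k)\le\nu_1(k),\quad |X_k|\le C_0\ \text{ almost surely}\quad(k=1,\dots,n),$$ $$\lambda\ge 1,\quad \sum_{k=1}^n\nu_2(k)\le\frac{\lambda}{20},\quad \sum_{k=2}^n|\operatorname{Cov}(X_{k-1},X_k)|\le\frac{\lambda}{20}.$$ Write $z=e^{it}-1$. Consider the following (signed) measures. - $\Pi$: the Poisson distribution with parameter $\lambda$. $\Pi_1$: its second order difference times $\Gamma_2$, i.e. $\Pi_1\{x\}=\Gamma_2(\Pi\{x\}-2\Pi\{x-1\}+\Pi\{x-2\})$, with Fourier–Stieltjes transform $\Gamma_2z^2e^{\lambda z}$. - $G$: the signed measure on $\{0,1,2,\dots\}$ with Fourier–Stieltjes transform $\exp(\lambda z+\Gamma_2z^2)$.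 - $TP$: the law of $\lfloor-2\Gamma_2\rfloor+P$, where $P$ is Poisson with parameter $\lambda+2\Gamma_2+\tilde\delta$ and $\tilde\delta\in[0,1)$ is the fractional part of $-2\Gamma_2$. - If $\Gamma_2>0$, $NB\{j\}=\frac{\Gamma(r+j)}{j!\,\Gamma(r)}q^r(1-q)^j$ for $j=0,1,2,\dots$, where $r(1-q)/q=\lambda$ and $r((1-q)/q)^2=2\Gamma_2$. - If $\Gamma_2<0$, $BI$: the binomial distribution with $N=\lfloor\lambda^2/(2|\Gamma_2|)\rfloor$ trials and success probability $\bar p=\lambda/N$. Then, for every $x\in\{0,1,2,\dots\}$, $$\Big(1+\frac{(x-\lambda)^2}{\lambda}\Big)|F_n\{x\}-\Pi\{x\}|\le C\frac{R_0}{\lambda\sqrt\lambda},$$ $$\Big(1+\frac{(x-\lambda)^2}{\lambda}\Big)|F_n\{x\}-\Pi\{x\}-\Pi_1\{x\}|\le C\Big(\frac{R_0^2}{\lambda^2\sqrt\lambda}+\frac{R_1}{\lambda^2}\Big),$$ $$\Big(1+\frac{(x-\lambda)^2}{\lambda}\Big)|F_n\{x\}-G\{x\}|\le C\frac{R_1}{\lambda^2},$$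 $$\Big(1+\frac{(x-\lambda)^2}{\lambda}\Big)|F_n\{x\}-TP\{x\}|\le C\Big(\frac{R_1+|\Gamma_2|}{\lambda^2}+\frac{\tilde\delta}{\lambda\sqrt\lambda}\Big).$$ If in addition $\Gamma_2>0$, then $$\Big(1+\frac{(x-\lambda)^2}{\lambda}\Big)|F_n\{x\}-NB\{x\}|\le C\Big(\frac{R_1}{\lambda^2}+\frac{\Gamma_2^2}{\lambda^3}\Big);$$ if instead $\Gamma_2<0$, then $$\Big(1+\frac{(x-\lambda)^2}{\lambda}\Big)|F_n\{x\}-BI\{x\}|\le C\Big(\frac{R_1}{\lambda^2}+\frac{\Gamma_2^2}{\lambda^3}\Big).$$ -/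

import Mathlib

open MeasureTheory ProbabilityTheory

namespace OneDep

noncomputable section

/-! ### The summands -/

/-- The summand `X_k` as a real random variable, for every integer index `k`,
with the convention `X_k = 0` for `k ≤ 0`. -/
def rv {Ω : Type*} (X : ℕ → Ω → ℕ) (k : ℤ) : Ω → ℝ :=
  fun ω => if 0 < k then (X k.toNat ω : ℝ) else 0

/-- `X_1, …, X_n` are `m`-dependent: whenever `1 ≤ s`, `t - s > m` and `t ≤ n`, the σ-algebras
generated by `X_1, …, X_s` and by `X_t, …, X_n` are independent. -/
def MDependent {Ω : Type*} [MeasurableSpace Ω] (m n : ℕ) (X : ℕ → Ω → ℕ) (μ : Measure Ω) : Prop :=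
  ∀ s t : ℕ, 1 ≤ s → s + m < t → t ≤ n →
    Indep (⨆ i ∈ Finset.Icc 1 s, MeasurableSpace.comap (X i) ⊤)
      (⨆ i ∈ Finset.Icc t n, MeasurableSpace.comap (X i) ⊤) μ

/-- The sum `S_n = X_1 + ⋯ + X_n`. -/
def S {Ω : Type*} (X : ℕ → Ω → ℕ) (n : ℕ) : Ω → ℕ := fun ω => ∑ k ∈ Finset.Icc 1 n, X k ω

/-- The point probability `F_n{x} = P(S_n = x)`. -/
def pointF {Ω : Type*} [MeasurableSpace Ω] (X : ℕ → Ω → ℕ) (n : ℕ) (μ : Measure Ω) (x : ℕ) : ℝ :=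
  μ.real {ω | S X n ω = x}

/-- `λ = E S_n`. -/
def lam {Ω : Type*} [MeasurableSpace Ω] (X : ℕ → Ω → ℕ) (n : ℕ) (μ : Measure Ω) : ℝ :=
  ∫ ω, (S X n ω : ℝ) ∂μ

/-- `Γ₂ = (Var S_n - E S_n) / 2`. -/
def Gam {Ω : Type*} [MeasurableSpace Ω] (X : ℕ → Ω → ℕ) (n : ℕ) (μ : Measure Ω) : ℝ :=
  (Var[fun ω => (S X n ω : ℝ); μ] - lam X n μ) / 2

/-- The factorial moment `ν_j(k) = E X_k (X_k - 1) ⋯ (X_k - j + 1)`. -/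
def nu {Ω : Type*} [MeasurableSpace Ω] (X : ℕ → Ω → ℕ) (μ : Measure Ω) (j : ℕ) (k : ℤ) : ℝ :=
  ∫ ω, ∏ i ∈ Finset.range j, (rv X k ω - (i : ℝ)) ∂μ

/-! ### The quantities `Ê⁺` and the remainder terms -/

/-- `Ê⁺(Y₁, Y₂) = E Y₁Y₂ + E Y₁ E Y₂`. -/
def EPlusPair {Ω : Type*} [MeasurableSpace Ω] (μ : Measure Ω) (Y₁ Y₂ : Ω → ℝ) : ℝ :=
  ∫ ω, Y₁ ω * Y₂ ω ∂μ + (∫ ω, Y₁ ω ∂μ) * ∫ ω, Y₂ ω ∂μ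

/-- `Ê⁺(Y₁, Y₂, Y₃) = E Y₁Y₂Y₃ + Ê⁺(Y₁) E Y₂Y₃ + Ê⁺(Y₁, Y₂) E Y₃`, where `Ê⁺(Y₁) = E Y₁`. -/
def EPlusTriple {Ω : Type*} [MeasurableSpace Ω] (μ : Measure Ω) (Y₁ Y₂ Y₃ : Ω → ℝ) : ℝ :=
  ∫ ω, Y₁ ω * Y₂ ω * Y₃ ω ∂μ + (∫ ω, Y₁ ω ∂μ) * (∫ ω, Y₂ ω * Y₃ ω ∂μ)
    + EPlusPair μ Y₁ Y₂ * ∫ ω, Y₃ ω ∂μ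

/-- `Ê₂⁺(Y₁, Y₂) = Ê⁺(Y₁(Y₁ - 1), Y₂) + Ê⁺(Y₁, Y₂(Y₂ - 1))`. -/
def EPlusTwo {Ω : Type*} [MeasurableSpace Ω] (μ : Measure Ω) (Y₁ Y₂ : Ω → ℝ) : ℝ :=
  EPlusPair μ (fun ω => Y₁ ω * (Y₁ ω - 1)) Y₂ + EPlusPair μ Y₁ (fun ω => Y₂ ω * (Y₂ ω - 1))

/-- The remainder term `R₀`. -/
def R₀ {Ω : Type*} [MeasurableSpace Ω] (X : ℕ → Ω → ℕ) (n : ℕ) (μ : Measure Ω) : ℝ :=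
  ∑ k ∈ Finset.Icc (1 : ℤ) n,
    (nu X μ 2 k + nu X μ 1 k ^ 2 + ∫ ω, rv X (k - 1) ω * rv X k ω ∂μ)

/-- The remainder term `R₁`. -/
def R₁ {Ω : Type*} [MeasurableSpace Ω] (X : ℕ → Ω → ℕ) (n : ℕ) (μ : Measure Ω) : ℝ :=
  ∑ k ∈ Finset.Icc (1 : ℤ) n,
    (nu X μ 1 k ^ 3 + nu X μ 1 k * nu X μ 2 k + nu X μ 3 k
      + (nu X μ 1 (k - 2) + nu X μ 1 (k - 1) + nu X μ 1 k) * ∫ ω, rv X (k - 1) ω * rv X k ω ∂μ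
      + EPlusTwo μ (rv X (k - 1)) (rv X k)
      + EPlusTriple μ (rv X (k - 2)) (rv X (k - 1)) (rv X k))

/-! ### The approximating (signed) measures, given by their point masses

Here `l` stands for `λ = E S_n` and `g` for `Γ₂`. -/

/-- The Poisson distribution with parameter `l`, as a measure on `ℤ`: its mass at `k`. -/
def pois (l : ℝ) (k : ℤ) : ℝ :=
  if 0 ≤ k then (poissonMeasure l.toNNReal).real {k.toNat} else 0

/-- The second order difference of the Poisson distribution with parameter `l`, times `g`;
its Fourier-Stieltjes transform is `exp (l z) * g * z ^ 2` with `z = exp (i t) - 1`. -/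
def pois₁ (l g : ℝ) (k : ℤ) : ℝ :=
  g * (pois l k - 2 * pois l (k - 1) + pois l (k - 2))

/-- The mass at `x` of the compound Poisson signed measure with Fourier-Stieltjes transform
`exp (l z + g z ^ 2)`, `z = exp (i t) - 1` (see `hasSum_compPois`): the coefficient of `w ^ x` in
`exp (l (w - 1) + g (w - 1) ^ 2) = exp (g - l) * exp ((l - 2 g) w) * exp (g w ^ 2)`. -/
def compPois (l g : ℝ) (x : ℕ) : ℝ :=
  ∑ j ∈ Finset.range (x / 2 + 1),
    Real.exp (g - l) * ((l - 2 * g) ^ (x - 2 * j) / (x - 2 * j).factorial)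
      * (g ^ j / j.factorial)

/-- The translated Poisson distribution, i.e. the law of `⌊-2g⌋ + P` where `P` is Poisson with
parameter `l + 2g + δ` and `δ` is the fractional part of `-2g`: its mass at `k`. -/
def transPois (l g : ℝ) (k : ℤ) : ℝ :=
  pois (l + 2 * g + Int.fract (-2 * g)) (k - ⌊-2 * g⌋)

/-- The parameter `q` of the negative binomial approximation. -/
def nbQ (l g : ℝ) : ℝ := l / (l + 2 * g)

/-- The parameter `r` of the negative binomial approximation. -/
def nbR (l g : ℝ) : ℝ := l ^ 2 / (2 * g)

/-- The negative binomial distribution with parameters `r`, `q`: its mass at `j`. -/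
def negBin (r q : ℝ) (j : ℕ) : ℝ :=
  Real.Gamma (r + j) / (j.factorial * Real.Gamma r) * q ^ r * (1 - q) ^ j

/-- The number of trials `N = ⌊l² / (2|g|)⌋` of the binomial approximation. -/
def biN (l g : ℝ) : ℕ := ⌊l ^ 2 / (2 * |g|)⌋₊

/-- The binomial distribution with `N` trials and success probability `p`: its mass at `j`. -/
def binom (N : ℕ) (p : ℝ) (j : ℕ) : ℝ := N.choose j * p ^ j * (1 - p) ^ (N - j)

/-! ### The approximations satisfy their defining relations -/

/-- `q` and `r` are determined by `r(1-q)/q = l` and `r((1-q)/q)² = 2g`. -/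
theorem nb_param {l g : ℝ} (hl : 0 < l) (hg : 0 < g) (r q : ℝ) :
    (r * (1 - q) / q = l ∧ r * ((1 - q) / q) ^ 2 = 2 * g) ↔ (r = nbR l g ∧ q = nbQ l g) := by
  have h0 : l + 2 * g ≠ 0 := by positivity
  constructor
  · rintro ⟨h1, h2⟩
    have hq : q ≠ 0 := by
      rintro rfl
      simp at h1
      exact hl.ne h1
    have h3 : l * ((1 - q) / q) = 2 * g := by rw [← h2, ← h1]; ring
    have h4 : l * (1 - q) = 2 * g * q := by
      field_simp at h3
      linarith
    have h5 : q = nbQ l g := by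
      unfold nbQ
      rw [eq_div_iff h0]
      linarith
    refine ⟨?_, h5⟩
    have h6 : (1 - q) / q = 2 * g / l := by
      rw [eq_div_iff hl.ne']
      linarith
    rw [mul_div_assoc, h6] at h1
    unfold nbR
    field_simp at h1 ⊢
    linarith
  · rintro ⟨rfl, rfl⟩
    have h6 : (1 - nbQ l g) / nbQ l g = 2 * g / l := by
      unfold nbQ
      field_simp
      ring
    rw [mul_div_assoc, h6]
    unfold nbR
    constructor <;> field_simp

theorem compPois_exp_mul (l g : ℝ) (w : ℂ) (x : ℕ) :
    w ^ x * (compPois l g x : ℂ)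
      = ∑ j ∈ Finset.range (x / 2 + 1), Complex.exp (g - l)
          * (((l - 2 * g) * w) ^ (x - 2 * j) / ((x - 2 * j).factorial : ℂ)
            * ((g * w ^ 2) ^ j / (j.factorial : ℂ))) := by
  unfold compPois
  push_cast
  rw [Finset.mul_sum]
  refine Finset.sum_congr rfl fun j hj => ?_
  have hj' : x = x - 2 * j + 2 * j := by
    have := Finset.mem_range.mp hj
    omega
  have hwx : w ^ x = w ^ (x - 2 * j) * (w ^ 2) ^ j := by
    rw [← pow_mul, ← pow_add, ← hj']
  rw [hwx, mul_pow, mul_pow]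
  ring

/-- The fibre sums of a family on `ℕ × ℕ` along `(i, j) ↦ i + 2 j`. -/
theorem tsum_fib (f : ℕ × ℕ → ℂ) (x : ℕ) :
    ∑' p : ((fun p : ℕ × ℕ => p.1 + 2 * p.2) ⁻¹' {x}), f p
      = ∑ j ∈ Finset.range (x / 2 + 1), f (x - 2 * j, j) := by
  have hfib : (fun p : ℕ × ℕ => p.1 + 2 * p.2) ⁻¹' {x}
      = ↑((Finset.range (x / 2 + 1)).image (fun j => (x - 2 * j, j))) := by
    ext ⟨i, j⟩
    simp only [Set.mem_preimage, Set.mem_singleton_iff, Finset.coe_image, Set.mem_image,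
      Finset.coe_range, Set.mem_Iio, Prod.mk.injEq]
    constructor
    · intro h
      exact ⟨j, by omega, by omega, rfl⟩
    · rintro ⟨j', h, h', rfl⟩
      omega
  rw [hfib, Finset.tsum_subtype', Finset.sum_image (by intro u _ v _ h; exact (Prod.mk.inj h).2)]

theorem summable_mul_aux (f g : ℕ → ℂ) (hf : Summable (fun i => ‖f i‖))
    (hg : Summable (fun i => ‖g i‖)) : Summable (fun p : ℕ × ℕ => f p.1 * g p.2) :=
  summable_mul_of_summable_norm hf hg

theorem exp_norm_summable (y : ℂ) : Summable (fun i : ℕ => ‖y ^ i / (i.factorial : ℂ)‖) := by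
  simpa only [norm_div, norm_pow, Complex.norm_natCast] using Real.summable_pow_div_factorial ‖y‖

theorem exp_mul_summable (u v : ℂ) :
    Summable (fun p : ℕ × ℕ => u ^ p.1 / (p.1.factorial : ℂ) * (v ^ p.2 / (p.2.factorial : ℂ))) :=
  summable_mul_aux (fun i => u ^ i / (i.factorial : ℂ)) (fun i => v ^ i / (i.factorial : ℂ))
    (exp_norm_summable u) (exp_norm_summable v)

/-- The masses `compPois l g` have the Fourier-Stieltjes transform `exp (l z + g z ^ 2)`. -/
theorem hasSum_compPois (l g t : ℝ) :
    HasSum (fun x : ℕ => Complex.exp (Complex.I * t) ^ x * (compPois l g x : ℂ))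
      (Complex.exp (l * (Complex.exp (Complex.I * t) - 1)
        + g * (Complex.exp (Complex.I * t) - 1) ^ 2)) := by
  generalize Complex.exp (Complex.I * t) = w
  have hexp : ∀ y : ℂ, HasSum (fun i : ℕ => y ^ i / (i.factorial : ℂ)) (Complex.exp y) := by
    intro y
    rw [Complex.exp_eq_exp_ℂ]
    exact NormedSpace.expSeries_div_hasSum_exp y
  have hs := exp_mul_summable ((l - 2 * g) * w) (g * w ^ 2)
  have h1 := (hexp ((l - 2 * g) * w)).mul (hexp (g * w ^ 2)) hs
  have h2 := (h1.mul_left (Complex.exp (g - l))).tsum_fiberwise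
    (fun p : ℕ × ℕ => p.1 + 2 * p.2)
  have h3 : Complex.exp (l * (w - 1) + g * (w - 1) ^ 2)
      = Complex.exp (g - l) * (Complex.exp ((l - 2 * g) * w) * Complex.exp (g * w ^ 2)) := by
    rw [← Complex.exp_add, ← Complex.exp_add]
    congr 1
    ring
  rw [h3]
  have h4 : ∀ x : ℕ, w ^ x * (compPois l g x : ℂ) = _ := fun x =>
    (compPois_exp_mul l g w x).trans (tsum_fib (fun p : ℕ × ℕ => Complex.exp (g - l)
      * (((l - 2 * g) * w) ^ p.1 / (p.1.factorial : ℂ)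
        * ((g * w ^ 2) ^ p.2 / (p.2.factorial : ℂ)))) x).symm
  rw [funext h4]
  exact h2

end

end OneDep

open OneDep

/-! The weight `1 + (x - λ)² / λ` comes from moving the contour of integration. A point mass is
recovered from the transform on any line `re s = h` of the strip. With `|h| = ε / √λ` and the sign
of `h` chosen according to the side of `λ` on which `x` lies, the integrand gains the factor `exp
(-ε |x - λ| / √λ)`, which absorbs the weight. It remains to bound differences of transforms on these
lines by `‖s‖ ^ m`, `m = 2, 3, 4`, times the Gaussian `exp (λ re s + 3 - λ (im s)² / 100)`;
integration turns `‖s‖ ^ m` into `λ ^ (-(m + 1) / 2)` (`exists_weighted_bound`).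

All comparisons pass through `exp (λ z + Γ₂ z²)` with `z = exp s - 1`. The transforms of the
explicit laws agree with it up to terms visible from Taylor expansions of `exp` and `log`, so the
triangle inequality leaves only the comparison with the law of the sum.

For that law, expand `w ^ X = 1 + (w ^ X - 1)` from the last index backwards. Choosing the summand
`1` leaves a gap of one index, across which 1-dependence factorizes the expectation; this gives a
linear recursion for the generating functions `f k` of the partial sums (`genFun_succ`). Its
coefficients, expectations of products of `w ^ X - 1` over blocks, decay geometrically because every
other variable is independent of the block before it. A bootstrap then keeps all ratios `f k / f (k
- 1)` within `1/10` of `1` (`ratio_aux`), so `f n` is a product of ratios. Each ratio equals `exp (p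
z + γ z²)` up to third order moments (`norm_factor_sub_exp_le`), the `γ`s add up exactly to `Γ₂`
(`Gam_eq`), and a telescoping argument bounds the difference of the two products
(`norm_prod_sub_prod_le`).

Gaussian decay survives because `re z = -‖z‖² / 2` on the imaginary axis: second order terms of
total size at most `(9/20) λ ‖z‖²` cannot destroy it (`InStrip.le_gaussExp`). The smallness
hypotheses on moments and covariances keep the total below this threshold (`smallMoments`). The
almost sure bound on the summands keeps `‖w‖ ^ X` close to `1` off the unit circle, and bounds the
third order terms by second order ones where the error is to be measured by `R₀`. -/

open Complex in
/-- `a` has the bilateral Laplace transform `P` on the strip `|re s| ≤ 1`. -/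
def HasTransform (a : ℤ → ℝ) (P : ℂ → ℂ) : Prop :=
  ∀ s : ℂ, |s.re| ≤ 1 → HasSum (fun k : ℤ => (a k : ℂ) * exp (k * s)) (P s)

/-! ### Inversion on shifted vertical lines and weighted bounds for point masses -/

section Inversion
open Complex Real

theorem integral_exp_int (m : ℤ) :
    ∫ t in (-π)..π, Complex.exp (m * (t * I)) = if m = 0 then 2 * (π : ℂ) else 0 := by
  split_ifs with hm
  · subst hm; simp; ring
  · have hc : (m * I : ℂ) ≠ 0 := by simp [hm]
    have h1 : ∀ t : ℝ, Complex.exp (m * (t * I)) = Complex.exp ((m * I) * t) := by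
      intro t; congr 1; ring
    simp_rw [h1]
    rw [integral_exp_mul_complex hc, div_eq_zero_iff]
    left
    rw [sub_eq_zero, Complex.exp_eq_exp_iff_exists_int]
    exact ⟨m, by push_cast; ring⟩

/-- On a vertical line the norms of the terms do not depend on `t`, so absolute convergence at one
point gives uniform convergence on the line. Integration over a period may be done termwise, and
orthogonality keeps only the term `k = x`. The freedom in `h` is what later yields decay in `x`. -/
theorem HasTransform.inversion {a : ℤ → ℝ} {P : ℂ → ℂ} (ha : HasTransform a P) {h : ℝ}
    (hh : |h| ≤ 1) (x : ℤ) :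
    IntervalIntegrable (fun t : ℝ => P (h + t * I) * Complex.exp (-(x * (h + t * I)))) volume
      (-π) π ∧
    ∫ t in (-π)..π, P (h + t * I) * Complex.exp (-(x * (h + t * I))) = 2 * π * a x := by
  have hre : ∀ t : ℝ, ((h : ℂ) + t * I).re = h := by intro t; simp
  have hP : ∀ t : ℝ, HasSum (fun k : ℤ => (a k : ℂ) * Complex.exp (k * (h + t * I))
      * Complex.exp (-(x * (h + t * I)))) (P (h + t * I) * Complex.exp (-(x * (h + t * I)))) :=
    fun t => (ha _ (by rw [hre]; exact hh)).mul_right _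
  let f : ℤ → C(ℝ, ℂ) := fun k => ⟨fun t => (a k : ℂ) * Complex.exp (k * (h + t * I))
      * Complex.exp (-(x * (h + t * I))), by fun_prop⟩
  have hnorm : ∀ k t, ‖f k t‖ = |a k| * Real.exp ((k - x) * h) := by
    intro k t
    simp only [f, ContinuousMap.coe_mk, norm_mul, Complex.norm_exp, Complex.norm_real,
      Real.norm_eq_abs]
    rw [mul_assoc, ← Real.exp_add]
    congr 2
    simp
    ring
  have hs0 : Summable fun k : ℤ => |a k| * Real.exp ((k - x) * h) := by
    have := (hP 0).summable.norm
    exact this.congr fun k => hnorm k 0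
  have hsum : Summable fun k => ‖(f k).restrict
      (⟨Set.uIcc (-π) π, isCompact_uIcc⟩ : TopologicalSpace.Compacts ℝ)‖ := by
    refine Summable.of_nonneg_of_le (fun _ => norm_nonneg _) (fun k => ?_) hs0
    rw [ContinuousMap.norm_le _ (by positivity)]
    intro t
    exact (hnorm k t).le
  have hcont : Continuous (fun t : ℝ => P (h + t * I) * Complex.exp (-(x * (h + t * I)))) := by
    have h2 : (fun t : ℝ => P (h + t * I) * Complex.exp (-(x * (h + t * I))))
        = fun t => ∑' k, f k t := by
      funext t; exact (hP t).tsum_eq.symm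
    rw [h2]
    exact continuous_tsum (fun k => (f k).continuous) hs0 (fun k t => (hnorm k t).le)
  refine ⟨hcont.intervalIntegrable _ _, ?_⟩
  have key := intervalIntegral.hasSum_intervalIntegral_of_summable_norm (a := -π) (b := π) hsum
  have h3 : ∀ t : ℝ, ∑' k, f k t = P (h + t * I) * Complex.exp (-(x * (h + t * I))) :=
    fun t => (hP t).tsum_eq
  simp_rw [h3] at key
  rw [← key.tsum_eq, tsum_eq_single x]
  · have h4 : ∀ t : ℝ, f x t = (a x : ℂ) := by
      intro t
      simp only [f, ContinuousMap.coe_mk]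
      rw [mul_assoc, ← Complex.exp_add]
      simp
    simp_rw [h4]
    rw [intervalIntegral.integral_const, Complex.real_smul]
    push_cast
    ring
  · intro k hk
    have h4 : ∀ t : ℝ, f k t = (a k : ℂ) * Complex.exp (((k - x : ℤ) : ℂ) * h)
        * Complex.exp (((k - x : ℤ) : ℂ) * (t * I)) := by
      intro t
      simp only [f, ContinuousMap.coe_mk]
      rw [mul_assoc, mul_assoc, ← Complex.exp_add, ← Complex.exp_add]
      congr 2
      push_cast
      ring
    simp_rw [h4]
    rw [intervalIntegral.integral_const_mul, integral_exp_int, if_neg (sub_ne_zero.mpr hk),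
      mul_zero]

/-- Half of the Gaussian is spent on the polynomial. The constant must make `700000 / 80000` exceed
the `8` in `(1 + v) ^ 4 ≤ 8 (1 + v ^ 4)`, since the quadratic Taylor term of `exp (v² / 200)` is `v
^ 4 / 80000`. -/
theorem one_add_pow_four_mul_exp_le (v : ℝ) :
    (1 + v) ^ 4 * Real.exp (-(v ^ 2 / 100)) ≤ 700000 * Real.exp (-(v ^ 2 / 200)) := by
  have h1 : Real.exp (-(v ^ 2 / 100)) = Real.exp (-(v ^ 2 / 200)) * Real.exp (-(v ^ 2 / 200)) := by
    rw [← Real.exp_add]; congr 1; ring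
  rw [h1, ← mul_assoc]
  refine mul_le_mul_of_nonneg_right ?_ (Real.exp_pos _).le
  rw [Real.exp_neg, ← div_eq_mul_inv, div_le_iff₀ (Real.exp_pos _)]
  have h2 := Real.quadratic_le_exp_of_nonneg (x := v ^ 2 / 200) (by positivity)
  have h3 : (1 + v) ^ 4 ≤ 8 * (1 + v ^ 4) := by
    nlinarith [sq_nonneg (v ^ 2 - 1), sq_nonneg (v - 1), sq_nonneg (v * (v - 1)),
      sq_nonneg (v + 1), sq_nonneg (v ^ 2 - v)]
  nlinarith [sq_nonneg v]

/-- Bounds for the difference of two transforms near the imaginary axis give non-uniform bounds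
for the difference of the sequences. -/
theorem exists_weighted_bound {ε : ℝ} (hε : 0 < ε) (hε1 : ε ≤ 1) :
    ∃ C : ℝ, 0 < C ∧ ∀ (l A₂ A₃ A₄ : ℝ) (a b : ℤ → ℝ) (P Q : ℂ → ℂ), 1 ≤ l → 0 ≤ A₂ → 0 ≤ A₃ →
      0 ≤ A₄ → HasTransform a P → HasTransform b Q →
      (∀ s : ℂ, |s.re| = ε / √l → |s.im| ≤ π → ‖P s - Q s‖
        ≤ (A₂ * ‖s‖ ^ 2 + A₃ * ‖s‖ ^ 3 + A₄ * ‖s‖ ^ 4)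
          * Real.exp (l * s.re + 3 - l * s.im ^ 2 / 100)) →
      ∀ x : ℤ, (1 + ((x : ℝ) - l) ^ 2 / l) * |a x - b x|
        ≤ C * (A₂ / (l * √l) + A₃ / l ^ 2 + A₄ / (l ^ 2 * √l)) := by
  -- The factors come from the weight against `exp (-ε u)`, the additive `3` in the exponent, the
  -- absorbed polynomial, and the Gaussian integral with rate `l / 200`, which also supplies a
  -- factor `1 / √l`.
  refine ⟨(1 + 2 / ε ^ 2) * (Real.exp 3 * 700000 * √(200 * π)), by positivity, ?_⟩
  intro l A₂ A₃ A₄ a b P Q hl h2 h3 h4 ha hb hPQ x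
  have hl0 : 0 < l := by linarith
  set q := √l with hq
  have hq1 : 1 ≤ q := by rw [hq]; exact Real.one_le_sqrt.mpr hl
  have hq0 : 0 < q := by linarith
  have hqq : l = q ^ 2 := (Real.sq_sqrt hl0.le).symm
  set u := |(x : ℝ) - l| / q with hu
  have hu0 : 0 ≤ u := by positivity
  -- The line is shifted to the side on which `exp ((l - x) h)` is small.
  obtain ⟨h, hh, hhu⟩ : ∃ h : ℝ, |h| = ε / q ∧ (l - x) * h = -(ε * u) := by
    rcases le_total l x with hx | hx
    · refine ⟨ε / q, abs_of_pos (by positivity), ?_⟩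
      rw [hu, abs_of_nonneg (by linarith)]
      ring
    · refine ⟨-(ε / q), by rw [abs_neg, abs_of_pos (by positivity)], ?_⟩
      rw [hu, abs_of_nonpos (by linarith)]
      ring
  have hh1 : |h| ≤ 1 := by
    rw [hh, div_le_one hq0]; linarith
  obtain ⟨ia, ea⟩ := ha.inversion hh1 x
  obtain ⟨ib, eb⟩ := hb.inversion hh1 x
  have ediff : ∫ t in (-π)..π, (P (h + t * I) - Q (h + t * I)) * Complex.exp (-(x * (h + t * I)))
      = 2 * π * (a x - b x : ℝ) := by
    simp_rw [sub_mul]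
    rw [intervalIntegral.integral_sub ia ib, ea, eb]
    push_cast; ring
  set A := A₂ / q ^ 2 + A₃ / q ^ 3 + A₄ / q ^ 4 with hA
  have hA0 : 0 ≤ A := by positivity
  have hpt : ∀ t : ℝ, |t| ≤ π →
      ‖(P (h + t * I) - Q (h + t * I)) * Complex.exp (-(x * (h + t * I)))‖
        ≤ A * Real.exp 3 * 700000 * Real.exp (-(ε * u)) * Real.exp (-(l / 200) * t ^ 2) := by
    intro t ht
    have hre : ((h : ℂ) + t * I).re = h := by simp
    have him : ((h : ℂ) + t * I).im = t := by simp
    have hb := hPQ (h + t * I) (by rw [hre, hh]) (by rw [him]; exact ht)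
    rw [hre, him] at hb
    set v := q * |t| with hv
    have hv0 : 0 ≤ v := by positivity
    have hvt : l * t ^ 2 = v ^ 2 := by rw [hv, mul_pow, sq_abs, hqq]
    have hs : ‖(h : ℂ) + t * I‖ ≤ (1 + v) / q := by
      calc ‖(h : ℂ) + t * I‖ ≤ ‖(h : ℂ)‖ + ‖(t : ℂ) * I‖ := norm_add_le _ _
        _ = |h| + |t| := by simp
        _ ≤ (1 + v) / q := by
          rw [hh, hv, add_div, mul_div_cancel_left₀ _ hq0.ne']
          gcongr
    have hpow : ∀ m : ℕ, m ≤ 4 → ‖(h : ℂ) + t * I‖ ^ m ≤ (1 + v) ^ 4 / q ^ m := by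
      intro m hm
      calc ‖(h : ℂ) + t * I‖ ^ m ≤ ((1 + v) / q) ^ m := by gcongr
        _ = (1 + v) ^ m / q ^ m := div_pow _ _ _
        _ ≤ (1 + v) ^ 4 / q ^ m := by
          gcongr
          linarith
    have hpoly : A₂ * ‖(h : ℂ) + t * I‖ ^ 2 + A₃ * ‖(h : ℂ) + t * I‖ ^ 3
        + A₄ * ‖(h : ℂ) + t * I‖ ^ 4 ≤ A * (1 + v) ^ 4 := by
      calc _ ≤ A₂ * ((1 + v) ^ 4 / q ^ 2) + A₃ * ((1 + v) ^ 4 / q ^ 3)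
            + A₄ * ((1 + v) ^ 4 / q ^ 4) := by
            gcongr
            exacts [hpow 2 (by norm_num), hpow 3 (by norm_num), hpow 4 le_rfl]
        _ = A * (1 + v) ^ 4 := by rw [hA]; ring
    have hexp : Real.exp (l * h + 3 - l * t ^ 2 / 100) * Real.exp (-(x * h))
        = Real.exp 3 * Real.exp (-(ε * u)) * Real.exp (-(v ^ 2 / 100)) := by
      rw [← Real.exp_add, ← Real.exp_add, ← Real.exp_add, ← hvt]
      congr 1
      linear_combination hhu
    have hne : ‖Complex.exp (-(x * (h + t * I)))‖ = Real.exp (-(x * h)) := by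
      rw [Complex.norm_exp]; simp
    rw [norm_mul, hne]
    calc _ ≤ (A * (1 + v) ^ 4 * Real.exp (l * h + 3 - l * t ^ 2 / 100)) * Real.exp (-(x * h)) := by
          gcongr
          exact hb.trans (by gcongr)
      _ = A * Real.exp 3 * Real.exp (-(ε * u)) * ((1 + v) ^ 4 * Real.exp (-(v ^ 2 / 100))) := by
          rw [mul_assoc, hexp]; ring
      _ ≤ A * Real.exp 3 * Real.exp (-(ε * u)) * (700000 * Real.exp (-(v ^ 2 / 200))) := by
          refine mul_le_mul_of_nonneg_left (one_add_pow_four_mul_exp_le v) (by positivity)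
      _ = _ := by
          rw [show -(l / 200) * t ^ 2 = -(v ^ 2 / 200) by rw [← hvt]; ring]; ring
  set K := A * Real.exp 3 * 700000 * Real.exp (-(ε * u)) with hK
  have hK0 : 0 ≤ K := by positivity
  have hgi : Integrable (fun t : ℝ => Real.exp (-(l / 200) * t ^ 2)) :=
    integrable_exp_neg_mul_sq (by positivity)
  have hpi : -π ≤ π := by linarith [Real.pi_pos]
  have hint : ‖∫ t in (-π)..π, (P (h + t * I) - Q (h + t * I)) * Complex.exp (-(x * (h + t * I)))‖
      ≤ K * (√(200 * π) / q) := by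
    calc _ ≤ ∫ t in (-π)..π, K * Real.exp (-(l / 200) * t ^ 2) := by
          refine intervalIntegral.norm_integral_le_of_norm_le hpi
            (Filter.Eventually.of_forall fun t ht => hpt t (abs_le.mpr ⟨ht.1.le, ht.2⟩))
            (hgi.const_mul K).intervalIntegrable
      _ = K * ∫ t in Set.Ioc (-π) π, Real.exp (-(l / 200) * t ^ 2) := by
          rw [intervalIntegral.integral_const_mul, intervalIntegral.integral_of_le hpi]
      _ ≤ K * ∫ t : ℝ, Real.exp (-(l / 200) * t ^ 2) := by
          exact mul_le_mul_of_nonneg_left (setIntegral_le_integral hgi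
            (Filter.Eventually.of_forall fun t => (Real.exp_pos _).le)) hK0
      _ = _ := by
          rw [integral_gaussian]
          congr 1
          rw [show π / (l / 200) = (200 * π) / l by field_simp,
            Real.sqrt_div (by positivity)]
  rw [ediff, norm_mul, Complex.norm_real, Real.norm_eq_abs] at hint
  -- The inversion factor `1 / (2π)` is not needed and is bounded by `1`.
  have h2pi : (1 : ℝ) ≤ ‖(2 * π : ℂ)‖ := by
    rw [norm_mul, Complex.norm_real, Real.norm_eq_abs, abs_of_pos Real.pi_pos]
    simp
    linarith [Real.pi_gt_three]
  have hab : |a x - b x| ≤ K * (√(200 * π) / q) :=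
    le_trans (le_mul_of_one_le_left (abs_nonneg _) h2pi) hint
  have hw : (1 + ((x : ℝ) - l) ^ 2 / l) = 1 + u ^ 2 := by
    rw [hu, div_pow, sq_abs, hqq]
  have hw2 : (1 + u ^ 2) * Real.exp (-(ε * u)) ≤ 1 + 2 / ε ^ 2 := by
    rw [Real.exp_neg, ← div_eq_mul_inv, div_le_iff₀ (Real.exp_pos _)]
    have h5 := Real.quadratic_le_exp_of_nonneg (x := ε * u) (by positivity)
    have h6 : 1 + (ε * u) ^ 2 / 2 ≤ Real.exp (ε * u) := by nlinarith [mul_nonneg hε.le hu0]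
    calc 1 + u ^ 2 ≤ (1 + 2 / ε ^ 2) * (1 + (ε * u) ^ 2 / 2) := by
          have : (1 + 2 / ε ^ 2) * (1 + (ε * u) ^ 2 / 2)
            = 1 + u ^ 2 + (2 / ε ^ 2 + (ε * u) ^ 2 / 2) := by field_simp; ring
          rw [this]
          have : 0 ≤ 2 / ε ^ 2 + (ε * u) ^ 2 / 2 := by positivity
          linarith
      _ ≤ _ := by gcongr
  rw [hw]
  calc (1 + u ^ 2) * |a x - b x| ≤ (1 + u ^ 2) * (K * (√(200 * π) / q)) := by gcongr
    _ = ((1 + u ^ 2) * Real.exp (-(ε * u))) * (Real.exp 3 * 700000 * √(200 * π)) * (A / q) := by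
        rw [hK]; ring
    _ ≤ (1 + 2 / ε ^ 2) * (Real.exp 3 * 700000 * √(200 * π)) * (A / q) := by gcongr
    _ = _ := by
        rw [hA, hqq]
        field_simp

end Inversion

/-! ### Transforms of the approximating measures -/

section Transforms
open Complex

theorem HasSum.of_eq {ι : Type*} {f g : ι → ℂ} {a b : ℂ} (h : HasSum f a) (hf : ∀ i, g i = f i)
    (hb : b = a) : HasSum g b := by
  rw [funext hf, hb]; exact h

theorem HasTransform.of_eq {a b : ℤ → ℝ} {P Q : ℂ → ℂ} (h : HasTransform a P)
    (hb : ∀ k, b k = a k) (hQ : ∀ s, Q s = P s) : HasTransform b Q := by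
  rw [funext hb, funext hQ]; exact h

/-- Extension by zero of a sequence on `ℕ` to `ℤ`. -/
noncomputable def zeroExt (a : ℕ → ℝ) (k : ℤ) : ℝ := if 0 ≤ k then a k.toNat else 0

@[simp] theorem zeroExt_natCast (a : ℕ → ℝ) (x : ℕ) : zeroExt a (x : ℤ) = a x := by
  simp [zeroExt]

theorem hasTransform_zeroExt {a : ℕ → ℝ} {P : ℂ → ℂ}
    (h : ∀ s : ℂ, |s.re| ≤ 1 → HasSum (fun n : ℕ => (a n : ℂ) * exp s ^ n) (P s)) :
    HasTransform (zeroExt a) P := by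
  intro s hs
  have hinj : Function.Injective (fun n : ℕ => (n : ℤ)) := Nat.cast_injective
  rw [← hinj.hasSum_iff]
  · exact (h s hs).of_eq (fun n => by simp [← Complex.exp_nat_mul]) rfl
  · intro k hk
    have : ¬ 0 ≤ k := fun h0 => hk ⟨k.toNat, Int.toNat_of_nonneg h0⟩
    simp [zeroExt, this]

theorem HasTransform.shift {a : ℤ → ℝ} {P : ℂ → ℂ} (h : HasTransform a P) (m : ℤ) :
    HasTransform (fun k => a (k - m)) (fun s => exp (m * s) * P s) := by
  intro s hs
  have h1 := (h s hs).mul_left (exp (m * s))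
  rw [← (Equiv.subRight m).hasSum_iff] at h1
  refine h1.of_eq (fun k => ?_) rfl
  simp only [Function.comp, Equiv.subRight_apply]
  rw [mul_left_comm, ← Complex.exp_add]
  congr 2
  push_cast
  ring

theorem HasTransform.const_mul {a : ℤ → ℝ} {P : ℂ → ℂ} (h : HasTransform a P) (c : ℝ) :
    HasTransform (fun k => c * a k) (fun s => c * P s) := by
  intro s hs
  exact ((h s hs).mul_left (c : ℂ)).of_eq (fun k => by push_cast; ring) rfl

theorem HasTransform.add {a b : ℤ → ℝ} {P Q : ℂ → ℂ} (h : HasTransform a P)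
    (h' : HasTransform b Q) : HasTransform (fun k => a k + b k) (fun s => P s + Q s) := by
  intro s hs
  exact ((h s hs).add (h' s hs)).of_eq (fun k => by push_cast; ring) rfl

theorem hasTransform_pois {l : ℝ} (hl : 0 ≤ l) :
    HasTransform (pois l) (fun s => exp (l * (exp s - 1))) := by
  have : pois l = zeroExt (fun n => (poissonMeasure l.toNNReal).real {n}) := rfl
  rw [this]
  refine hasTransform_zeroExt fun s _ => ?_
  have h1 := (NormedSpace.expSeries_div_hasSum_exp (l * exp s : ℂ)).mul_left (exp (-l))
  rw [← Complex.exp_eq_exp_ℂ, ← Complex.exp_add] at h1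
  refine h1.of_eq (fun n => ?_) ?_
  · rw [poissonMeasure_real_singleton, Real.coe_toNNReal _ hl]
    push_cast
    ring
  · ring_nf

theorem hasTransform_pois₁ {l : ℝ} (hl : 0 ≤ l) (g : ℝ) :
    HasTransform (pois₁ l g) (fun s => g * (exp s - 1) ^ 2 * exp (l * (exp s - 1))) := by
  have h := hasTransform_pois hl
  have h1 := ((h.add ((h.shift 1).const_mul (-2))).add (h.shift 2)).const_mul g
  refine h1.of_eq (fun k => ?_) (fun s => ?_)
  · unfold pois₁; ring
  · have : exp ((2 : ℤ) * s) = exp s ^ 2 := by rw [← Complex.exp_nat_mul]; simp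
    rw [this]
    push_cast
    rw [one_mul]
    ring

theorem hasTransform_transPois {l g : ℝ} (hl : 0 ≤ l + 2 * g + Int.fract (-2 * g)) :
    HasTransform (transPois l g) (fun s => exp ((⌊-2 * g⌋ : ℤ) * s
      + ((l + 2 * g + Int.fract (-2 * g) : ℝ) : ℂ) * (exp s - 1))) := by
  have h1 := (hasTransform_pois hl).shift ⌊-2 * g⌋
  exact h1.of_eq (fun k => rfl) (fun s => Complex.exp_add _ _)

theorem hasTransform_compPois (l g : ℝ) :
    HasTransform (zeroExt (compPois l g))
      (fun s => exp (l * (exp s - 1) + g * (exp s - 1) ^ 2)) := by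
  refine hasTransform_zeroExt fun s _ => ?_
  generalize exp s = w
  have hexp : ∀ y : ℂ, HasSum (fun i : ℕ => y ^ i / (i.factorial : ℂ)) (exp y) := by
    intro y
    rw [Complex.exp_eq_exp_ℂ]
    exact NormedSpace.expSeries_div_hasSum_exp y
  have hs := exp_mul_summable ((l - 2 * g) * w) (g * w ^ 2)
  have h1 := (hexp ((l - 2 * g) * w)).mul (hexp (g * w ^ 2)) hs
  have h2 := (h1.mul_left (exp (g - l))).tsum_fiberwise (fun p : ℕ × ℕ => p.1 + 2 * p.2)
  have h3 : exp (l * (w - 1) + g * (w - 1) ^ 2)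
      = exp (g - l) * (exp ((l - 2 * g) * w) * exp (g * w ^ 2)) := by
    rw [← Complex.exp_add, ← Complex.exp_add]
    congr 1
    ring
  rw [h3]
  have h4 : ∀ x : ℕ, (compPois l g x : ℂ) * w ^ x = _ := fun x =>
    ((mul_comm _ _).trans (compPois_exp_mul l g w x)).trans
      (tsum_fib (fun p : ℕ × ℕ => exp (g - l) * (((l - 2 * g) * w) ^ p.1 / (p.1.factorial : ℂ)
        * ((g * w ^ 2) ^ p.2 / (p.2.factorial : ℂ)))) x).symm
  rw [funext h4]
  exact h2

theorem hasTransform_binom (N : ℕ) (p : ℝ) :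
    HasTransform (zeroExt (binom N p)) (fun s => (1 + p * (exp s - 1)) ^ N) := by
  refine hasTransform_zeroExt fun s _ => ?_
  have h1 : (1 + p * (exp s - 1)) ^ N
      = ∑ j ∈ Finset.range (N + 1), (binom N p j : ℂ) * exp s ^ j := by
    rw [show 1 + p * (exp s - 1) = p * exp s + (1 - p) by ring, add_pow]
    refine Finset.sum_congr rfl fun j _ => ?_
    unfold binom
    push_cast
    ring
  rw [h1]
  refine hasSum_sum_of_ne_finset_zero fun j hj => ?_
  have : N < j := by simpa using hj
  simp [binom, Nat.choose_eq_zero_of_lt this]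

/-- Both sides are the rising factorial of `r` divided by `n!`. The right side is the form of the
coefficients in the binomial series of `(1 - y) ^ (-r)`. -/
theorem Gamma_add_natCast_div {r : ℝ} (hr : 0 < r) (n : ℕ) :
    Real.Gamma (r + n) / (n.factorial * Real.Gamma r) = Ring.choose (r + n - 1) n := by
  have hG := (Real.Gamma_pos_of_pos hr).ne'
  have hn : (n.factorial : ℝ) ≠ 0 := by positivity
  rw [Ring.choose_eq_smul, smul_eq_mul, div_eq_iff (by positivity)]
  have : (descPochhammer ℤ n).smeval (r + n - 1) = (ascPochhammer ℕ n).smeval r := by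
    rw [Polynomial.descPochhammer_smeval_eq_ascPochhammer]
    congr 1
    ring
  rw [this, Polynomial.ascPochhammer_smeval_eq_eval]
  have h2 : Real.Gamma (r + n) = (ascPochhammer ℝ n).eval r * Real.Gamma r := by
    induction n with
    | zero => simp
    | succ n ih =>
      have hrn : r + n ≠ 0 := by positivity
      rw [ascPochhammer_succ_eval, Nat.cast_succ, ← add_assoc, Real.Gamma_add_one hrn,
        ih (by positivity) (by
          rw [Polynomial.descPochhammer_smeval_eq_ascPochhammer]; ring_nf)]
      ring
  rw [h2]
  field_simp

/-- The masses are the coefficients of `q ^ r (1 - (1 - q) w) ^ (-r)`, and `1 - (1 - q) w = q (1 -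
(2g/l)(w - 1))`. The condition `8 g ≤ l` gives `1 - q ≤ 1/5`, so `(1 - q) e < 1` and the series
converges on the whole strip. The logarithmic form makes exponents comparable. -/
theorem hasTransform_negBin {l g : ℝ} (hl : 0 < l) (hg : 0 < g) (hgl : 8 * g ≤ l) :
    HasTransform (zeroExt (negBin (nbR l g) (nbQ l g)))
      (fun s => exp (-(nbR l g * log (1 - (2 * g / l : ℝ) * (exp s - 1))))) := by
  refine hasTransform_zeroExt fun s hs => ?_
  set r := nbR l g with hr
  set q := nbQ l g with hq
  have hr0 : 0 < r := by rw [hr]; unfold nbR; positivity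
  have hq0 : 0 < q := by rw [hq]; unfold nbQ; positivity
  have hq1 : 1 - q ≤ 1 / 5 := by
    rw [hq]; unfold nbQ
    rw [sub_le_iff_le_add, ← sub_le_iff_le_add', le_div_iff₀ (by positivity)]
    linarith
  have hq2 : 0 ≤ 1 - q := by
    rw [hq]; unfold nbQ
    rw [sub_nonneg, div_le_one (by positivity)]
    linarith
  set y : ℂ := (1 - q : ℝ) * exp s with hy
  have hy1 : ‖y‖ < 1 := by
    rw [hy, norm_mul, Complex.norm_real, Real.norm_eq_abs, abs_of_nonneg hq2, Complex.norm_exp]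
    have h1 : Real.exp s.re ≤ Real.exp 1 := Real.exp_le_exp.mpr (abs_le.mp hs).2
    have := Real.exp_one_lt_d9
    nlinarith [Real.exp_pos s.re]
  have h1 := (one_div_one_sub_cpow_hasFPowerSeriesOnBall_zero (r : ℂ)).hasSum (y := y)
    (by simpa [← ofReal_norm] using hy1)
  have h2 := h1.mul_left ((q : ℂ) ^ (r : ℂ))
  have hyy : 1 - y = q * (1 - (2 * g / l : ℝ) * (exp s - 1)) := by
    rw [hy, hq]; unfold nbQ
    have : (l : ℂ) + 2 * g ≠ 0 := by exact_mod_cast (by positivity : l + 2 * g ≠ 0)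
    have : (l : ℂ) ≠ 0 := by exact_mod_cast hl.ne'
    push_cast
    field_simp
    ring
  have hne : 1 - (2 * g / l : ℝ) * (exp s - 1) ≠ 0 := by
    intro h0
    rw [h0, mul_zero, sub_eq_zero] at hyy
    rw [← hyy] at hy1
    simp at hy1
  have h3 : ∀ n : ℕ, (FormalMultilinearSeries.ofScalars ℂ (𝕜 := ℂ)
      (fun n => Ring.choose ((r : ℂ) + n - 1) n)) n (fun _ => y)
        = Ring.choose ((r : ℂ) + n - 1) n * y ^ n := fun n => by
    simp [FormalMultilinearSeries.ofScalars]
  refine h2.of_eq (fun n => ?_) ?_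
  · refine Eq.trans ?_ (congrArg (fun v => (q : ℂ) ^ (r : ℂ) * v) (h3 n)).symm
    simp only [negBin]
    rw [Gamma_add_natCast_div hr0, hy, mul_pow, show (r : ℂ) + n - 1 = ((r + n - 1 : ℝ) : ℂ) by
      push_cast; rfl, ← Complex.ofReal_choose]
    push_cast
    rw [Complex.ofReal_cpow hq0.le]
    ring
  · have hqne : (q : ℂ) ≠ 0 := by exact_mod_cast hq0.ne'
    rw [zero_add, hyy, cpow_def_of_ne_zero hqne, cpow_def_of_ne_zero (mul_ne_zero hqne hne),
      Complex.log_ofReal_mul hq0 hne, ← Complex.ofReal_log hq0.le, add_mul, Complex.exp_add,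
      Complex.exp_neg, mul_comm (log _) (r : ℂ)]
    field_simp

end Transforms

/-! ### Gaussian bounds on the strip -/

section Strip
open Complex

/-- The part of the strip `|re s| ≤ 1 / √l`, `|im s| ≤ π` near the imaginary axis on which the
transforms are compared. -/
structure InStrip (l : ℝ) (s : ℂ) : Prop where
  one_le : 1 ≤ l
  re_le : |s.re| ≤ 1 / 2
  re_sq : l * s.re ^ 2 ≤ 1
  im_le : |s.im| ≤ Real.pi

/-- The exponent of the Gaussian bound of the transforms. -/
noncomputable def gaussExp (l : ℝ) (s : ℂ) : ℝ := l * s.re + 3 - l * s.im ^ 2 / 100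

/-- The quantity `exp (re s) (1 - cos (im s))` is isolated because it carries the whole dependence
on `im s`, with factor `-1` here and factor `2` in `‖exp s - 1‖²`. -/
theorem exp_sub_one_re (s : ℂ) :
    (exp s - 1).re = Real.exp s.re - 1 - Real.exp s.re * (1 - Real.cos s.im) := by
  rw [sub_re, exp_re, one_re]; ring

theorem norm_exp_sub_one_sq (s : ℂ) :
    ‖exp s - 1‖ ^ 2 = (Real.exp s.re - 1) ^ 2 + 2 * (Real.exp s.re * (1 - Real.cos s.im)) := by
  rw [← normSq_eq_norm_sq, normSq_apply, sub_re, sub_im, exp_re, exp_im, one_re, one_im]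
  linear_combination Real.exp s.re ^ 2 * Real.sin_sq_add_cos_sq s.im

theorem exp_half_bounds {h : ℝ} (hh : |h| ≤ 1 / 2) :
    1 / 2 ≤ Real.exp h ∧ Real.exp h ≤ 5 / 3 ∧ Real.exp h - 1 - h ≤ h ^ 2 ∧ 0 ≤ Real.exp h - 1 - h ∧
      (Real.exp h - 1) ^ 2 ≤ 9 / 4 * h ^ 2 := by
  have hh' := abs_le.mp hh
  have h1 := abs_le.mp (Real.abs_exp_sub_one_sub_id_le (x := h) (by linarith))
  have h2 := Real.add_one_le_exp h
  have h3 : Real.exp h ≤ 5 / 3 := by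
    have h4 : Real.exp h ≤ Real.exp (1 / 2) := Real.exp_le_exp.mpr hh'.2
    have h5 : Real.exp (1 / 2) ^ 2 = Real.exp 1 := by rw [← Real.exp_nat_mul]; norm_num
    nlinarith [Real.exp_one_lt_d9, Real.exp_pos (1 / 2 : ℝ)]
  refine ⟨by linarith, h3, h1.2, by linarith, ?_⟩
  have h6 : |Real.exp h - 1| ≤ 3 / 2 * |h| := by
    have : Real.exp h - 1 = (Real.exp h - 1 - h) + h := by ring
    rw [this]
    refine (abs_add_le _ _).trans ?_
    have h7 : |Real.exp h - 1 - h| ≤ h ^ 2 := Real.abs_exp_sub_one_sub_id_le (by linarith)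
    have h8 : h ^ 2 ≤ 1 / 2 * |h| := by rw [← sq_abs]; nlinarith [abs_nonneg h]
    linarith
  rw [← sq_abs, ← sq_abs h]
  nlinarith [abs_nonneg (Real.exp h - 1), abs_nonneg h]

namespace InStrip
variable {l : ℝ} {s : ℂ} (hs : InStrip l s)
include hs

theorem cos_bound : s.im ^ 2 / 10 ≤ Real.exp s.re * (1 - Real.cos s.im) ∧
    Real.exp s.re * (1 - Real.cos s.im) ≤ s.im ^ 2 := by
  have h1 := Real.cos_le_one_sub_mul_cos_sq hs.im_le
  have h2 := Real.one_sub_sq_div_two_le_cos (x := s.im)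
  obtain ⟨h3, h4, -⟩ := exp_half_bounds hs.re_le
  have h5 : 1 / 5 ≤ 2 / Real.pi ^ 2 := by
    rw [div_le_div_iff₀ (by norm_num) (by positivity)]
    nlinarith [Real.pi_lt_d2, Real.pi_pos]
  have h6 : 1 / 5 * s.im ^ 2 ≤ 1 - Real.cos s.im := by nlinarith [sq_nonneg s.im]
  constructor <;> nlinarith [sq_nonneg s.im]

theorem norm_le : ‖exp s - 1‖ ≤ 2 * ‖s‖ := by
  have h1 := norm_exp_sub_one_sq s
  obtain ⟨-, h2⟩ := hs.cos_bound
  obtain ⟨-, -, -, -, h3⟩ := exp_half_bounds hs.re_le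
  have h4 : ‖s‖ ^ 2 = s.re ^ 2 + s.im ^ 2 := by
    rw [← normSq_eq_norm_sq, normSq_apply]; ring
  refine abs_le_of_sq_le_sq' ?_ (by positivity) |>.2
  nlinarith [sq_nonneg s.re, sq_nonneg s.im]

theorem norm_le_const : ‖exp s - 1‖ ≤ 8 / 3 := by
  refine (norm_sub_le _ _).trans ?_
  rw [norm_exp, norm_one]
  linarith [(exp_half_bounds hs.re_le).2.1]

/-- With `c = exp (re s) (1 - cos (im s))` the left side contains `-(1 - 2κ) l c`. For `κ ≤ 9/20` at
least `l c / 10` survives, and `c ≥ (im s)² / 10` gives the Gaussian. The remaining excess is at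
most `2.1 l (re s)²`, hence less than `3` on the strip. -/
theorem le_gaussExp {κ : ℝ} (hκ : κ ≤ 9 / 20) :
    l * (exp s - 1).re + κ * l * ‖exp s - 1‖ ^ 2 ≤ gaussExp l s := by
  rw [norm_exp_sub_one_sq, exp_sub_one_re]
  unfold gaussExp
  obtain ⟨h2, -⟩ := hs.cos_bound
  obtain ⟨-, -, h3, -, h4⟩ := exp_half_bounds hs.re_le
  set c := Real.exp s.re * (1 - Real.cos s.im)
  have hl := hs.one_le
  have h5 : κ * (Real.exp s.re - 1) ^ 2 ≤ 9 / 20 * (9 / 4 * s.re ^ 2) := by gcongr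
  have hc : 0 ≤ c := le_trans (by positivity) h2
  have h6 : κ * (2 * c) ≤ 9 / 10 * c := by nlinarith
  have h7 : (Real.exp s.re - 1 - c) + κ * ((Real.exp s.re - 1) ^ 2 + 2 * c)
      ≤ s.re + 2.1 * s.re ^ 2 - s.im ^ 2 / 100 := by nlinarith [sq_nonneg s.re]
  have h8 := hs.re_sq
  have h9 := mul_le_mul_of_nonneg_left h7 (by linarith : (0 : ℝ) ≤ l)
  nlinarith

theorem norm_le_four : ‖s‖ ≤ 4 := by
  refine (Complex.norm_le_abs_re_add_abs_im s).trans ?_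
  linarith [hs.re_le, hs.im_le, Real.pi_lt_d2]

end InStrip

/-- Mean value inequality on the convex half-plane `re ≤ M`: once both exponents have real part at
most `gaussExp`, only their difference has to be estimated. -/
theorem norm_exp_sub_exp_le {a b : ℂ} {M : ℝ} (ha : a.re ≤ M) (hb : b.re ≤ M) :
    ‖exp a - exp b‖ ≤ ‖a - b‖ * Real.exp M := by
  have h := Convex.norm_image_sub_le_of_norm_deriv_le (𝕜 := ℂ) (f := exp) (s := {z : ℂ | z.re ≤ M})
    (C := Real.exp M) (x := b) (y := a) (fun _ _ => differentiableAt_exp)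
    (fun z hz => by rw [Complex.deriv_exp, norm_exp]; exact Real.exp_le_exp.mpr hz)
    (convex_halfSpace_re_le M) hb ha
  rw [mul_comm]; exact h

theorem norm_exp_sub_one_sub_le (u : ℂ) : ‖exp u - 1 - u‖ ≤ ‖u‖ ^ 2 * Real.exp ‖u‖ := by
  have := norm_exp_sub_sum_le_norm_mul_exp u 2
  simpa [Finset.sum_range_succ, sub_sub] using this

theorem norm_exp_sub_quadratic_le (u : ℂ) :
    ‖exp u - 1 - u - u ^ 2 / 2‖ ≤ ‖u‖ ^ 3 * Real.exp ‖u‖ := by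
  have := norm_exp_sub_sum_le_norm_mul_exp u 3
  simpa [Finset.sum_range_succ, sub_sub, add_assoc, Nat.factorial] using this

/-! ### Comparison of the approximating measures with `exp (l z + g z ^ 2)` -/

theorem re_mul_sq_le (g : ℝ) (z : ℂ) : ((g : ℂ) * z ^ 2).re ≤ |g| * ‖z‖ ^ 2 := by
  refine (re_le_norm _).trans ?_
  rw [norm_mul, norm_pow, norm_real, Real.norm_eq_abs]

theorem re_compPois_le {l g : ℝ} {s : ℂ} (hs : InStrip l s) {κ : ℝ} (hg : |g| ≤ κ * l)
    (hκ : κ ≤ 9 / 20) : (l * (exp s - 1) + g * (exp s - 1) ^ 2).re ≤ gaussExp l s := by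
  have hl := hs.one_le
  have h1 := re_mul_sq_le g (exp s - 1)
  have h2 := hs.le_gaussExp hκ
  rw [add_re, re_ofReal_mul]
  nlinarith [mul_le_mul_of_nonneg_right hg (sq_nonneg ‖exp s - 1‖)]

theorem norm_compPois_sub_pois_le {l g : ℝ} {s : ℂ} (hs : InStrip l s) (hg : |g| ≤ 2 / 25 * l) :
    ‖exp (l * (exp s - 1) + g * (exp s - 1) ^ 2) - exp (l * (exp s - 1))‖
      ≤ 4 * |g| * ‖s‖ ^ 2 * Real.exp (gaussExp l s) := by
  have h1 := re_compPois_le hs hg (by norm_num)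
  have h2 := re_compPois_le (g := 0) (κ := 0) hs (by simp) (by norm_num)
  simp only [ofReal_zero, zero_mul, add_zero] at h2
  refine (norm_exp_sub_exp_le h1 h2).trans ?_
  gcongr
  rw [add_sub_cancel_left, norm_mul, norm_pow, norm_real, Real.norm_eq_abs]
  calc |g| * ‖exp s - 1‖ ^ 2 ≤ |g| * (2 * ‖s‖) ^ 2 := by gcongr; exact hs.norm_le
    _ = _ := by ring

/-- Taylor expansion of `exp u` at `u = g z²`. The factor `exp ‖u‖` of the remainder is absorbed
into the Gaussian, because `‖u‖ ≤ (2/25) l ‖z‖²` is far below the threshold of `le_gaussExp`. -/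
theorem norm_compPois_sub_pois₁_le {l g : ℝ} {s : ℂ} (hs : InStrip l s) (hg : |g| ≤ 2 / 25 * l) :
    ‖exp (l * (exp s - 1) + g * (exp s - 1) ^ 2)
      - (exp (l * (exp s - 1)) + g * (exp s - 1) ^ 2 * exp (l * (exp s - 1)))‖
      ≤ 16 * g ^ 2 * ‖s‖ ^ 4 * Real.exp (gaussExp l s) := by
  set u := (g : ℂ) * (exp s - 1) ^ 2 with hu
  have hun : ‖u‖ = |g| * ‖exp s - 1‖ ^ 2 := by
    rw [hu, norm_mul, norm_pow, norm_real, Real.norm_eq_abs]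
  have h1 : exp (l * (exp s - 1) + u) - (exp (l * (exp s - 1)) + u * exp (l * (exp s - 1)))
      = exp (l * (exp s - 1)) * (exp u - 1 - u) := by rw [Complex.exp_add]; ring
  rw [h1, norm_mul, norm_exp, re_ofReal_mul]
  have h2 := hs.le_gaussExp (κ := 2 / 25) (by norm_num)
  have h3 : l * (exp s - 1).re + ‖u‖ ≤ gaussExp l s := by
    rw [hun]
    nlinarith [mul_le_mul_of_nonneg_right hg (sq_nonneg ‖exp s - 1‖)]
  calc _ ≤ Real.exp (l * (exp s - 1).re) * (‖u‖ ^ 2 * Real.exp ‖u‖) := by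
        gcongr; exact norm_exp_sub_one_sub_le u
    _ = ‖u‖ ^ 2 * Real.exp (l * (exp s - 1).re + ‖u‖) := by rw [Real.exp_add]; ring
    _ ≤ (|g| * (2 * ‖s‖) ^ 2) ^ 2 * Real.exp (gaussExp l s) := by
        rw [hun] at h3 ⊢
        gcongr
        exact hs.norm_le
    _ = _ := by rw [mul_pow, sq_abs]; ring

/-- This is `log (1 + z) = z - z² / 2 + O(z³)` with `z = exp s - 1`, in a form free of branches of
the logarithm; it linearizes the translation in the translated Poisson law. -/
theorem norm_exp_sub_one_sub_self_sub_le {s : ℂ} (hs : ‖s‖ ≤ 4) :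
    ‖exp s - 1 - s - (exp s - 1) ^ 2 / 2‖ ≤ 3 * Real.exp 8 * ‖s‖ ^ 3 := by
  have h1 := norm_exp_sub_quadratic_le s
  have h2 := norm_exp_sub_one_sub_le s
  have he : Real.exp ‖s‖ ≤ Real.exp 4 := Real.exp_le_exp.mpr hs
  -- With `d = exp s - 1 - s`, the square is `(s + d)² = s² + d (d + 2 s)`.
  have h3 : exp s - 1 - s - (exp s - 1) ^ 2 / 2 = (exp s - 1 - s - s ^ 2 / 2)
      - (exp s - 1 - s) * ((exp s - 1 - s) + 2 * s) / 2 := by ring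
  have h48 : Real.exp 8 = Real.exp 4 * Real.exp 4 := by rw [← Real.exp_add]; norm_num
  have h4 : (4 : ℝ) + 1 ≤ Real.exp 4 := Real.add_one_le_exp 4
  have h5 : ‖exp s - 1 - s‖ ≤ ‖s‖ ^ 2 * Real.exp 4 := h2.trans (by gcongr)
  have h6 : ‖(exp s - 1 - s) + 2 * s‖ ≤ ‖s‖ * (4 * Real.exp 4 + 2) := by
    refine (norm_add_le _ _).trans ?_
    rw [norm_mul]
    have : ‖(2 : ℂ)‖ = 2 := by simp
    rw [this]
    nlinarith [norm_nonneg s, mul_nonneg (norm_nonneg s) (Real.exp_pos 4).le]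
  rw [h3]
  refine (norm_sub_le _ _).trans ?_
  rw [norm_div, norm_mul]
  have : ‖(2 : ℂ)‖ = 2 := by simp
  rw [this]
  calc _ ≤ ‖s‖ ^ 3 * Real.exp 4
        + (‖s‖ ^ 2 * Real.exp 4) * (‖s‖ * (4 * Real.exp 4 + 2)) / 2 := by
        gcongr
        exact h1.trans (by gcongr)
    _ = ‖s‖ ^ 3 * (Real.exp 4 + Real.exp 4 * (2 * Real.exp 4 + 1)) := by ring
    _ ≤ ‖s‖ ^ 3 * (3 * Real.exp 8) := by
        gcongr
        rw [h48]; nlinarith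
    _ = _ := by ring

theorem norm_compPois_sub_transPois_le {l g : ℝ} {s : ℂ} (hs : InStrip l s)
    (hg : |g| ≤ 2 / 25 * l) :
    ‖exp (l * (exp s - 1) + g * (exp s - 1) ^ 2) - exp ((⌊-2 * g⌋ : ℤ) * s
      + ((l + 2 * g + Int.fract (-2 * g) : ℝ) : ℂ) * (exp s - 1))‖
      ≤ (4 * Int.fract (-2 * g) * ‖s‖ ^ 2
          + 6 * Real.exp 8 * (|g| + Int.fract (-2 * g)) * ‖s‖ ^ 3)
        * Real.exp (gaussExp l s) := by
  set δ := Int.fract (-2 * g) with hδ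
  have hδ0 : 0 ≤ δ := Int.fract_nonneg _
  have hδ1 : δ < 1 := Int.fract_lt_one _
  have hm : ((⌊-2 * g⌋ : ℤ) : ℝ) = -2 * g - δ := by rw [hδ, Int.fract]; ring
  have hmc : ((⌊-2 * g⌋ : ℤ) : ℂ) = ((-2 * g - δ : ℝ) : ℂ) := by rw [← hm]; push_cast; rfl
  rw [hmc]
  have hg' := abs_le.mp hg
  have hl := hs.one_le
  have h1 := re_compPois_le hs hg (by norm_num)
  -- The translation and the Poisson parameter add up to the mean `l`, so the linear term is exactly
  -- `l re s`; the Poisson parameter lies between `l / 10` and `3 l`, which suffices for the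
  -- Gaussian bound.
  have h2 : (((-2 * g - δ : ℝ) : ℂ) * s + ((l + 2 * g + δ : ℝ) : ℂ) * (exp s - 1)).re
      ≤ gaussExp l s := by
    rw [add_re, re_ofReal_mul, re_ofReal_mul, exp_sub_one_re]
    unfold gaussExp
    obtain ⟨h2, -⟩ := hs.cos_bound
    obtain ⟨-, -, h3, h4, -⟩ := exp_half_bounds hs.re_le
    set c := Real.exp s.re * (1 - Real.cos s.im)
    have hc : 0 ≤ c := le_trans (by positivity) h2
    have h5 : (l + 2 * g + δ) * (Real.exp s.re - 1 - s.re) ≤ 3 * l * s.re ^ 2 := by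
      apply mul_le_mul _ h3 h4 (by linarith)
      linarith
    have h6 : l * (s.im ^ 2 / 100) ≤ (l + 2 * g + δ) * c := by
      have : l * (s.im ^ 2 / 100) ≤ (l / 10) * c := by nlinarith
      refine this.trans ?_
      gcongr
      linarith
    nlinarith [hs.re_sq]
  refine (norm_exp_sub_exp_le h1 h2).trans ?_
  gcongr
  -- Translation by `-2g - δ` reproduces `g z²` to second order; only the rounding `δ` leaves a term
  -- in `z²`.
  have h3 : l * (exp s - 1) + g * (exp s - 1) ^ 2 - (((-2 * g - δ : ℝ) : ℂ) * s
      + ((l + 2 * g + δ : ℝ) : ℂ) * (exp s - 1))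
      = -((δ / 2 : ℝ) * (exp s - 1) ^ 2)
        - ((2 * g + δ : ℝ) : ℂ) * (exp s - 1 - s - (exp s - 1) ^ 2 / 2) := by
    push_cast; ring
  rw [h3]
  refine (norm_sub_le _ _).trans ?_
  rw [norm_neg, norm_mul, norm_mul, norm_pow, norm_real, norm_real, Real.norm_eq_abs,
    Real.norm_eq_abs, abs_of_nonneg (by positivity : 0 ≤ δ / 2)]
  have h4 := norm_exp_sub_one_sub_self_sub_le hs.norm_le_four
  have h5 : |2 * g + δ| ≤ 2 * (|g| + δ) := by
    refine (abs_add_le _ _).trans ?_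
    rw [abs_mul, abs_of_nonneg hδ0, abs_two]; linarith
  calc _ ≤ δ / 2 * (2 * ‖s‖) ^ 2 + 2 * (|g| + δ) * (3 * Real.exp 8 * ‖s‖ ^ 3) := by
        gcongr
        exact hs.norm_le
    _ ≤ _ := by
        have : 0 ≤ δ * ‖s‖ ^ 2 := by positivity
        nlinarith

/-- The parameters satisfy `r ρ = l`, `r ρ² = 2 g` and `r ρ³ = 4 g² / l` for `ρ = 2 g / l`. Hence
`-r log (1 - ρ z)` expands as `l z + g z²` with a cubic error of order `g² / l`. -/
theorem norm_compPois_sub_negBin_le {l g : ℝ} {s : ℂ} (hs : InStrip l s) (hg0 : 0 < g)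
    (hg : g ≤ 2 / 25 * l) :
    ‖exp (l * (exp s - 1) + g * (exp s - 1) ^ 2)
      - exp (-(nbR l g * log (1 - (2 * g / l : ℝ) * (exp s - 1))))‖
      ≤ 32 * (g ^ 2 / l) * ‖s‖ ^ 3 * Real.exp (gaussExp l s) := by
  have hl := hs.one_le
  have hl0 : 0 < l := by linarith
  set z := exp s - 1 with hz
  set ρ := 2 * g / l with hρ
  have hρ0 : 0 < ρ := by positivity
  have hρ1 : ρ ≤ 4 / 25 := by rw [hρ, div_le_iff₀ hl0]; linarith
  set r := nbR l g with hr
  have hr0 : 0 < r := by rw [hr]; unfold nbR; positivity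
  have hrl : r * ρ = l := by rw [hr, hρ]; unfold nbR; field_simp
  have hrl2 : r * ρ ^ 2 = 2 * g := by rw [pow_two, ← mul_assoc, hrl, hρ]; field_simp
  have hrl3 : r * ρ ^ 3 = 4 * (g ^ 2 / l) := by
    rw [pow_succ, ← mul_assoc, hrl2, hρ]; ring
  set u : ℂ := -((ρ : ℂ) * z) with hu
  have hun : ‖u‖ = ρ * ‖z‖ := by
    rw [hu, norm_neg, norm_mul, norm_real, Real.norm_eq_abs, abs_of_pos hρ0]
  have hzc : ‖z‖ ≤ 8 / 3 := hs.norm_le_const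
  have hu1 : ‖u‖ ≤ 1 / 2 := by rw [hun]; nlinarith [norm_nonneg z]
  have h1 := norm_log_sub_logTaylor_le 2 (z := u) (by linarith)
  have h2 : logTaylor 3 u = u - u ^ 2 / 2 := by
    simp [logTaylor, Finset.sum_range_succ]; ring
  rw [h2] at h1
  have h3 : ‖log (1 + u) - (u - u ^ 2 / 2)‖ ≤ ‖u‖ ^ 3 := by
    refine h1.trans ?_
    have : (1 - ‖u‖)⁻¹ ≤ 2 := by
      rw [inv_le_comm₀ (by linarith) (by norm_num)]; linarith
    have h4 : 0 ≤ ‖u‖ ^ 3 := by positivity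
    norm_num
    nlinarith
  have h4 : (l : ℂ) * z + g * z ^ 2 - -(r * log (1 - ρ * z))
      = r * (log (1 + u) - (u - u ^ 2 / 2)) := by
    have e1 : (l : ℂ) = r * ρ := by exact_mod_cast hrl.symm
    have e2 : (g : ℂ) = r * ρ ^ 2 / 2 := by
      have : g = r * ρ ^ 2 / 2 := by rw [hrl2]; ring
      exact_mod_cast this
    rw [e1, e2, hu, sub_eq_add_neg 1]
    ring
  have h5 : ‖(l : ℂ) * z + g * z ^ 2 - -(r * log (1 - ρ * z))‖ ≤ 4 * (g ^ 2 / l) * ‖z‖ ^ 3 := by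
    rw [h4, norm_mul, norm_real, Real.norm_eq_abs, abs_of_pos hr0]
    calc _ ≤ r * ‖u‖ ^ 3 := by gcongr
      _ = r * ρ ^ 3 * ‖z‖ ^ 3 := by rw [hun]; ring
      _ = _ := by rw [hrl3]
  have h6 : 4 * (g ^ 2 / l) * ‖z‖ ^ 3 ≤ 2 / 25 * l * ‖z‖ ^ 2 := by
    have h7 : g ^ 2 / l ≤ 4 / 625 * l := by
      rw [div_le_iff₀ hl0]; nlinarith
    have h8 : ‖z‖ ^ 3 ≤ 8 / 3 * ‖z‖ ^ 2 := by
      rw [pow_succ, mul_comm]; gcongr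
    calc 4 * (g ^ 2 / l) * ‖z‖ ^ 3 ≤ 4 * (4 / 625 * l) * (8 / 3 * ‖z‖ ^ 2) := by gcongr
      _ ≤ _ := by
        have : 0 ≤ l * ‖z‖ ^ 2 := by positivity
        nlinarith
  have hga : |g| ≤ 2 / 25 * l := by rwa [abs_of_pos hg0]
  -- One share `2/25` is for `g z²`, the other for the cubic error bounded in `h6`.
  have h8 := hs.le_gaussExp (κ := 4 / 25) (by norm_num)
  rw [← hz] at h8
  have h9 : ((l : ℂ) * z + g * z ^ 2).re ≤ l * z.re + 2 / 25 * l * ‖z‖ ^ 2 := by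
    rw [add_re, re_ofReal_mul]
    have := re_mul_sq_le g z
    nlinarith [mul_le_mul_of_nonneg_right hga (sq_nonneg ‖z‖)]
  have h10 : (-(r * log (1 - ρ * z))).re ≤ gaussExp l s := by
    have h11 := (abs_le.mp (abs_re_le_norm ((l : ℂ) * z + g * z ^ 2 - -(r * log (1 - ρ * z))))).1
    rw [sub_re] at h11
    linarith
  refine (norm_exp_sub_exp_le (re_compPois_le hs hga (by norm_num)) h10).trans ?_
  gcongr
  refine h5.trans ?_
  calc 4 * (g ^ 2 / l) * ‖z‖ ^ 3 ≤ 4 * (g ^ 2 / l) * (2 * ‖s‖) ^ 3 := by gcongr; exact hs.norm_le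
    _ = _ := by ring

theorem norm_pow_sub_pow_le {a b : ℂ} {m : ℝ} (N : ℕ) (ha : ‖a‖ ≤ m) (hb : ‖b‖ ≤ m) :
    ‖a ^ N - b ^ N‖ ≤ N * ‖a - b‖ * m ^ (N - 1) := by
  have hm : 0 ≤ m := (norm_nonneg a).trans ha
  rw [← (Commute.all a b).mul_geom_sum₂ N, norm_mul, mul_comm (N : ℝ), mul_assoc]
  gcongr
  have h : ∀ i ∈ Finset.range N, ‖a ^ i * b ^ (N - 1 - i)‖ ≤ m ^ (N - 1) := by
    intro i hi
    have hi' : N - 1 = i + (N - 1 - i) := by have := Finset.mem_range.mp hi; omega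
    calc ‖a ^ i * b ^ (N - 1 - i)‖ ≤ m ^ i * m ^ (N - 1 - i) := by
          rw [norm_mul, norm_pow, norm_pow]; gcongr
      _ = m ^ (N - 1) := by rw [← pow_add, ← hi']
  have h2 := norm_sum_le_of_le _ h
  simpa using h2

/-- Squaring keeps the sign of `re y`; the bound `‖1 + y‖ ≤ exp ‖y‖` would lose the Gaussian decay.
-/
theorem norm_one_add_le (y : ℂ) : ‖1 + y‖ ≤ Real.exp (y.re + ‖y‖ ^ 2 / 2) := by
  have h1 : ‖1 + y‖ ^ 2 = 1 + (2 * y.re + ‖y‖ ^ 2) := by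
    rw [← normSq_eq_norm_sq, ← normSq_eq_norm_sq, normSq_apply, normSq_apply, add_re, add_im,
      one_re, one_im]
    ring
  have h2 := Real.add_one_le_exp (2 * y.re + ‖y‖ ^ 2)
  have h3 : Real.exp (2 * y.re + ‖y‖ ^ 2) = Real.exp (y.re + ‖y‖ ^ 2 / 2) ^ 2 := by
    rw [← Real.exp_nat_mul]; congr 1; push_cast; ring
  refine abs_le_of_sq_le_sq' ?_ (Real.exp_pos _).le |>.2
  linarith

/-- Comparison of one binomial factor with the `N`-th root of the target. Expanding at `v = p z - c
z²`, the linear terms cancel and the quadratic coefficient is `p² / 2 - c`, which would vanish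
without the rounding of `N`. -/
theorem norm_exp_sub_one_add_le {p c d : ℝ} {z : ℂ} (hp0 : 0 < p) (hp1 : p ≤ 1 / 5) (hc0 : 0 < c)
    (hcp : c ≤ 2 / 25 * p) (hd : |p ^ 2 / 2 - c| ≤ d) (hzc : ‖z‖ ≤ 8 / 3) :
    ‖exp (p * z - c * z ^ 2) - (1 + (p : ℂ) * z)‖
      ≤ d * ‖z‖ ^ 2 + (5 * p ^ 3 + 2 * (p * c)) * ‖z‖ ^ 3 := by
  have hpz : ‖(p : ℂ) * z‖ = p * ‖z‖ := by
    rw [norm_mul, norm_real, Real.norm_eq_abs, abs_of_pos hp0]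
  have hcz : ‖(c : ℂ) * z ^ 2‖ = c * ‖z‖ ^ 2 := by
    rw [norm_mul, norm_real, Real.norm_eq_abs, abs_of_pos hc0, norm_pow]
  set v : ℂ := p * z - c * z ^ 2 with hv
  have hvn : ‖v‖ ≤ 5 / 4 * (p * ‖z‖) := by
    refine (norm_sub_le _ _).trans ?_
    rw [hpz, hcz]
    have : c * ‖z‖ ^ 2 ≤ (2 / 25 * p) * (8 / 3 * ‖z‖) := by
      rw [pow_two]; gcongr
    have : 0 ≤ p * ‖z‖ := by positivity
    linarith
  have hv1 : ‖v‖ ≤ 2 / 3 := by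
    have : p * ‖z‖ ≤ 1 / 5 * (8 / 3) := by gcongr
    linarith
  have hexpv : Real.exp ‖v‖ ≤ 5 / 2 := by
    have : Real.exp ‖v‖ ≤ Real.exp (2 / 3) := Real.exp_le_exp.mpr hv1
    have h5 : Real.exp (2 / 3) ^ 3 = Real.exp 1 ^ 2 := by
      rw [← Real.exp_nat_mul, ← Real.exp_nat_mul]; norm_num
    have h6 := Real.exp_one_lt_d9
    have h7 : Real.exp 1 ^ 2 ≤ (5 / 2) ^ 3 := by nlinarith [Real.exp_pos 1]
    have h8 : Real.exp (2 / 3) ≤ 5 / 2 := by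
      by_contra h
      push Not at h
      have := pow_lt_pow_left₀ h (by norm_num) (n := 3) (by norm_num)
      linarith
    linarith
  have h1 : exp v - (1 + (p : ℂ) * z) = (exp v - 1 - v - v ^ 2 / 2)
      + ((p ^ 2 / 2 - c : ℝ) : ℂ) * z ^ 2 - ((p * c : ℝ) : ℂ) * z ^ 3
      + ((c ^ 2 / 2 : ℝ) : ℂ) * z ^ 4 := by
    rw [hv]; push_cast; ring
  have h2 : ‖exp v - 1 - v - v ^ 2 / 2‖ ≤ 5 * p ^ 3 * ‖z‖ ^ 3 := by
    refine (norm_exp_sub_quadratic_le v).trans ?_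
    calc ‖v‖ ^ 3 * Real.exp ‖v‖ ≤ (5 / 4 * (p * ‖z‖)) ^ 3 * (5 / 2) := by gcongr
      _ = (625 / 128) * (p ^ 3 * ‖z‖ ^ 3) := by ring
      _ ≤ _ := by
        have : 0 ≤ p ^ 3 * ‖z‖ ^ 3 := by positivity
        linarith
  have h4 : c ^ 2 / 2 * ‖z‖ ^ 4 ≤ p * c * ‖z‖ ^ 3 := by
    have : c ^ 2 / 2 * ‖z‖ ^ 4 = (c * ‖z‖ / 2) * (c * ‖z‖ ^ 3) := by ring
    rw [this, mul_assoc p]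
    gcongr
    nlinarith [mul_le_mul hcp hzc (norm_nonneg z) (by positivity)]
  rw [h1]
  have n1 := norm_add_le ((exp v - 1 - v - v ^ 2 / 2) + ((p ^ 2 / 2 - c : ℝ) : ℂ) * z ^ 2
    - ((p * c : ℝ) : ℂ) * z ^ 3) (((c ^ 2 / 2 : ℝ) : ℂ) * z ^ 4)
  have n2 := norm_sub_le ((exp v - 1 - v - v ^ 2 / 2) + ((p ^ 2 / 2 - c : ℝ) : ℂ) * z ^ 2)
    (((p * c : ℝ) : ℂ) * z ^ 3)
  have n3 := norm_add_le (exp v - 1 - v - v ^ 2 / 2) (((p ^ 2 / 2 - c : ℝ) : ℂ) * z ^ 2)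
  have m1 : ‖((p ^ 2 / 2 - c : ℝ) : ℂ) * z ^ 2‖ = |p ^ 2 / 2 - c| * ‖z‖ ^ 2 := by
    rw [norm_mul, norm_pow, norm_real, Real.norm_eq_abs]
  have m2 : ‖((p * c : ℝ) : ℂ) * z ^ 3‖ = p * c * ‖z‖ ^ 3 := by
    rw [norm_mul, norm_pow, norm_real, Real.norm_eq_abs, abs_of_pos (by positivity)]
  have m3 : ‖((c ^ 2 / 2 : ℝ) : ℂ) * z ^ 4‖ = c ^ 2 / 2 * ‖z‖ ^ 4 := by
    rw [norm_mul, norm_pow, norm_real, Real.norm_eq_abs, abs_of_pos (by positivity)]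
  have h5 : |p ^ 2 / 2 - c| * ‖z‖ ^ 2 ≤ d * ‖z‖ ^ 2 := by gcongr
  rw [m1] at n3
  rw [m2] at n2
  rw [m3] at n1
  linarith

theorem norm_compPois_sub_binom_le {l g : ℝ} {s : ℂ} (hs : InStrip l s) (hg0 : g < 0)
    (hg : -g ≤ 2 / 25 * l) :
    ‖exp (l * (exp s - 1) + g * (exp s - 1) ^ 2)
      - (1 + ((l / biN l g : ℝ) : ℂ) * (exp s - 1)) ^ biN l g‖
      ≤ (32 * (g ^ 2 / l ^ 2) * ‖s‖ ^ 2 + 1000 * (g ^ 2 / l) * ‖s‖ ^ 3)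
        * Real.exp (gaussExp l s) := by
  have hl := hs.one_le
  have hl0 : 0 < l := by linarith
  set z := exp s - 1 with hz
  obtain ⟨G, rfl⟩ : ∃ G, g = -G := ⟨-g, by ring⟩
  have hG0 : 0 < G := by linarith
  have hG : G ≤ 2 / 25 * l := by linarith
  set N := biN l (-G) with hN
  have hNdef : N = ⌊l ^ 2 / (2 * G)⌋₊ := by rw [hN]; unfold biN; rw [abs_neg, abs_of_pos hG0]
  have hN1 : (N : ℝ) ≤ l ^ 2 / (2 * G) := by rw [hNdef]; exact Nat.floor_le (by positivity)
  have hN2 : l ^ 2 / (2 * G) < N + 1 := by rw [hNdef]; exact Nat.lt_floor_add_one _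
  rw [le_div_iff₀ (by positivity)] at hN1
  rw [div_lt_iff₀ (by positivity)] at hN2
  -- From `l² < 2 G (N + 1)` and `G ≤ (2/25) l`. Together with `l ≥ 1` this makes `N` at least `5`,
  -- so that `N + 1` and `N` are comparable.
  have hN3 : 25 / 4 * l < N + 1 := by
    by_contra h
    push Not at h
    nlinarith
  have hN4 : 21 / 4 * l ≤ N := by linarith
  have hN0 : (0 : ℝ) < N := by linarith
  have hN5 : (N : ℝ) + 1 ≤ 6 / 5 * N := by linarith
  have hinv : 1 / (N : ℝ) ≤ 12 / 5 * (G / l ^ 2) := by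
    rw [mul_div_assoc', div_le_div_iff₀ hN0 (by positivity)]
    nlinarith
  set p := l / N with hp
  have hp0 : 0 < p := by positivity
  have hp1 : p ≤ 1 / 5 := by rw [hp, div_le_iff₀ hN0]; linarith
  have hNp : N * p = l := by rw [hp]; field_simp
  set c := G / N with hc
  have hc0 : 0 < c := by positivity
  have hNc : N * c = G := by rw [hc]; field_simp
  have hcp : c ≤ 2 / 25 * p := by
    rw [hc, hp, mul_div_assoc']; gcongr
  set v : ℂ := p * z - c * z ^ 2 with hv
  have hzc : ‖z‖ ≤ 8 / 3 := hs.norm_le_const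
  have hb : exp ((l : ℂ) * z + ((-G : ℝ) : ℂ) * z ^ 2) = exp v ^ N := by
    rw [← Complex.exp_nat_mul]
    congr 1
    have e1 : (l : ℂ) = N * p := by exact_mod_cast hNp.symm
    have e2 : (G : ℂ) = N * c := by exact_mod_cast hNc.symm
    push_cast
    rw [hv, e1, e2]
    ring
  rw [hb]
  set e := p * z.re + p / 10 * ‖z‖ ^ 2 with he
  have hpz : ‖(p : ℂ) * z‖ = p * ‖z‖ := by
    rw [norm_mul, norm_real, Real.norm_eq_abs, abs_of_pos hp0]
  have hcz : ‖(c : ℂ) * z ^ 2‖ = c * ‖z‖ ^ 2 := by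
    rw [norm_mul, norm_real, Real.norm_eq_abs, abs_of_pos hc0, norm_pow]
  have hz2 : 0 ≤ ‖z‖ ^ 2 := by positivity
  have ha1 : ‖1 + (p : ℂ) * z‖ ≤ Real.exp e := by
    refine (norm_one_add_le _).trans (Real.exp_le_exp.mpr ?_)
    rw [re_ofReal_mul, hpz, he, mul_pow]
    have : p ^ 2 * ‖z‖ ^ 2 ≤ p / 5 * ‖z‖ ^ 2 := by gcongr; nlinarith
    linarith
  have hb1 : ‖exp v‖ ≤ Real.exp e := by
    rw [norm_exp]
    refine Real.exp_le_exp.mpr ?_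
    rw [hv, sub_re, re_ofReal_mul, he]
    have := (abs_le.mp (abs_re_le_norm ((c : ℂ) * z ^ 2))).1
    rw [hcz] at this
    nlinarith
  refine (norm_pow_sub_pow_le N hb1 ha1).trans ?_
  have hNpos : 1 ≤ N := by
    have : (0 : ℝ) < (N : ℕ) := hN0
    exact_mod_cast this
  -- One factor is missing from the product. Since `e ≥ -3/5`, restoring it costs at most `exp (3/5)
  -- ≤ 2`.
  have hpow : Real.exp e ^ (N - 1) ≤ 2 * Real.exp (gaussExp l s) := by
    rw [← Real.exp_nat_mul, Nat.cast_sub hNpos, Nat.cast_one]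
    have h1 : (N : ℝ) * e ≤ gaussExp l s := by
      have h2 := hs.le_gaussExp (κ := 1 / 10) (by norm_num)
      have h3 : (N : ℝ) * e = l * z.re + 1 / 10 * l * ‖z‖ ^ 2 := by
        rw [he, ← hNp]; ring
      rw [h3]; exact h2
    have h4 : -(3 / 5) ≤ e := by
      have h5 := (abs_le.mp (abs_re_le_norm z)).1
      have h6 : p * ‖z‖ ≤ 1 / 5 * (8 / 3) := by gcongr
      have h7 : 0 ≤ p / 10 * ‖z‖ ^ 2 := by positivity
      nlinarith
    have h8 : Real.exp (3 / 5) ≤ 2 := by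
      by_contra h
      push Not at h
      have h9 : Real.exp (3 / 5) ^ 5 = Real.exp 1 ^ 3 := by
        rw [← Real.exp_nat_mul, ← Real.exp_nat_mul]; norm_num
      have h10 := pow_lt_pow_left₀ h (by norm_num) (n := 5) (by norm_num)
      have h11 : Real.exp 1 ^ 3 ≤ 2.72 ^ 3 := by
        gcongr; linarith [Real.exp_one_lt_d9]
      have h12 := h10.trans_le (h9.le.trans h11)
      norm_num at h12
    calc Real.exp (((N : ℝ) - 1) * e) ≤ Real.exp (3 / 5 + gaussExp l s) := by
          refine Real.exp_le_exp.mpr ?_; linarith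
      _ ≤ 2 * Real.exp (gaussExp l s) := by rw [Real.exp_add]; gcongr
  -- The floor defining `N` gives `0 ≤ l² - 2 G N < 2 G`.
  have hpcd : |p ^ 2 / 2 - c| ≤ c / N := by
    have e1 : p ^ 2 / 2 - c = (l ^ 2 - 2 * G * N) / (2 * N ^ 2) := by
      rw [hp, hc]; field_simp
    have e2 : c / N = (2 * G) / (2 * N ^ 2) := by rw [hc]; field_simp
    rw [e1, e2, abs_of_nonneg (div_nonneg (by linarith) (by positivity))]
    gcongr
    linarith
  have hab := norm_exp_sub_one_add_le hp0 hp1 hc0 hcp hpcd hzc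
  rw [← hv] at hab
  have hG2 : 0 ≤ G ^ 2 / l := by positivity
  have c1 : N * (c / N) ≤ 4 * (G ^ 2 / l ^ 2) := by
    calc N * (c / N) = G * (1 / N) := by rw [hc]; field_simp
      _ ≤ G * (12 / 5 * (G / l ^ 2)) := by gcongr
      _ = 12 / 5 * (G ^ 2 / l ^ 2) := by ring
      _ ≤ _ := by gcongr; norm_num
  have c2 : N * (5 * p ^ 3 + 2 * (p * c)) ≤ 50 * (G ^ 2 / l) := by
    have e1 : N * (5 * p ^ 3 + 2 * (p * c)) = 5 * l ^ 3 * (1 / N) ^ 2 + 2 * (l * G) * (1 / N) := by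
      rw [hp, hc]; field_simp
    rw [e1]
    calc _ ≤ 5 * l ^ 3 * (12 / 5 * (G / l ^ 2)) ^ 2 + 2 * (l * G) * (12 / 5 * (G / l ^ 2)) := by
          gcongr
      _ = (5 * (12 / 5) ^ 2 + 2 * (12 / 5)) * (G ^ 2 / l) := by field_simp
      _ ≤ _ := by gcongr; norm_num
  calc N * ‖exp v - (1 + (p : ℂ) * z)‖ * Real.exp e ^ (N - 1)
      ≤ (N * ((c / N) * ‖z‖ ^ 2 + (5 * p ^ 3 + 2 * (p * c)) * ‖z‖ ^ 3))
        * (2 * Real.exp (gaussExp l s)) := by gcongr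
    _ = ((N * (c / N)) * ‖z‖ ^ 2 + (N * (5 * p ^ 3 + 2 * (p * c))) * ‖z‖ ^ 3)
        * (2 * Real.exp (gaussExp l s)) := by ring
    _ ≤ ((4 * (G ^ 2 / l ^ 2)) * (2 * ‖s‖) ^ 2 + (50 * (G ^ 2 / l)) * (2 * ‖s‖) ^ 3)
        * (2 * Real.exp (gaussExp l s)) := by
        gcongr
        · exact hs.norm_le
        · exact hs.norm_le
    _ = (32 * (G ^ 2 / l ^ 2) * ‖s‖ ^ 2 + 800 * (G ^ 2 / l) * ‖s‖ ^ 3)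
        * Real.exp (gaussExp l s) := by ring
    _ ≤ _ := by
        rw [neg_sq]
        gcongr
        norm_num

end Strip

/-! ### The recursion for generating functions and its ratios -/

section Core

/-- A sequence that decays geometrically along every other index has sums controlled by its first
two terms. -/
theorem sum_range_le_of_two_step {u : ℕ → ℝ} {κ : ℝ} (hu : ∀ j, 0 ≤ u j) (hκ : κ < 1)
    (h : ∀ j, u (j + 2) ≤ κ * u j) (J : ℕ) :
    ∑ j ∈ Finset.range J, u j ≤ (u 0 + u 1) / (1 - κ) := by
  rw [le_div_iff₀ (by linarith)]
  have h1 : ∑ j ∈ Finset.range J, u j ≤ ∑ j ∈ Finset.range (J + 2), u j :=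
    Finset.sum_le_sum_of_subset_of_nonneg (by simp) (fun _ _ _ => hu _)
  rw [Finset.sum_range_succ', Finset.sum_range_succ'] at h1
  have h2 : ∑ j ∈ Finset.range J, u (j + 1 + 1) ≤ κ * ∑ j ∈ Finset.range J, u j := by
    rw [Finset.mul_sum]
    exact Finset.sum_le_sum fun j _ => h j
  simp only [zero_add] at h1
  linarith

/-- A ratio within `1/10` of `1` has modulus at least `9/10`, so each step backwards costs at most
`10/9`. Truncated subtraction makes the sequence constant below `0`, where the ratio is `f 0 / f 0 =
1`. -/
theorem norm_sub_le_of_ratio {f : ℕ → ℂ} {k : ℕ}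
    (hk : ∀ i ≤ k, f i ≠ 0 ∧ ‖f i / f (i - 1) - 1‖ ≤ 1 / 10) (j : ℕ) :
    ‖f (k - j)‖ ≤ (10 / 9) ^ j * ‖f k‖ := by
  induction j with
  | zero => simp
  | succ j ih =>
    obtain ⟨h1, h2⟩ := hk (k - j) (Nat.sub_le _ _)
    have h3 := (hk (k - j - 1) (by omega)).1
    have h4 : ‖f (k - j) - f (k - j - 1)‖ ≤ 1 / 10 * ‖f (k - j - 1)‖ := by
      have : f (k - j) - f (k - j - 1) = (f (k - j) / f (k - j - 1) - 1) * f (k - j - 1) := by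
        field_simp
      rw [this, norm_mul]
      gcongr
    have h5 : ‖f (k - j - 1)‖ ≤ ‖f (k - j)‖ + ‖f (k - j) - f (k - j - 1)‖ := by
      have := norm_sub_le (f (k - j)) (f (k - j) - f (k - j - 1))
      rwa [sub_sub_cancel] at this
    rw [show k - (j + 1) = k - j - 1 by omega, pow_succ]
    linarith

/-- The data of the recursion for the generating functions of the partial sums: `f k` is the
generating function of `S_k` at `1 + z`, `D j k` the expectation of the product of
`(1 + z) ^ X_i - 1` over the last `j` indices `i ≤ k`, and `E j k` the expectation of its norm;
`p`, `m₂`, `m₃` are factorial moments, `q`, `q₂`, `t` mixed moments. -/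
structure RecursionData (z : ℂ) (K : ℝ) (n : ℕ) (f : ℕ → ℂ) (D : ℕ → ℕ → ℂ) (E : ℕ → ℕ → ℝ)
    (p m₂ m₃ q q₂ t : ℕ → ℝ) : Prop where
  f_zero : f 0 = 1
  f_succ : ∀ k < n, f (k + 1) = f k
    + ∑ j ∈ Finset.range (k + 1), f (k - (j + 1)) * D (j + 1) (k + 1)
  D_eq_zero : ∀ j k, k < j → D j k = 0
  D_le : ∀ j k, ‖D j k‖ ≤ E j k
  E_two : ∀ j k, E (j + 3) k ≤ 1 / 24 * E (j + 1) k
  E_one : ∀ j k, E (j + 2) k ≤ 2.02 * E (j + 1) k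
  E1_le : ∀ k, E 1 k ≤ 0.0204
  E2_le : ∀ k, E 2 k ≤ 0.0413
  z_le : ‖z‖ ≤ 2.01
  one_le_K : 1 ≤ K
  p_nonneg : ∀ k, 0 ≤ p k
  m₂_nonneg : ∀ k, 0 ≤ m₂ k
  m₃_nonneg : ∀ k, 0 ≤ m₃ k
  q_nonneg : ∀ k, 0 ≤ q k
  q₂_nonneg : ∀ k, 0 ≤ q₂ k
  t_nonneg : ∀ k, 0 ≤ t k
  p_zero : p 0 = 0
  p_le : ∀ k, p k ≤ 1 / 100
  m₂_le : ∀ k, m₂ k ≤ p k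
  q_le : ∀ k, q k ≤ K * p k
  E1_le' : ∀ k, E 1 k ≤ 1.01 * (‖z‖ * p k)
  E2_le' : ∀ k, E 2 k ≤ 1.03 * (‖z‖ ^ 2 * q k)
  E3_le' : ∀ k, E 3 k ≤ K * (‖z‖ ^ 3 * t k)
  D1_first : ∀ k, ‖D 1 k - z * p k‖ ≤ 0.51 * (‖z‖ ^ 2 * m₂ k)
  D1_second : ∀ k, ‖D 1 k - z * p k - z ^ 2 * m₂ k / 2‖ ≤ K * (‖z‖ ^ 3 * m₃ k)
  D2_second : ∀ k, ‖D 2 k - z ^ 2 * q k‖ ≤ K * (‖z‖ ^ 3 * q₂ k)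

namespace RecursionData
variable {z : ℂ} {K : ℝ} {n : ℕ} {f : ℕ → ℂ} {D : ℕ → ℕ → ℂ} {E : ℕ → ℕ → ℝ}
  {p m₂ m₃ q q₂ t : ℕ → ℝ} (H : RecursionData z K n f D E p m₂ m₃ q q₂ t)
include H

theorem E_nonneg (j k : ℕ) : 0 ≤ E j k := (norm_nonneg _).trans (H.D_le j k)

/-- Two steps multiply the terms by at most `(10/9)² / 24 ≤ 1/19`, and `1 / (1 - 1/19) = 19/18`. -/
theorem tail_le (m k J : ℕ) :
    ∑ j ∈ Finset.range J, (10 / 9 : ℝ) ^ (j + m + 1) * E (j + m + 1) k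
      ≤ 19 / 18 * ((10 / 9) ^ (m + 1) * E (m + 1) k + (10 / 9) ^ (m + 2) * E (m + 2) k) := by
  refine (sum_range_le_of_two_step (κ := 1 / 19) (fun j => ?_) (by norm_num)
    (fun j => ?_) J).trans (le_of_eq ?_)
  · have := H.E_nonneg (j + m + 1) k
    positivity
  · have h1 := H.E_two (j + m) k
    have h2 := H.E_nonneg (j + m + 1) k
    have h3 : (0 : ℝ) < (10 / 9 : ℝ) ^ (j + m + 1) := by positivity
    rw [show j + 2 + m + 1 = (j + m + 1) + 2 by ring, pow_add]
    calc (10 / 9 : ℝ) ^ (j + m + 1) * (10 / 9) ^ 2 * E (j + m + 3) k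
        ≤ (10 / 9 : ℝ) ^ (j + m + 1) * (10 / 9) ^ 2 * (1 / 24 * E (j + m + 1) k) := by gcongr
      _ = (10 / 9) ^ 2 / 24 * ((10 / 9 : ℝ) ^ (j + m + 1) * E (j + m + 1) k) := by ring
      _ ≤ _ := by
        have : 0 ≤ (10 / 9 : ℝ) ^ (j + m + 1) * E (j + m + 1) k := by positivity
        nlinarith
  · rw [zero_add, show 1 + m + 1 = m + 2 by ring]
    ring

/-- Dividing the recursion by `f k` expresses the next ratio through earlier ones. After `m` exact
terms the rest is bounded using only the ratios up to `k`, which permits an induction. -/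
theorem norm_ratio_sub_le {k : ℕ} (hkn : k < n)
    (hk : ∀ i ≤ k, f i ≠ 0 ∧ ‖f i / f (i - 1) - 1‖ ≤ 1 / 10) (m : ℕ) (hm : m ≤ k + 1) :
    ‖f (k + 1) / f k - 1 - ∑ j ∈ Finset.range m, f (k - (j + 1)) / f k * D (j + 1) (k + 1)‖
      ≤ 19 / 18 * ((10 / 9) ^ (m + 1) * E (m + 1) (k + 1)
        + (10 / 9) ^ (m + 2) * E (m + 2) (k + 1)) := by
  have hf := (hk k le_rfl).1
  obtain ⟨J, hJ⟩ : ∃ J, k + 1 = m + J := ⟨k + 1 - m, by omega⟩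
  have h1 : f (k + 1) / f k - 1 - ∑ j ∈ Finset.range m, f (k - (j + 1)) / f k * D (j + 1) (k + 1)
      = ∑ j ∈ Finset.range J, f (k - (j + m + 1)) / f k * D (j + m + 1) (k + 1) := by
    rw [H.f_succ k hkn, hJ, Finset.sum_range_add, add_div, div_self hf, add_div,
      Finset.sum_div, Finset.sum_div, ← hJ]
    rw [add_sub_cancel_left, sub_eq_iff_eq_add, add_comm]
    congr 1
    · refine Finset.sum_congr rfl fun j _ => ?_
      rw [add_comm m j]; ring
    · refine Finset.sum_congr rfl fun j _ => ?_
      ring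
  rw [h1]
  refine le_trans (norm_sum_le_of_le _ fun j _ => ?_) (H.tail_le m (k + 1) J)
  rw [norm_mul, norm_div]
  refine mul_le_mul ?_ (H.D_le _ _) (norm_nonneg _) (by positivity)
  rw [div_le_iff₀ (norm_pos_iff.mpr hf)]
  exact norm_sub_le_of_ratio hk _

/-- Nonvanishing and the ratio bound must be proved together, because the recursion is divided by `f
k`. The induction closes because the bounds on `E 1` and `E 2` make the tail less than `0.08`, below
the assumed `1/10`. -/
theorem ratio_aux (k : ℕ) (hkn : k ≤ n) : ∀ i ≤ k, f i ≠ 0 ∧ ‖f i / f (i - 1) - 1‖ ≤ 1 / 10 := by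
  induction k with
  | zero =>
    intro i hi
    obtain rfl : i = 0 := by omega
    simp [H.f_zero]
  | succ k ih =>
    have hk := ih (by omega)
    intro i hi
    rcases Nat.lt_or_ge i (k + 1) with h | h
    · exact hk i (by omega)
    · obtain rfl : i = k + 1 := by omega
      have h1 := H.norm_ratio_sub_le (by omega : k < n) hk 0 (by omega)
      have hf := (hk k le_rfl).1
      have h2 := H.E1_le (k + 1)
      have h3 := H.E2_le (k + 1)
      simp only [Finset.range_zero, Finset.sum_empty, sub_zero, zero_add] at h1
      have h4 : ‖f (k + 1) / f (k + 1 - 1) - 1‖ ≤ 1 / 10 := by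
        rw [Nat.add_sub_cancel]
        refine h1.trans ?_
        norm_num at h2 h3 ⊢
        linarith
      refine ⟨fun h0 => ?_, h4⟩
      rw [h0] at h4
      norm_num at h4

theorem f_ne_zero {k : ℕ} (hk : k ≤ n) : f k ≠ 0 := (H.ratio_aux k hk k le_rfl).1

theorem ratio_sub_one_le {k : ℕ} (hk : k ≤ n) : ‖f k / f (k - 1) - 1‖ ≤ 1 / 10 :=
  (H.ratio_aux k hk k le_rfl).2

theorem ratio_inv_le {k : ℕ} (hk : k ≤ n) : ‖(f k / f (k - 1))⁻¹‖ ≤ 10 / 9 := by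
  have h1 := H.ratio_sub_one_le hk
  have h2 := norm_sub_norm_le (1 : ℂ) (1 - f k / f (k - 1))
  rw [sub_sub_cancel, norm_one, norm_sub_rev] at h2
  rw [norm_inv, inv_le_comm₀ (by linarith) (by norm_num)]
  norm_num
  rw [← norm_div]
  linarith

theorem ratio_zero_order {k : ℕ} (hk : k ≤ n) :
    ‖f k / f (k - 1) - 1‖ ≤ 1.18 * E 1 k + 1.31 * E 2 k := by
  have e1 := H.E_nonneg 1 k
  have e2 := H.E_nonneg 2 k
  cases k with
  | zero => simp [H.f_zero]; linarith
  | succ k =>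
    have h1 := H.norm_ratio_sub_le (by omega : k < n) (H.ratio_aux k (by omega)) 0 (by omega)
    simp only [Finset.range_zero, Finset.sum_empty, sub_zero, zero_add] at h1
    rw [Nat.add_sub_cancel]
    refine h1.trans ?_
    norm_num
    linarith

theorem ratio_zero_order' {k : ℕ} (hk : k ≤ n) :
    ‖f k / f (k - 1) - 1‖ ≤ 4 * K * (‖z‖ * p k) := by
  refine (H.ratio_zero_order hk).trans ?_
  have h1 := H.E1_le' k
  have h2 := H.E2_le' k
  have h3 : ‖z‖ ^ 2 * q k ≤ 2.01 * (K * (‖z‖ * p k)) := by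
    have := H.z_le
    have h5 := H.q_le k
    have h6 := H.p_nonneg k
    have := H.one_le_K
    calc ‖z‖ ^ 2 * q k ≤ ‖z‖ ^ 2 * (K * p k) := by gcongr
      _ = ‖z‖ * (K * (‖z‖ * p k)) := by ring
      _ ≤ _ := by gcongr
  have h5 : 0 ≤ ‖z‖ * p k := mul_nonneg (norm_nonneg _) (H.p_nonneg k)
  have h4 : ‖z‖ * p k ≤ K * (‖z‖ * p k) := le_mul_of_one_le_left h5 H.one_le_K
  linarith

theorem ratio_first_order {k : ℕ} (hk : k < n) :
    ‖f (k + 1) / f k - 1 - (f k / f (k - 1))⁻¹ * D 1 (k + 1)‖ ≤ 4.25 * E 2 (k + 1) := by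
  have h1 := H.norm_ratio_sub_le hk (H.ratio_aux k hk.le) 1 (by omega)
  simp only [Finset.range_one, Finset.sum_singleton, zero_add] at h1
  rw [inv_div]
  refine h1.trans ?_
  have h2 := H.E_one 1 (k + 1)
  have h3 := H.E_nonneg 2 (k + 1)
  norm_num at h2 ⊢
  linarith

theorem ratio_second_order {k : ℕ} (hk : k < n) :
    ‖f (k + 1) / f k - 1 - (f k / f (k - 1))⁻¹ * D 1 (k + 1)
      - (f k / f (k - 1))⁻¹ * (f (k - 1) / f (k - 1 - 1))⁻¹ * D 2 (k + 1)‖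
      ≤ 5 * E 3 (k + 1) := by
  have h2 := H.E_one 2 (k + 1)
  have h3 := H.E_nonneg 3 (k + 1)
  have hf := H.f_ne_zero hk.le
  have hf1 : f (k - 1) ≠ 0 := H.f_ne_zero (by omega)
  have h0 : (f k / f (k - 1))⁻¹ * (f (k - 1) / f (k - 1 - 1))⁻¹ = f (k - 2) / f k := by
    rw [show k - 2 = k - 1 - 1 by omega, inv_div, inv_div]
    field_simp
  rw [h0, inv_div]
  -- For `k = 0` the recursion has a single term, and `D 2 1 = 0` makes the second order formula
  -- exact.
  rcases Nat.eq_zero_or_pos k with rfl | hk0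
  · have h1 := H.f_succ 0 hk
    simp only [zero_add, Finset.range_one, Finset.sum_singleton, Nat.zero_sub, H.f_zero, one_mul]
      at h1
    rw [zero_add, H.D_eq_zero 2 1 (by norm_num), h1]
    simp only [zero_add, Nat.zero_sub, H.f_zero] at h3 ⊢
    simpa using h3
  · have h1 := H.norm_ratio_sub_le hk (H.ratio_aux k hk.le) 2 (by omega)
    simp only [Finset.sum_range_succ, Finset.range_zero, Finset.sum_empty, zero_add] at h1
    rw [sub_sub]
    refine h1.trans ?_
    norm_num at h2 ⊢
    linarith

end RecursionData
end Core

/-! ### Comparison of one factor, and of products of factors -/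

section Comparison
open Complex

theorem mul_sq_le_add_cube {a b : ℝ} (ha : 0 ≤ a) (hb : 0 ≤ b) : a * b ^ 2 ≤ a ^ 3 + b ^ 3 := by
  have h1 : 0 ≤ a ^ 3 := by positivity
  have h2 : 0 ≤ b ^ 3 := by positivity
  rcases le_total a b with h | h
  · have : a * b ^ 2 ≤ b * b ^ 2 := by gcongr
    linarith [this, (by ring : b * b ^ 2 = b ^ 3)]
  · have : a * b ^ 2 ≤ a * a ^ 2 := by gcongr
    linarith [this, (by ring : a * a ^ 2 = a ^ 3)]

set_option maxHeartbeats 1000000 in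
/-- Comparison of one factor of the recursion with `exp (z p + γ z ^ 2)`. -/
theorem norm_factor_sub_exp_le {K : ℝ} (hK : 1 ≤ K) {z a α β A B D₁ D₂ : ℂ}
    {p p' p'' m m' m₃ q q' q₂ t γ ρ : ℝ} (hz : ‖z‖ ≤ 3) (hp : 0 ≤ p) (hp1 : p ≤ 1) (hp' : 0 ≤ p')
    (hp'' : 0 ≤ p'') (hm : 0 ≤ m) (hm' : 0 ≤ m') (hm₃ : 0 ≤ m₃) (hq : 0 ≤ q) (hq' : 0 ≤ q')
    (hq₂ : 0 ≤ q₂) (ht : 0 ≤ t)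
    (hA : A * (1 + α) = 1) (hB : B * (1 + β) = 1) (hA2 : ‖A‖ ≤ 2) (hB2 : ‖B‖ ≤ 2)
    (hα : ‖α‖ ≤ K * (‖z‖ * p')) (hβ : ‖β‖ ≤ K * (‖z‖ * p''))
    (hα2 : ‖α - z * p'‖ ≤ K * (‖z‖ ^ 2 * (m' + q' + p' * p'')))
    (h1 : ‖D₁ - z * p - z ^ 2 * m / 2‖ ≤ K * (‖z‖ ^ 3 * m₃))
    (h1' : ‖D₁ - z * p‖ ≤ ‖z‖ ^ 2 * m) (hD1 : ‖D₁‖ ≤ 2 * (‖z‖ * p))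
    (hD2 : ‖D₂‖ ≤ 2 * (‖z‖ ^ 2 * q)) (h2 : ‖D₂ - z ^ 2 * q‖ ≤ K * (‖z‖ ^ 3 * q₂))
    (ha : ‖a - 1 - A * D₁ - A * B * D₂‖ ≤ K * (‖z‖ ^ 3 * t))
    (hγ : γ = m / 2 - p ^ 2 / 2 + q - p * p') (hγ1 : |γ| ≤ K * p)
    (hρ : p ^ 3 + p' ^ 3 + p * m + m₃ + (p'' + p' + p) * q + q₂ + m' * p + p' * m + t
      + p * q' + p'' * p' * p ≤ ρ) :
    ‖a - exp (z * p + γ * z ^ 2)‖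
      ≤ (100 * K ^ 2 + (4 * K) ^ 3 * Real.exp (12 * K)) * (‖z‖ ^ 3 * ρ) := by
  set ζ := ‖z‖ with hζ
  have hζ0 : 0 ≤ ζ := norm_nonneg z
  have i1 : 0 ≤ p ^ 3 := by positivity
  have i2 : 0 ≤ p' ^ 3 := by positivity
  have i3 : 0 ≤ p * m := by positivity
  have i4 : 0 ≤ p'' * q := by positivity
  have i5 : 0 ≤ p' * q := by positivity
  have i6 : 0 ≤ p * q := by positivity
  have i7 : 0 ≤ m' * p := by positivity
  have i8 : 0 ≤ p' * m := by positivity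
  have i9 : 0 ≤ p * q' := by positivity
  have i10 : 0 ≤ p'' * p' * p := by positivity
  have hρ' : p ^ 3 + p' ^ 3 + p * m + m₃ + (p'' * q + p' * q + p * q) + q₂ + m' * p + p' * m + t
      + p * q' + p'' * p' * p ≤ ρ := by linarith
  have hρ0 : 0 ≤ ρ := by linarith
  have j1 : p * p' ^ 2 ≤ p ^ 3 + p' ^ 3 := mul_sq_le_add_cube hp hp'
  have j2 : p ^ 2 * p' ≤ p ^ 3 + p' ^ 3 := by
    have := mul_sq_le_add_cube hp' hp
    linarith
  set W := ζ ^ 3 * ρ with hW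
  have hW0 : 0 ≤ W := by positivity
  have hKK : K ≤ K ^ 2 := le_self_pow₀ hK (by norm_num)
  have hnp : ‖(p : ℂ)‖ = p := by rw [norm_real, Real.norm_eq_abs, abs_of_nonneg hp]
  set u : ℂ := z * p + γ * z ^ 2 with hu
  -- Every bracket on the right is of third order. The second order terms `m/2`, `-p p'`, `q` and
  -- `-p²/2`, which come from `D₁`, from `-α D₁`, from `D₂` and from the square in `exp u`, cancel
  -- by the choice of `γ`.
  have hid : a - exp u = (a - 1 - A * D₁ - A * B * D₂) + (D₁ - z * p - z ^ 2 * m / 2)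
      - z * p * (α - z * p') - (D₁ - z * p) * α + D₁ * α ^ 2 * A
      + D₂ * (B - 1 - α * A * B) + (D₂ - z ^ 2 * q) - (z * p * (γ * z ^ 2) + (γ * z ^ 2) ^ 2 / 2)
      - (exp u - 1 - u - u ^ 2 / 2) := by
    have hA' : A = 1 - α + α ^ 2 * A := by linear_combination (1 - α) * hA
    have hγc : (γ : ℂ) = m / 2 - p ^ 2 / 2 + q - p * p' := by rw [hγ]; push_cast; ring
    rw [hu]
    linear_combination D₁ * hA' + (B * D₂) * hA - z ^ 2 * hγc
  have e1 : ‖a - 1 - A * D₁ - A * B * D₂‖ ≤ K ^ 2 * W := by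
    refine ha.trans ?_
    rw [hW]
    gcongr
    linarith
  have e2 : ‖D₁ - z * p - z ^ 2 * m / 2‖ ≤ K ^ 2 * W := by
    refine h1.trans ?_
    rw [hW]
    gcongr
    linarith
  have e3 : ‖z * p * (α - z * p')‖ ≤ K ^ 2 * W := by
    rw [norm_mul, norm_mul, hnp]
    calc ζ * p * ‖α - z * p'‖ ≤ ζ * p * (K * (ζ ^ 2 * (m' + q' + p' * p''))) := by gcongr
      _ = K * (ζ ^ 3 * (m' * p + p * q' + p'' * p' * p)) := by ring
      _ ≤ K ^ 2 * W := by
        rw [hW]; gcongr; linarith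
  have e4 : ‖(D₁ - z * p) * α‖ ≤ K ^ 2 * W := by
    rw [norm_mul]
    calc _ ≤ (ζ ^ 2 * m) * (K * (ζ * p')) := by gcongr
      _ = K * (ζ ^ 3 * (p' * m)) := by ring
      _ ≤ K ^ 2 * W := by
        rw [hW]; gcongr; linarith
  have e5 : ‖D₁ * α ^ 2 * A‖ ≤ 4 * K ^ 2 * W := by
    rw [norm_mul, norm_mul, norm_pow]
    calc _ ≤ (2 * (ζ * p)) * (K * (ζ * p')) ^ 2 * 2 := by gcongr
      _ = 4 * K ^ 2 * (ζ ^ 3 * (p * p' ^ 2)) := by ring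
      _ ≤ _ := by
        rw [hW]; gcongr; linarith
  have e6 : ‖D₂ * (B - 1 - α * A * B)‖ ≤ 12 * K ^ 2 * W := by
    have hB1 : B - 1 = -(B * β) := by linear_combination hB
    have : ‖B - 1 - α * A * B‖ ≤ 2 * (K * (ζ * p'')) + (K * (ζ * p')) * 2 * 2 := by
      refine (norm_sub_le _ _).trans ?_
      rw [hB1, norm_neg, norm_mul, norm_mul, norm_mul]
      gcongr
    rw [norm_mul]
    calc _ ≤ (2 * (ζ ^ 2 * q)) * (2 * (K * (ζ * p'')) + (K * (ζ * p')) * 2 * 2) := by gcongr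
      _ = K * (ζ ^ 3 * (4 * (p'' * q) + 8 * (p' * q))) := by ring
      _ ≤ K ^ 2 * (ζ ^ 3 * (12 * ρ)) := by
        gcongr; linarith
      _ = _ := by rw [hW]; ring
  have e7 : ‖D₂ - z ^ 2 * q‖ ≤ K ^ 2 * W := by
    refine h2.trans ?_
    rw [hW]
    gcongr
    linarith
  -- One factor `γ` is expanded into moments to reach third order; another one is only bounded by `K
  -- p` in `l2`.
  have hγ2 : p * |γ| ≤ 3 * ρ := by
    have : |γ| ≤ m / 2 + p ^ 2 / 2 + q + p * p' := by
      rw [hγ, abs_le]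
      have : 0 ≤ p * p' := by positivity
      have : 0 ≤ p ^ 2 := by positivity
      constructor <;> linarith
    calc p * |γ| ≤ p * (m / 2 + p ^ 2 / 2 + q + p * p') := by gcongr
      _ = (p * m) / 2 + p ^ 3 / 2 + p * q + p ^ 2 * p' := by ring
      _ ≤ _ := by linarith
  have hnγ : ‖(γ : ℂ) * z ^ 2‖ = |γ| * ζ ^ 2 := by
    rw [norm_mul, norm_pow, norm_real, Real.norm_eq_abs]
  have e8 : ‖z * p * (γ * z ^ 2) + (γ * z ^ 2) ^ 2 / 2‖ ≤ 8 * K ^ 2 * W := by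
    refine (norm_add_le _ _).trans ?_
    have h2n : ‖(2 : ℂ)‖ = 2 := by simp
    rw [norm_mul, norm_mul, norm_div, norm_pow, hnγ, hnp, h2n]
    have l1 : ζ * p * (|γ| * ζ ^ 2) ≤ 3 * W := by
      calc ζ * p * (|γ| * ζ ^ 2) = ζ ^ 3 * (p * |γ|) := by ring
        _ ≤ ζ ^ 3 * (3 * ρ) := by gcongr
        _ = _ := by rw [hW]; ring
    have l2 : (|γ| * ζ ^ 2) ^ 2 / 2 ≤ 3 / 2 * K * (3 * W) := by
      calc (|γ| * ζ ^ 2) ^ 2 / 2 = |γ| * ζ / 2 * (|γ| * ζ ^ 3) := by ring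
        _ ≤ (K * p) * 3 / 2 * (|γ| * ζ ^ 3) := by gcongr
        _ = 3 / 2 * K * (ζ ^ 3 * (p * |γ|)) := by ring
        _ ≤ 3 / 2 * K * (ζ ^ 3 * (3 * ρ)) := by gcongr
        _ = _ := by rw [hW]; ring
    have : K * W ≤ K ^ 2 * W := by gcongr
    have : W ≤ K ^ 2 * W := le_mul_of_one_le_left hW0 (hK.trans hKK)
    linarith
  have hun : ‖u‖ ≤ 4 * K * (ζ * p) := by
    rw [hu]
    refine (norm_add_le _ _).trans ?_
    rw [hnγ, norm_mul, hnp]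
    have : |γ| * ζ ^ 2 ≤ (K * p) * (3 * ζ) := by rw [pow_two]; gcongr
    have : ζ * p ≤ K * (ζ * p) := le_mul_of_one_le_left (by positivity) hK
    linarith
  have e9 : ‖exp u - 1 - u - u ^ 2 / 2‖ ≤ (4 * K) ^ 3 * Real.exp (12 * K) * W := by
    refine (norm_exp_sub_quadratic_le u).trans ?_
    have : 4 * K * (ζ * p) ≤ 12 * K := by
      calc 4 * K * (ζ * p) ≤ 4 * K * (3 * 1) := by gcongr
        _ = 12 * K := by ring
    calc _ ≤ (4 * K * (ζ * p)) ^ 3 * Real.exp (12 * K) := by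
          gcongr
          exact hun.trans this
      _ = (4 * K) ^ 3 * Real.exp (12 * K) * (ζ ^ 3 * p ^ 3) := by ring
      _ ≤ _ := by
        rw [hW]; gcongr; linarith
  rw [hid]
  have hKW : 0 ≤ K ^ 2 * W := by positivity
  refine (norm_sub_le_of_le (norm_sub_le_of_le (norm_add_le_of_le (norm_add_le_of_le
    (norm_add_le_of_le (norm_sub_le_of_le (norm_sub_le_of_le (norm_add_le_of_le e1 e2) e3) e4) e5)
    e6) e7) e8) e9).trans ?_
  linarith

/-- The telescoping bound for the difference of two products. -/
theorem norm_prod_sub_prod_le {a b : ℕ → ℂ} {e : ℕ → ℝ} (n : ℕ)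
    (ha : ∀ k < n, ‖a k‖ ≤ Real.exp (e k)) (hb : ∀ k < n, ‖b k‖ ≤ Real.exp (e k)) :
    ‖∏ k ∈ Finset.range n, a k - ∏ k ∈ Finset.range n, b k‖
      ≤ (∑ k ∈ Finset.range n, ‖a k - b k‖ * Real.exp (-e k))
        * Real.exp (∑ k ∈ Finset.range n, e k) := by
  induction n with
  | zero => simp
  | succ n ih =>
    have h1 := ih (fun k hk => ha k (by omega)) (fun k hk => hb k (by omega))
    have h2 : ‖∏ k ∈ Finset.range n, a k‖ ≤ Real.exp (∑ k ∈ Finset.range n, e k) := by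
      rw [norm_prod, Real.exp_sum]
      refine Finset.prod_le_prod (fun _ _ => norm_nonneg _) fun k hk => ha k ?_
      have := Finset.mem_range.mp hk
      omega
    rw [Finset.prod_range_succ, Finset.prod_range_succ, Finset.sum_range_succ,
      Finset.sum_range_succ]
    have h3 : (∏ k ∈ Finset.range n, a k) * a n - (∏ k ∈ Finset.range n, b k) * b n
        = (∏ k ∈ Finset.range n, a k) * (a n - b n)
          + (∏ k ∈ Finset.range n, a k - ∏ k ∈ Finset.range n, b k) * b n := by ring
    rw [h3]
    refine (norm_add_le _ _).trans ?_
    rw [norm_mul, norm_mul, Real.exp_add]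
    have h4 : Real.exp (-e n) * Real.exp (e n) = 1 := by rw [← Real.exp_add]; simp
    calc _ ≤ Real.exp (∑ k ∈ Finset.range n, e k) * ‖a n - b n‖
          + (∑ k ∈ Finset.range n, ‖a k - b k‖ * Real.exp (-e k))
            * Real.exp (∑ k ∈ Finset.range n, e k) * Real.exp (e n) := by
          gcongr
          exact hb n (by omega)
      _ = _ := by linear_combination (-Real.exp (∑ k ∈ Finset.range n, e k) * ‖a n - b n‖) * h4

end Comparison

/-! ### The product of ratios against the compound Poisson exponential -/

namespace RecursionData
variable {z : ℂ} {K : ℝ} {n : ℕ} {f : ℕ → ℂ} {D : ℕ → ℕ → ℂ} {E : ℕ → ℕ → ℝ}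
  {p m₂ m₃ q q₂ t : ℕ → ℝ} (H : RecursionData z K n f D E p m₂ m₃ q q₂ t)
include H

theorem norm_D1_le (k : ℕ) : ‖D 1 k‖ ≤ 1.01 * (‖z‖ * p k) := (H.D_le 1 k).trans (H.E1_le' k)

/-- First order approximation of a ratio, with sharp constants. -/
theorem ratio_approx {k : ℕ} (hk : k < n) :
    ‖f (k + 1) / f k - 1 - z * p (k + 1)‖ ≤ ‖z‖ ^ 2 * (0.51 * m₂ (k + 1) + 4.4 * q (k + 1)
      + 1.4 * (p (k + 1) * p k) + 0.04 * q k) := by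
  set ζ := ‖z‖ with hζ
  have hζ0 : 0 ≤ ζ := norm_nonneg _
  set α := f k / f (k - 1) - 1 with hα
  have hne : 1 + α ≠ 0 := by
    rw [hα, add_sub_cancel]
    exact div_ne_zero (H.f_ne_zero hk.le) (H.f_ne_zero (by omega))
  have hinv : (f k / f (k - 1))⁻¹ = 1 - (1 + α)⁻¹ * α := by
    have : f k / f (k - 1) = 1 + α := by rw [hα]; ring
    rw [this]
    field_simp
    ring
  have hid : f (k + 1) / f k - 1 - z * p (k + 1)
      = (f (k + 1) / f k - 1 - (f k / f (k - 1))⁻¹ * D 1 (k + 1)) + (D 1 (k + 1) - z * p (k + 1))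
        - (1 + α)⁻¹ * α * D 1 (k + 1) := by
    rw [hinv]; ring
  have hA : ‖(1 + α)⁻¹‖ ≤ 10 / 9 := by
    have : f k / f (k - 1) = 1 + α := by rw [hα]; ring
    rw [← this]; exact H.ratio_inv_le hk.le
  have h1 := H.ratio_first_order hk
  have h2 := H.D1_first (k + 1)
  have h3 := H.norm_D1_le (k + 1)
  have h4 := H.ratio_zero_order hk.le
  have h5 := H.E2_le' (k + 1)
  have h6 := H.E1_le' k
  have h7 := H.E2_le' k
  have h8 : ‖D 1 (k + 1)‖ ≤ 0.0204 := (H.D_le _ _).trans (H.E1_le _)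
  have p1 := H.p_nonneg k
  have p2 := H.p_nonneg (k + 1)
  have q1 := H.q_nonneg k
  have h9 : ‖(1 + α)⁻¹ * α * D 1 (k + 1)‖
      ≤ 1.4 * (ζ ^ 2 * (p (k + 1) * p k)) + 0.04 * (ζ ^ 2 * q k) := by
    rw [norm_mul, norm_mul]
    have l1 : ‖α‖ ≤ 1.1918 * (ζ * p k) + 1.3493 * (ζ ^ 2 * q k) := by
      norm_num at h4 h6 h7 ⊢
      linarith
    have l2 : (ζ * p k) * ‖D 1 (k + 1)‖ ≤ 1.01 * (ζ ^ 2 * (p (k + 1) * p k)) := by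
      calc (ζ * p k) * ‖D 1 (k + 1)‖ ≤ (ζ * p k) * (1.01 * (ζ * p (k + 1))) := by gcongr
        _ = _ := by ring
    have l3 : (ζ ^ 2 * q k) * ‖D 1 (k + 1)‖ ≤ (ζ ^ 2 * q k) * 0.0204 := by gcongr
    calc _ ≤ 10 / 9 * (1.1918 * (ζ * p k) + 1.3493 * (ζ ^ 2 * q k)) * ‖D 1 (k + 1)‖ := by gcongr
      _ = 10 / 9 * (1.1918 * ((ζ * p k) * ‖D 1 (k + 1)‖)
          + 1.3493 * ((ζ ^ 2 * q k) * ‖D 1 (k + 1)‖)) := by ring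
      _ ≤ _ := by
        have s1 : 0 ≤ ζ ^ 2 * (p (k + 1) * p k) := by positivity
        have s2 : 0 ≤ ζ ^ 2 * q k := by positivity
        norm_num at l2 l3 ⊢
        linarith
  rw [hid]
  refine (norm_sub_le_of_le (norm_add_le_of_le h1 h2) h9).trans ?_
  have s3 : 0 ≤ ζ ^ 2 * q (k + 1) := mul_nonneg (by positivity) (H.q_nonneg _)
  norm_num at h5 ⊢
  linarith

end RecursionData

/-- The second order coefficient of the exponent of one factor. -/
noncomputable def gammaCoeff (p m₂ q : ℕ → ℝ) (k : ℕ) : ℝ :=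
  m₂ (k + 1) / 2 - p (k + 1) ^ 2 / 2 + q (k + 1) - p (k + 1) * p k

/-- A majorant of the second order contribution of one factor. -/
noncomputable def majorant (p m₂ q : ℕ → ℝ) (k : ℕ) : ℝ :=
  0.6 * m₂ (k + 1) + 4.75 * q (k + 1) + 1.5 * (p (k + 1) * p k) + 0.05 * q k
    + 0.5 * p (k + 1) ^ 2

/-- The third order contribution of one factor. -/
noncomputable def thirdOrder (p m₂ m₃ q q₂ t : ℕ → ℝ) (k : ℕ) : ℝ :=
  p (k + 1) ^ 3 + p k ^ 3 + p (k + 1) * m₂ (k + 1) + m₃ (k + 1)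
    + (p (k - 1) + p k + p (k + 1)) * q (k + 1) + q₂ (k + 1) + m₂ k * p (k + 1)
    + p k * m₂ (k + 1) + t (k + 1) + p (k + 1) * q k + p (k - 1) * p k * p (k + 1)

namespace RecursionData
variable {z : ℂ} {K : ℝ} {n : ℕ} {f : ℕ → ℂ} {D : ℕ → ℕ → ℂ} {E : ℕ → ℕ → ℝ}
  {p m₂ m₃ q q₂ t : ℕ → ℝ} (H : RecursionData z K n f D E p m₂ m₃ q q₂ t)
include H

/-- The term linear in `p` enters through `re z` only, and all other contributions are charged to
`‖z‖²`. The numerical coefficients matter: summed over the factors, the majorants have to stay below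
`(9/20) λ`. -/
theorem norm_ratio_le {k : ℕ} (hk : k < n) :
    ‖f (k + 1) / f k‖ ≤ Real.exp (p (k + 1) * z.re + majorant p m₂ q k * ‖z‖ ^ 2) := by
  have h1 := H.ratio_approx hk
  have h2 := H.ratio_sub_one_le (by omega : k + 1 ≤ n)
  rw [Nat.add_sub_cancel] at h2
  set y := f (k + 1) / f k - 1 with hy
  set W := 0.51 * m₂ (k + 1) + 4.4 * q (k + 1) + 1.4 * (p (k + 1) * p k) + 0.04 * q k with hW
  have h3 : f (k + 1) / f k = 1 + y := by rw [hy]; ring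
  rw [h3]
  refine (norm_one_add_le y).trans (Real.exp_le_exp.mpr ?_)
  set R := ‖z‖ ^ 2 * W with hR
  have p2 := H.p_nonneg (k + 1)
  have hre : y.re ≤ p (k + 1) * z.re + R := by
    have := (abs_le.mp ((Complex.abs_re_le_norm (y - z * p (k + 1))).trans h1)).2
    rw [Complex.sub_re, Complex.re_mul_ofReal] at this
    linarith
  have hpz : ‖z * (p (k + 1) : ℂ)‖ = p (k + 1) * ‖z‖ := by
    rw [norm_mul, Complex.norm_real, Real.norm_eq_abs, abs_of_nonneg p2, mul_comm]
  have hn : ‖y‖ ≤ p (k + 1) * ‖z‖ + R := by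
    have := norm_add_le_of_le h1 hpz.le
    rw [sub_add_cancel] at this
    linarith
  have hR0 : 0 ≤ R := (norm_nonneg _).trans h1
  have hpz1 : p (k + 1) * ‖z‖ ≤ 0.0201 := by
    calc p (k + 1) * ‖z‖ ≤ 1 / 100 * 2.01 := by gcongr; exacts [H.p_le _, H.z_le]
      _ = _ := by norm_num
  have hsq : ‖y‖ ^ 2 ≤ p (k + 1) ^ 2 * ‖z‖ ^ 2 + 0.1201 * R := by
    have a1 : ‖y‖ ^ 2 ≤ ‖y‖ * (p (k + 1) * ‖z‖ + R) := by rw [pow_two]; gcongr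
    have a2 : ‖y‖ * R ≤ 1 / 10 * R := by gcongr
    have a3 : ‖y‖ * (p (k + 1) * ‖z‖) ≤ (p (k + 1) * ‖z‖ + R) * (p (k + 1) * ‖z‖) := by gcongr
    have a4 : R * (p (k + 1) * ‖z‖) ≤ R * 0.0201 := by gcongr
    norm_num at a4 ⊢
    nlinarith
  have p1 := H.p_nonneg k
  -- The excess `0.06005` is half of `0.1201`, the share of `R` in the bound for `‖y‖²`.
  have hfin : 1.06005 * W + 0.5 * p (k + 1) ^ 2 ≤ majorant p m₂ q k := by
    have b1 := H.m₂_nonneg (k + 1)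
    have b2 := H.q_nonneg (k + 1)
    have b3 := H.q_nonneg k
    have b4 : 0 ≤ p (k + 1) * p k := by positivity
    rw [hW]
    unfold majorant
    norm_num
    linarith
  have hfin2 := mul_le_mul_of_nonneg_right hfin (sq_nonneg ‖z‖)
  have : 1.06005 * R = 1.06005 * W * ‖z‖ ^ 2 := by rw [hR]; ring
  norm_num at this hsq hfin2 ⊢
  linarith

theorem abs_gammaCoeff_le (k : ℕ) : |gammaCoeff p m₂ q k| ≤ majorant p m₂ q k := by
  have p1 := H.p_nonneg k
  have p2 := H.p_nonneg (k + 1)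
  have b1 := H.m₂_nonneg (k + 1)
  have b2 := H.q_nonneg (k + 1)
  have b3 := H.q_nonneg k
  have b4 : 0 ≤ p (k + 1) * p k := by positivity
  have b5 : 0 ≤ p (k + 1) ^ 2 := by positivity
  unfold gammaCoeff majorant
  rw [abs_le]
  norm_num
  constructor <;> linarith

theorem majorant_nonneg (k : ℕ) : 0 ≤ majorant p m₂ q k :=
  (abs_nonneg _).trans (H.abs_gammaCoeff_le k)

theorem norm_exp_factor_le (k : ℕ) :
    ‖Complex.exp (z * p (k + 1) + gammaCoeff p m₂ q k * z ^ 2)‖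
      ≤ Real.exp (p (k + 1) * z.re + majorant p m₂ q k * ‖z‖ ^ 2) := by
  rw [Complex.norm_exp]
  refine Real.exp_le_exp.mpr ?_
  rw [Complex.add_re, Complex.re_mul_ofReal]
  have h1 := re_mul_sq_le (gammaCoeff p m₂ q k) z
  have h2 := mul_le_mul_of_nonneg_right (H.abs_gammaCoeff_le k) (sq_nonneg ‖z‖)
  linarith

theorem norm_ratio_sub_exp_le {k : ℕ} (hk : k < n) :
    ‖f (k + 1) / f k - Complex.exp (z * p (k + 1) + gammaCoeff p m₂ q k * z ^ 2)‖
      ≤ (100 * (13 * K) ^ 2 + (4 * (13 * K)) ^ 3 * Real.exp (12 * (13 * K)))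
        * (‖z‖ ^ 3 * thirdOrder p m₂ m₃ q q₂ t k) := by
  have hK := H.one_le_K
  have hz := H.z_le
  have hz0 := norm_nonneg z
  have P0 := H.p_nonneg
  have Q0 := H.q_nonneg
  have M0 := H.m₂_nonneg
  have hrat : ∀ {i : ℕ}, i ≤ n → (f i / f (i - 1))⁻¹ * (1 + (f i / f (i - 1) - 1)) = 1 := by
    intro i hi
    rw [add_sub_cancel]
    exact inv_mul_cancel₀ (div_ne_zero (H.f_ne_zero hi) (H.f_ne_zero (by omega)))
  have hzero : ∀ {i : ℕ}, i ≤ n → ‖f i / f (i - 1) - 1‖ ≤ 13 * K * (‖z‖ * p i) := by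
    intro i hi
    refine (H.ratio_zero_order' hi).trans ?_
    have : 0 ≤ ‖z‖ * p i := mul_nonneg hz0 (P0 i)
    gcongr
    norm_num
  have hE2 := H.E2_le' (k + 1)
  have hE3 := H.E3_le' (k + 1)
  have w1 : 0 ≤ ‖z‖ ^ 2 * m₂ (k + 1) := mul_nonneg (by positivity) (M0 _)
  have w2 : 0 ≤ ‖z‖ ^ 2 * q (k + 1) := mul_nonneg (by positivity) (Q0 _)
  have w3 : 0 ≤ ‖z‖ * p (k + 1) := mul_nonneg (by positivity) (P0 _)
  have hg : |gammaCoeff p m₂ q k| ≤ 13 * K * p (k + 1) := by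
    have g1 := H.m₂_le (k + 1)
    have g2 := H.q_le (k + 1)
    have g3 := H.p_le k
    have g4 := H.p_le (k + 1)
    have g5 : p (k + 1) * p k ≤ p (k + 1) * (1 / 100) := by gcongr; exact P0 _
    have g6 : p (k + 1) ^ 2 ≤ p (k + 1) * (1 / 100) := by
      rw [pow_two]; gcongr; exact P0 _
    have g7 : p (k + 1) ≤ K * p (k + 1) := le_mul_of_one_le_left (P0 _) hK
    have g8 : 0 ≤ p (k + 1) * p k := mul_nonneg (P0 _) (P0 _)
    unfold gammaCoeff
    rw [abs_le]
    constructor <;> nlinarith [M0 (k + 1), Q0 (k + 1), P0 (k + 1)]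
  -- The constant `13 K` generously dominates every coefficient occurring in the hypotheses.
  refine norm_factor_sub_exp_le (α := f k / f (k - 1) - 1) (β := f (k - 1) / f (k - 1 - 1) - 1)
    (A := (f k / f (k - 1))⁻¹) (B := (f (k - 1) / f (k - 1 - 1))⁻¹) (D₁ := D 1 (k + 1))
    (D₂ := D 2 (k + 1)) (p := p (k + 1)) (p' := p k) (p'' := p (k - 1)) (m := m₂ (k + 1))
    (m' := m₂ k) (m₃ := m₃ (k + 1)) (q := q (k + 1)) (q' := q k) (q₂ := q₂ (k + 1))
    (t := t (k + 1)) (γ := gammaCoeff p m₂ q k) (by linarith) (by linarith) (P0 _)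
    ((H.p_le _).trans (by norm_num)) (P0 _) (P0 _) (M0 _) (M0 _) (H.m₃_nonneg _) (Q0 _) (Q0 _)
    (H.q₂_nonneg _) (H.t_nonneg _) (hrat hk.le) (hrat (by omega))
    ((H.ratio_inv_le hk.le).trans (by norm_num)) ((H.ratio_inv_le (by omega)).trans (by norm_num))
    (hzero hk.le) (hzero (by omega)) ?_ ?_ ?_ ?_ ?_ ?_ ?_ rfl hg le_rfl
  · have hnn : ∀ i, 0 ≤ K * (‖z‖ ^ 2 * (m₂ i + q i + p i * p (i - 1))) := fun i =>
      mul_nonneg (by linarith) (mul_nonneg (by positivity)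
        (add_nonneg (add_nonneg (M0 i) (Q0 i)) (mul_nonneg (P0 i) (P0 _))))
    cases k with
    -- For `k = 0` the preceding ratio is `f 0 / f 0 = 1`, consistent with `p 0 = 0`.
    | zero =>
      rw [H.p_zero, H.f_zero]
      have := hnn 0
      rw [H.p_zero] at this
      simp only [div_one, sub_self, Complex.ofReal_zero, mul_zero,
        norm_zero] at this ⊢
      linarith
    | succ i =>
      rw [Nat.add_sub_cancel]
      have hi : i < n := by omega
      have b1 := H.ratio_first_order hi
      have b2 := H.D1_first (i + 1)
      have b3 := H.E2_le' (i + 1)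
      have b4 := H.ratio_zero_order' hi.le
      have b5 := H.ratio_inv_le hi.le
      have b6 := H.norm_D1_le (i + 1)
      have b7 := hrat hi.le
      have b8 : ‖(f i / f (i - 1))⁻¹ * (f i / f (i - 1) - 1) * D 1 (i + 1)‖
          ≤ 5 * (K * (‖z‖ ^ 2 * (p (i + 1) * p i))) := by
        rw [norm_mul, norm_mul]
        have : 0 ≤ K * (‖z‖ ^ 2 * (p (i + 1) * p i)) :=
          mul_nonneg (by linarith) (mul_nonneg (by positivity) (mul_nonneg (P0 _) (P0 _)))
        have : 0 ≤ ‖z‖ * p i := mul_nonneg hz0 (P0 i)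
        calc _ ≤ 10 / 9 * (4 * K * (‖z‖ * p i)) * (1.01 * (‖z‖ * p (i + 1))) := by gcongr
          _ = 10 / 9 * 4 * 1.01 * (K * (‖z‖ ^ 2 * (p (i + 1) * p i))) := by ring
          _ ≤ _ := by gcongr; norm_num
      have b9 : f (i + 1) / f i - 1 - z * p (i + 1)
          = (f (i + 1) / f i - 1 - (f i / f (i - 1))⁻¹ * D 1 (i + 1))
            + (D 1 (i + 1) - z * p (i + 1))
            - (f i / f (i - 1))⁻¹ * (f i / f (i - 1) - 1) * D 1 (i + 1) := by
        linear_combination D 1 (i + 1) * b7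
      rw [b9]
      refine (norm_sub_le_of_le (norm_add_le_of_le b1 b2) b8).trans ?_
      have c1 : ‖z‖ ^ 2 * m₂ (i + 1) ≤ K * (‖z‖ ^ 2 * m₂ (i + 1)) :=
        le_mul_of_one_le_left (mul_nonneg (by positivity) (M0 _)) hK
      have c2 : ‖z‖ ^ 2 * q (i + 1) ≤ K * (‖z‖ ^ 2 * q (i + 1)) :=
        le_mul_of_one_le_left (mul_nonneg (by positivity) (Q0 _)) hK
      have c3 : 0 ≤ ‖z‖ ^ 2 * m₂ (i + 1) := mul_nonneg (by positivity) (M0 _)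
      have c4 : 0 ≤ ‖z‖ ^ 2 * q (i + 1) := mul_nonneg (by positivity) (Q0 _)
      have c5 : 0 ≤ K * (‖z‖ ^ 2 * (p (i + 1) * p i)) :=
          mul_nonneg (by linarith) (mul_nonneg (by positivity) (mul_nonneg (P0 _) (P0 _)))
      have c6 : 13 * K * (‖z‖ ^ 2 * (m₂ (i + 1) + q (i + 1) + p (i + 1) * p i))
        = 13 * (K * (‖z‖ ^ 2 * m₂ (i + 1))) + 13 * (K * (‖z‖ ^ 2 * q (i + 1)))
          + 13 * (K * (‖z‖ ^ 2 * (p (i + 1) * p i))) := by ring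
      rw [c6]
      norm_num at b3 c1 c2 c3 c4 c5 ⊢
      linarith
  · refine (H.D1_second (k + 1)).trans ?_
    have : 0 ≤ ‖z‖ ^ 3 * m₃ (k + 1) := mul_nonneg (by positivity) (H.m₃_nonneg _)
    nlinarith
  · refine (H.D1_first (k + 1)).trans ?_
    linarith
  · refine (H.norm_D1_le (k + 1)).trans ?_
    linarith
  · refine ((H.D_le _ _).trans hE2).trans ?_
    linarith
  · refine (H.D2_second (k + 1)).trans ?_
    have : 0 ≤ ‖z‖ ^ 3 * q₂ (k + 1) := mul_nonneg (by positivity) (H.q₂_nonneg _)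
    nlinarith
  · refine (H.ratio_second_order hk).trans ?_
    have : 0 ≤ K * (‖z‖ ^ 3 * t (k + 1)) :=
      mul_nonneg (by linarith) (mul_nonneg (by positivity) (H.t_nonneg _))
    linarith

theorem f_eq_prod : f n = ∏ k ∈ Finset.range n, f (k + 1) / f k := by
  have h : ∀ m ≤ n, f m = ∏ k ∈ Finset.range m, f (k + 1) / f k := by
    intro m
    induction m with
    | zero => intro _; simp [H.f_zero]
    | succ m ih =>
      intro hm
      rw [Finset.prod_range_succ, ← ih (by omega), mul_div_cancel₀ _ (H.f_ne_zero (by omega))]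
  exact h n le_rfl

theorem norm_sub_exp_le :
    ‖f n - Complex.exp (z * (∑ k ∈ Finset.range n, p (k + 1) : ℝ)
        + (∑ k ∈ Finset.range n, gammaCoeff p m₂ q k : ℝ) * z ^ 2)‖
      ≤ 2 * (100 * (13 * K) ^ 2 + (4 * (13 * K)) ^ 3 * Real.exp (12 * (13 * K)))
        * (‖z‖ ^ 3 * ∑ k ∈ Finset.range n, thirdOrder p m₂ m₃ q q₂ t k)
        * Real.exp ((∑ k ∈ Finset.range n, p (k + 1)) * z.re
          + (∑ k ∈ Finset.range n, majorant p m₂ q k) * ‖z‖ ^ 2) := by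
  have h1 := norm_prod_sub_prod_le n (fun k hk => H.norm_ratio_le hk)
    (fun k _ => H.norm_exp_factor_le k)
  rw [← H.f_eq_prod, ← Complex.exp_sum, Finset.sum_add_distrib, Finset.sum_add_distrib,
    ← Finset.mul_sum, ← Finset.sum_mul, ← Finset.sum_mul, ← Finset.sum_mul] at h1
  push_cast
  refine h1.trans ?_
  gcongr
  rw [Finset.mul_sum, Finset.mul_sum]
  refine Finset.sum_le_sum fun k hk => ?_
  have h2 := H.norm_ratio_sub_exp_le (Finset.mem_range.mp hk)
  -- In the telescoped product one factor is missing; putting it back costs at most `exp (1/2) ≤ 2`,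
  -- because `p (k + 1) ‖z‖` is small.
  have h3 : Real.exp (-(p (k + 1) * z.re + majorant p m₂ q k * ‖z‖ ^ 2)) ≤ 2 := by
    have h4 : -(p (k + 1) * z.re + majorant p m₂ q k * ‖z‖ ^ 2) ≤ 1 / 2 := by
      have h5 := (abs_le.mp (Complex.abs_re_le_norm z)).1
      have h6 := mul_nonneg (H.majorant_nonneg k) (sq_nonneg ‖z‖)
      have h7 := H.p_nonneg (k + 1)
      have h8 : p (k + 1) * ‖z‖ ≤ 1 / 100 * 2.01 := by gcongr; exacts [H.p_le _, H.z_le]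
      have h9 : p (k + 1) * (-‖z‖) ≤ p (k + 1) * z.re := by gcongr
      norm_num at h8
      linarith
    refine (Real.exp_le_exp.mpr h4).trans ?_
    linarith [(exp_half_bounds (h := 1 / 2) (abs_of_pos one_half_pos).le).2.1]
  calc _ ≤ _ * 2 := mul_le_mul h2 h3 (Real.exp_pos _).le ((norm_nonneg _).trans h2)
    _ = _ := by ring

end RecursionData

/-! ### Bounded functions measurable with respect to a sub-σ-algebra -/

section BoundedMeasurable
variable {Ω : Type*} {𝕜 : Type*} [RCLike 𝕜]

/-- Bounded functions measurable with respect to a given σ-algebra. -/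
structure BddMeas (m : MeasurableSpace Ω) (g : Ω → 𝕜) : Prop where
  meas : Measurable[m] g
  bdd : ∃ C : ℝ, ∀ ω, ‖g ω‖ ≤ C

namespace BddMeas
variable {m m' : MeasurableSpace Ω} {g h : Ω → 𝕜}

theorem mono (hg : BddMeas m g) (hm : m ≤ m') : BddMeas m' g :=
  ⟨hg.meas.mono hm le_rfl, hg.bdd⟩

theorem mul (hg : BddMeas m g) (hh : BddMeas m h) : BddMeas m (fun ω => g ω * h ω) := by
  obtain ⟨C, hC⟩ := hg.bdd
  obtain ⟨C', hC'⟩ := hh.bdd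
  refine ⟨hg.meas.mul hh.meas, C * C', fun ω => ?_⟩
  rw [norm_mul]
  exact mul_le_mul (hC ω) (hC' ω) (norm_nonneg _) ((norm_nonneg _).trans (hC ω))

theorem add (hg : BddMeas m g) (hh : BddMeas m h) : BddMeas m (fun ω => g ω + h ω) := by
  obtain ⟨C, hC⟩ := hg.bdd
  obtain ⟨C', hC'⟩ := hh.bdd
  exact ⟨hg.meas.add hh.meas, C + C', fun ω => norm_add_le_of_le (hC ω) (hC' ω)⟩

theorem const (c : 𝕜) : BddMeas m (fun _ : Ω => c) := ⟨measurable_const, ‖c‖, fun _ => le_rfl⟩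

theorem prod {ι : Type*} (s : Finset ι) {g : ι → Ω → 𝕜} (hg : ∀ i ∈ s, BddMeas m (g i)) :
    BddMeas m (fun ω => ∏ i ∈ s, g i ω) := by
  classical
  induction s using Finset.induction_on with
  | empty => simpa using const (1 : 𝕜)
  | insert a s ha ih =>
    simp_rw [Finset.prod_insert ha]
    exact (hg a (by simp)).mul (ih fun i hi => hg i (by simp [hi]))

theorem integrable {mΩ : MeasurableSpace Ω} {μ : Measure Ω} [IsFiniteMeasure μ] {g : Ω → 𝕜}
    (hg : BddMeas mΩ g) : Integrable g μ := by
  obtain ⟨C, hC⟩ := hg.bdd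
  exact Integrable.of_bound hg.meas.aestronglyMeasurable C (Filter.Eventually.of_forall hC)

theorem integral_mul {m m' mΩ : MeasurableSpace Ω} {μ : Measure Ω} {g h : Ω → 𝕜} (hm : m ≤ mΩ)
    (hm' : m' ≤ mΩ) (hind : Indep m m' μ) (hg : BddMeas m g) (hh : BddMeas m' h) :
    ∫ ω, g ω * h ω ∂μ = (∫ ω, g ω ∂μ) * ∫ ω, h ω ∂μ := by
  refine IndepFun.integral_fun_mul_eq_mul_integral ?_
    (hg.mono hm).meas.aestronglyMeasurable (hh.mono hm').meas.aestronglyMeasurable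
  rw [IndepFun_iff_Indep]
  exact indep_of_indep_of_le hind hg.meas.comap_le hh.meas.comap_le

theorem comp_of_le {Y : Ω → ℕ} {B : ℕ} (hY : ∀ ω, Y ω ≤ B) (φ : ℕ → 𝕜)
    (hm : MeasurableSpace.comap Y ⊤ ≤ m) : BddMeas m (fun ω => φ (Y ω)) := by
  refine ⟨?_, ∑ i ∈ Finset.range (B + 1), ‖φ i‖, fun ω => ?_⟩
  · have h1 : Measurable[m] Y := fun s _ => hm _ ⟨s, trivial, rfl⟩
    exact (measurable_from_top (f := φ)).comp h1
  · exact Finset.single_le_sum (f := fun i => ‖φ i‖) (fun i _ => norm_nonneg _)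
      (by simpa [Nat.lt_succ_iff] using hY ω)

end BddMeas
end BoundedMeasurable

/-! ### Bounded 1-dependent sequences and their block expansion -/

section Dependent
variable {Ω : Type*} {mΩ : MeasurableSpace Ω}

/-- The σ-algebra generated by the variables with index at most `s`. -/
@[reducible] def past (Y : ℕ → Ω → ℕ) (s : ℕ) : MeasurableSpace Ω :=
  ⨆ i ∈ Set.Iic s, MeasurableSpace.comap (Y i) ⊤

/-- The σ-algebra generated by the variables with index at least `t`. -/
@[reducible] def future (Y : ℕ → Ω → ℕ) (t : ℕ) : MeasurableSpace Ω :=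
  ⨆ i ∈ Set.Ici t, MeasurableSpace.comap (Y i) ⊤

theorem comap_le_past (Y : ℕ → Ω → ℕ) {i s : ℕ} (h : i ≤ s) :
    MeasurableSpace.comap (Y i) ⊤ ≤ past Y s :=
  le_iSup₂_of_le (f := fun i (_ : i ∈ Set.Iic s) => MeasurableSpace.comap (Y i) ⊤) i h le_rfl

theorem comap_le_future (Y : ℕ → Ω → ℕ) {i t : ℕ} (h : t ≤ i) :
    MeasurableSpace.comap (Y i) ⊤ ≤ future Y t :=
  le_iSup₂_of_le (f := fun i (_ : i ∈ Set.Ici t) => MeasurableSpace.comap (Y i) ⊤) i h le_rfl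

/-- A uniformly bounded 1-dependent sequence starting with `Y 0 = 0`. -/
structure BddOneDep (μ : Measure Ω) (B : ℕ) (Y : ℕ → Ω → ℕ) : Prop where
  meas : ∀ k, Measurable (Y k)
  le : ∀ k ω, Y k ω ≤ B
  zero : ∀ ω, Y 0 ω = 0
  indep : ∀ s t, s + 1 < t → Indep (past Y s) (future Y t) μ

namespace BddOneDep
variable {μ : Measure Ω} {B : ℕ} {Y : ℕ → Ω → ℕ} (hY : BddOneDep μ B Y)
include hY

theorem past_le (s : ℕ) : past Y s ≤ mΩ := iSup₂_le fun i _ => (hY.meas i).comap_le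

theorem future_le (s : ℕ) : future Y s ≤ mΩ := iSup₂_le fun i _ => (hY.meas i).comap_le

variable {𝕜 : Type*} [RCLike 𝕜]

theorem comp (φ : ℕ → 𝕜) (k : ℕ) : BddMeas mΩ (fun ω => φ (Y k ω)) :=
  BddMeas.comp_of_le (hY.le k) φ (hY.meas k).comap_le

theorem comp_past (φ : ℕ → 𝕜) {k s : ℕ} (h : k ≤ s) : BddMeas (past Y s) (fun ω => φ (Y k ω)) :=
  BddMeas.comp_of_le (hY.le k) φ (comap_le_past Y h)

theorem comp_future (φ : ℕ → 𝕜) {k s : ℕ} (h : s ≤ k) :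
    BddMeas (future Y s) (fun ω => φ (Y k ω)) :=
  BddMeas.comp_of_le (hY.le k) φ (comap_le_future Y h)

theorem integral_mul {s t : ℕ} (hst : s + 1 < t) {g h : Ω → 𝕜} (hg : BddMeas (past Y s) g)
    (hh : BddMeas (future Y t) h) :
    ∫ ω, g ω * h ω ∂μ = (∫ ω, g ω ∂μ) * ∫ ω, h ω ∂μ :=
  BddMeas.integral_mul (hY.past_le s) (hY.future_le t) (hY.indep s t hst) hg hh

end BddOneDep

/-- `(1 + z) ^ y - 1` at `w = 1 + z`. -/
noncomputable def powSubOne (w : ℂ) (y : ℕ) : ℂ := w ^ y - 1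

/-- The generating function of the partial sums. -/
noncomputable def genFun (μ : Measure Ω) (Y : ℕ → Ω → ℕ) (w : ℂ) (k : ℕ) : ℂ :=
  ∫ ω, ∏ i ∈ Finset.range k, w ^ (Y (i + 1) ω) ∂μ

/-- The expectation of the product of `w ^ Y i - 1` over the last `j` indices `i ≤ k`. -/
noncomputable def blockExp (μ : Measure Ω) (Y : ℕ → Ω → ℕ) (w : ℂ) (j k : ℕ) : ℂ :=
  ∫ ω, ∏ i ∈ Finset.range j, powSubOne w (Y (k - i) ω) ∂μ

/-- The expectation of the norm of the product of `w ^ Y i - 1` over the last `j` indices. -/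
noncomputable def blockNorm (μ : Measure Ω) (Y : ℕ → Ω → ℕ) (w : ℂ) (j k : ℕ) : ℝ :=
  ∫ ω, ∏ i ∈ Finset.range j, ‖powSubOne w (Y (k - i) ω)‖ ∂μ

namespace BddOneDep
variable {μ : Measure Ω} [IsProbabilityMeasure μ] {B : ℕ} {Y : ℕ → Ω → ℕ} (hY : BddOneDep μ B Y)
  (w : ℂ)

theorem genFun_zero : genFun μ Y w 0 = 1 := by simp [genFun]

include hY

omit [IsProbabilityMeasure μ] in
theorem blockExp_eq_zero {j k : ℕ} (h : k < j) : blockExp μ Y w j k = 0 := by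
  unfold blockExp
  have : ∀ ω, ∏ i ∈ Finset.range j, powSubOne w (Y (k - i) ω) = 0 := fun ω =>
    Finset.prod_eq_zero (Finset.mem_range.mpr h) (by simp [powSubOne, hY.zero])
  simp [this]

/-- In the remainder, the factor `w ^ Y` next to the block is split as `1 + (w ^ Y - 1)`. The second
summand lengthens the block. The first leaves an unused index between the prefix and the block, so
1-dependence factorizes the expectation. -/
theorem genFun_telescope {k J : ℕ} (hJ : J ≤ k) :
    genFun μ Y w k = ∑ j ∈ Finset.range J, genFun μ Y w (k - j - 1) * blockExp μ Y w j k
      + ∫ ω, (∏ i ∈ Finset.range (k - J), w ^ (Y (i + 1) ω))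
          * ∏ i ∈ Finset.range J, powSubOne w (Y (k - i) ω) ∂μ := by
  induction J with
  | zero => simp [genFun]
  | succ J ih =>
    rw [ih (by omega), Finset.sum_range_succ, add_assoc]
    congr 1
    obtain ⟨m, hm⟩ : ∃ m, k - J = m + 1 := ⟨k - J - 1, by omega⟩
    have h1 : k - J - 1 = m := by omega
    have h2 : k - (J + 1) = m := by omega
    rw [h1, h2, hm]
    -- The prefix uses indices up to `m`, the block starts at `m + 2`, and index `m + 1` is the gap.
    have hg : BddMeas (past Y m) (fun ω => ∏ i ∈ Finset.range m, w ^ (Y (i + 1) ω)) :=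
      BddMeas.prod _ fun i hi => hY.comp_past (fun y => w ^ y)
        (by have := Finset.mem_range.mp hi; omega)
    have hh : BddMeas (future Y (m + 2))
        (fun ω => ∏ i ∈ Finset.range J, powSubOne w (Y (k - i) ω)) :=
      BddMeas.prod _ fun i hi => hY.comp_future (powSubOne w)
        (by have := Finset.mem_range.mp hi; omega)
    have hgh := hY.integral_mul (by omega) hg hh
    unfold genFun blockExp
    rw [← hgh]
    have hgm := hg.mono (hY.past_le _)
    have hhm := hh.mono (hY.future_le _)
    rw [← integral_add (hgm.mul hhm).integrable
      (hgm.mul (BddMeas.prod _ fun i _ => hY.comp (powSubOne w) (k - i))).integrable]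
    congr 1
    funext ω
    rw [Finset.prod_range_succ, Finset.prod_range_succ, hm]
    unfold powSubOne
    ring

theorem genFun_succ (k : ℕ) : genFun μ Y w (k + 1) = genFun μ Y w k
    + ∑ j ∈ Finset.range (k + 1), genFun μ Y w (k - (j + 1)) * blockExp μ Y w (j + 1) (k + 1) := by
  rw [hY.genFun_telescope w (le_refl (k + 1)), Nat.sub_self, Finset.sum_range_succ']
  rw [Finset.sum_range_succ]
  have h1 : blockExp μ Y w 0 (k + 1) = 1 := by simp [blockExp]
  -- The block reaching down to index `1` has no prefix; truncated subtraction lets it fit the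
  -- general term with `genFun` at `0`, which is `1`.
  have h2 : k - (k + 1) = 0 := by omega
  rw [h1, h2, genFun_zero, one_mul, mul_one]
  have h3 : ∀ j, k + 1 - (j + 1) - 1 = k - (j + 1) := fun j => by omega
  simp only [h3, Nat.sub_zero, Nat.add_sub_cancel, Finset.range_zero, Finset.prod_empty, one_mul]
  unfold blockExp
  ring

omit [IsProbabilityMeasure μ] hY in
theorem norm_blockExp_le (j k : ℕ) : ‖blockExp μ Y w j k‖ ≤ blockNorm μ Y w j k := by
  unfold blockExp blockNorm
  refine (norm_integral_le_integral_norm _).trans (le_of_eq ?_)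
  simp_rw [norm_prod]

end BddOneDep

/-! ### Pointwise bounds -/

section Pointwise
variable {w : ℂ} {B : ℕ} (hw : ‖w‖ ^ (B + 1) ≤ 1.01)
include hw

/-- The hypothesis on the single power `B + 1` controls all powers that occur, whichever side of the
unit circle `w` lies on. -/
theorem norm_pow_le_of_le {i : ℕ} (hi : i ≤ B + 1) : ‖w‖ ^ i ≤ 1.01 := by
  rcases le_total ‖w‖ 1 with h | h
  · exact (pow_le_one₀ (norm_nonneg _) h).trans (by norm_num)
  · exact (pow_le_pow_right₀ h hi).trans hw

theorem norm_sub_one_le_of_pow : ‖w - 1‖ ≤ 2.01 := by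
  refine (norm_sub_le _ _).trans ?_
  have := norm_pow_le_of_le hw (i := 1) (by omega)
  rw [pow_one] at this
  rw [norm_one]
  norm_num at this ⊢
  linarith

theorem norm_powSubOne_le_two {y : ℕ} (hy : y ≤ B) : ‖powSubOne w y‖ ≤ 2.02 := by
  unfold powSubOne
  refine (norm_sub_le _ _).trans ?_
  rw [norm_pow, norm_one]
  have := norm_pow_le_of_le hw (i := y) (by omega)
  norm_num at this ⊢
  linarith

theorem norm_powSubOne_le {y : ℕ} (hy : y ≤ B) : ‖powSubOne w y‖ ≤ 1.01 * (‖w - 1‖ * y) := by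
  unfold powSubOne
  rw [← geom_sum_mul w y, norm_mul, mul_comm]
  have : ‖∑ i ∈ Finset.range y, w ^ i‖ ≤ ∑ i ∈ Finset.range y, (1.01 : ℝ) :=
    norm_sum_le_of_le _ fun i hi => by
      rw [norm_pow]
      exact norm_pow_le_of_le hw (by have := Finset.mem_range.mp hi; omega)
  rw [Finset.sum_const, Finset.card_range, nsmul_eq_mul] at this
  calc _ ≤ ‖w - 1‖ * (y * 1.01) := by gcongr
    _ = _ := by ring

theorem norm_powSubOne_sub_le {y : ℕ} (hy : y ≤ B) :
    ‖powSubOne w y - (w - 1) * y‖ ≤ 0.51 * (‖w - 1‖ ^ 2 * (y * (y - 1))) := by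
  induction y with
  | zero => simp [powSubOne]
  | succ y ih =>
    have h1 := ih (by omega)
    have h2 := norm_powSubOne_le hw (y := y) (by omega)
    -- The increment is `z` times the error of one order less, so the factorial moments appear by
    -- summation; `0.51` exceeds `1.01 / 2`.
    have h3 : powSubOne w (y + 1) - (w - 1) * ((y + 1 : ℕ) : ℂ)
        = (powSubOne w y - (w - 1) * y) + (w - 1) * powSubOne w y := by
      unfold powSubOne; push_cast; ring
    rw [h3]
    refine (norm_add_le _ _).trans ?_
    rw [norm_mul]
    have h4 : ‖w - 1‖ * ‖powSubOne w y‖ ≤ 1.01 * (‖w - 1‖ ^ 2 * y) := by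
      calc _ ≤ ‖w - 1‖ * (1.01 * (‖w - 1‖ * y)) := by gcongr
        _ = _ := by ring
    have h5 : 0 ≤ ‖w - 1‖ ^ 2 * (y : ℝ) := by positivity
    have h6 : ‖w - 1‖ ^ 2 * (((y + 1 : ℕ) : ℝ) * (((y + 1 : ℕ) : ℝ) - 1))
        = ‖w - 1‖ ^ 2 * (y * (y - 1)) + 2 * (‖w - 1‖ ^ 2 * y) := by push_cast; ring
    rw [h6]
    norm_num at h1 h4 ⊢
    linarith

theorem norm_powSubOne_sub_sub_le {y : ℕ} (hy : y ≤ B) :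
    ‖powSubOne w y - (w - 1) * y - (w - 1) ^ 2 * (y * (y - 1)) / 2‖
      ≤ ‖w - 1‖ ^ 3 * (y * (y - 1) * (y - 2)) := by
  induction y with
  | zero => simp [powSubOne]
  | succ y ih =>
    have h1 := ih (by omega)
    have h2 := norm_powSubOne_sub_le hw (y := y) (by omega)
    have h3 : powSubOne w (y + 1) - (w - 1) * ((y + 1 : ℕ) : ℂ)
          - (w - 1) ^ 2 * (((y + 1 : ℕ) : ℂ) * (((y + 1 : ℕ) : ℂ) - 1)) / 2
        = (powSubOne w y - (w - 1) * y - (w - 1) ^ 2 * (y * (y - 1)) / 2)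
          + (w - 1) * (powSubOne w y - (w - 1) * y) := by
      unfold powSubOne; push_cast; ring
    rw [h3]
    refine (norm_add_le _ _).trans ?_
    rw [norm_mul]
    have h4 : ‖w - 1‖ * ‖powSubOne w y - (w - 1) * y‖
        ≤ 0.51 * (‖w - 1‖ ^ 3 * (y * (y - 1))) := by
      calc _ ≤ ‖w - 1‖ * (0.51 * (‖w - 1‖ ^ 2 * (y * (y - 1)))) := by gcongr
        _ = _ := by ring
    have h5 : 0 ≤ ‖w - 1‖ ^ 3 * ((y : ℝ) * (y - 1)) := by
      refine mul_nonneg (by positivity) ?_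
      cases y with
      | zero => simp
      | succ y => push_cast; rw [add_sub_cancel_right]; positivity
    have h6 : ‖w - 1‖ ^ 3 * (((y + 1 : ℕ) : ℝ) * (((y + 1 : ℕ) : ℝ) - 1) * (((y + 1 : ℕ) : ℝ) - 2))
        = ‖w - 1‖ ^ 3 * (y * (y - 1) * (y - 2)) + 3 * (‖w - 1‖ ^ 3 * (y * (y - 1))) := by
      push_cast; ring
    rw [h6]
    norm_num at h1 h4 ⊢
    linarith

end Pointwise

end Dependent

/-! ### Moments and the verification of the recursion data -/

section Moments
variable {Ω : Type*} {mΩ : MeasurableSpace Ω} (μ : Measure Ω) (Y : ℕ → Ω → ℕ)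

noncomputable def mom₁ (k : ℕ) : ℝ := ∫ ω, (Y k ω : ℝ) ∂μ

noncomputable def mom₂ (k : ℕ) : ℝ := ∫ ω, (Y k ω : ℝ) * (Y k ω - 1) ∂μ

noncomputable def mom₃ (k : ℕ) : ℝ := ∫ ω, (Y k ω : ℝ) * (Y k ω - 1) * (Y k ω - 2) ∂μ

/-- For `k = 0` truncated subtraction pairs `Y 0` with itself; this is harmless, since `Y 0`
vanishes in the sequences considered. -/
noncomputable def mix (k : ℕ) : ℝ := ∫ ω, (Y (k - 1) ω : ℝ) * Y k ω ∂μ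

noncomputable def mix₂ (k : ℕ) : ℝ :=
  ∫ ω, (Y (k - 1) ω : ℝ) * (Y (k - 1) ω - 1) * Y k ω ∂μ
    + ∫ ω, (Y (k - 1) ω : ℝ) * (Y k ω * (Y k ω - 1)) ∂μ

noncomputable def mix₃ (k : ℕ) : ℝ := ∫ ω, (Y (k - 2) ω : ℝ) * Y (k - 1) ω * Y k ω ∂μ

theorem natCast_mul_sub_one_nonneg (y : ℕ) : (0 : ℝ) ≤ (y : ℝ) * (y - 1) := by
  cases y with
  | zero => simp
  | succ y => push_cast; rw [add_sub_cancel_right]; positivity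

theorem natCast_mul_sub_one_mul_nonneg (y : ℕ) : (0 : ℝ) ≤ (y : ℝ) * (y - 1) * (y - 2) := by
  rcases y with _ | _ | y
  · simp
  · simp
  · push_cast
    have h1 : (y : ℝ) + 1 + 1 - 1 = y + 1 := by ring
    have h2 : (y : ℝ) + 1 + 1 - 2 = y := by ring
    rw [h1, h2]
    positivity

theorem integral_mul_le_mul {f g : Ω → ℝ} {c : ℝ} [IsFiniteMeasure μ] (hf : BddMeas mΩ f)
    (hg : BddMeas mΩ g) (h : ∀ ω, f ω ≤ c * g ω) : ∫ ω, f ω ∂μ ≤ c * ∫ ω, g ω ∂μ := by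
  rw [← integral_const_mul]
  exact integral_mono hf.integrable (((BddMeas.const c).mul hg).integrable) h

theorem norm_integral_le_mul {f : Ω → ℂ} {g : Ω → ℝ} {c : ℝ} [IsFiniteMeasure μ]
    (hg : BddMeas mΩ g) (h : ∀ ω, ‖f ω‖ ≤ c * g ω) : ‖∫ ω, f ω ∂μ‖ ≤ c * ∫ ω, g ω ∂μ := by
  rw [← integral_const_mul]
  exact norm_integral_le_of_norm_le (((BddMeas.const c).mul hg).integrable)
    (Filter.Eventually.of_forall h)

variable {μ Y} in
theorem ofReal_mom₁ (k : ℕ) : ((mom₁ μ Y k : ℝ) : ℂ) = ∫ ω, (Y k ω : ℂ) ∂μ := by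
  rw [mom₁, ← integral_complex_ofReal]
  simp

variable {μ Y} in
theorem ofReal_mom₂ (k : ℕ) :
    ((mom₂ μ Y k : ℝ) : ℂ) = ∫ ω, (Y k ω : ℂ) * (Y k ω - 1) ∂μ := by
  rw [mom₂, ← integral_complex_ofReal]
  simp

variable {μ Y} in
theorem ofReal_mix (k : ℕ) :
    ((mix μ Y k : ℝ) : ℂ) = ∫ ω, (Y (k - 1) ω : ℂ) * Y k ω ∂μ := by
  rw [mix, ← integral_complex_ofReal]
  simp

variable {μ Y} in
theorem blockNorm_one (w : ℂ) (k : ℕ) : blockNorm μ Y w 1 k = ∫ ω, ‖powSubOne w (Y k ω)‖ ∂μ := by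
  simp [blockNorm]

namespace BddOneDep
variable {μ Y} [IsProbabilityMeasure μ] {B : ℕ} (hY : BddOneDep μ B Y)
include hY

omit [IsProbabilityMeasure μ] in
theorem bddMeas_cast (k : ℕ) : BddMeas mΩ (fun ω => (Y k ω : ℝ)) :=
  hY.comp (fun y : ℕ => (y : ℝ)) k

omit [IsProbabilityMeasure μ] in
theorem bddMeas_two (k : ℕ) : BddMeas mΩ (fun ω => (Y k ω : ℝ) * (Y k ω - 1)) :=
  hY.comp (fun y : ℕ => (y : ℝ) * (y - 1)) k

omit [IsProbabilityMeasure μ] in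
theorem bddMeas_three (k : ℕ) : BddMeas mΩ (fun ω => (Y k ω : ℝ) * (Y k ω - 1) * (Y k ω - 2)) :=
  hY.comp (fun y : ℕ => (y : ℝ) * (y - 1) * (y - 2)) k

omit [IsProbabilityMeasure μ] in
theorem bddMeas_norm (w : ℂ) (k : ℕ) : BddMeas mΩ (fun ω => ‖powSubOne w (Y k ω)‖) :=
  hY.comp (fun y => ‖powSubOne w y‖) k

omit [IsProbabilityMeasure μ] in
theorem bddMeas_block (w : ℂ) (j k : ℕ) :
    BddMeas mΩ (fun ω => ∏ i ∈ Finset.range j, ‖powSubOne w (Y (k - i) ω)‖) :=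
  BddMeas.prod _ fun _ _ => hY.bddMeas_norm w _

theorem blockNorm_succ_le {w : ℂ} (hw : ‖w‖ ^ (B + 1) ≤ 1.01) (j k : ℕ) :
    blockNorm μ Y w (j + 1) k ≤ 2.02 * blockNorm μ Y w j k := by
  unfold blockNorm
  refine integral_mul_le_mul μ (hY.bddMeas_block w _ k) (hY.bddMeas_block w _ k) fun ω => ?_
  rw [Finset.prod_range_succ, mul_comm]
  have := norm_powSubOne_le_two hw (hY.le (k - j) ω)
  gcongr

theorem blockNorm_one_le {w : ℂ} (hw : ‖w‖ ^ (B + 1) ≤ 1.01) (k : ℕ) :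
    blockNorm μ Y w 1 k ≤ 1.01 * (‖w - 1‖ * mom₁ μ Y k) := by
  rw [blockNorm_one, ← mul_assoc]
  refine integral_mul_le_mul μ (hY.bddMeas_norm w k) (hY.bddMeas_cast k) fun ω => ?_
  rw [mul_assoc]
  exact norm_powSubOne_le hw (hY.le k ω)

/-- Bounding the next variable of the block by `2.02` creates a gap. The variable beyond it is
independent of the first `j + 1` factors and contributes at most `0.0204`, and `2.02 * 0.0204 ≤
1/24`. -/
theorem blockNorm_add_two_le {w : ℂ} (hw : ‖w‖ ^ (B + 1) ≤ 1.01)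
    (hp : ∀ k, blockNorm μ Y w 1 k ≤ 0.0204) (j k : ℕ) :
    blockNorm μ Y w (j + 3) k ≤ 1 / 24 * blockNorm μ Y w (j + 1) k := by
  have hnn : 0 ≤ blockNorm μ Y w (j + 1) k :=
    integral_nonneg fun ω => Finset.prod_nonneg fun _ _ => norm_nonneg _
  have h1 : blockNorm μ Y w (j + 3) k
      ≤ 2.02 * ∫ ω, ‖powSubOne w (Y (k - (j + 2)) ω)‖
        * ∏ i ∈ Finset.range (j + 1), ‖powSubOne w (Y (k - i) ω)‖ ∂μ := by
    refine integral_mul_le_mul μ (hY.bddMeas_block w _ k)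
      ((hY.bddMeas_norm w _).mul (hY.bddMeas_block w _ k)) fun ω => ?_
    rw [Finset.prod_range_succ, Finset.prod_range_succ]
    have h2 := norm_powSubOne_le_two hw (hY.le (k - (j + 1)) ω)
    have h3 : 0 ≤ ∏ i ∈ Finset.range (j + 1), ‖powSubOne w (Y (k - i) ω)‖ :=
      Finset.prod_nonneg fun _ _ => norm_nonneg _
    set P := ∏ i ∈ Finset.range (j + 1), ‖powSubOne w (Y (k - i) ω)‖
    calc _ ≤ P * 2.02 * ‖powSubOne w (Y (k - (j + 2)) ω)‖ := by gcongr
      _ = _ := by ring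
  refine h1.trans ?_
  -- If the block is longer than the sequence, its last index is truncated to `0`, where the factor
  -- vanishes.
  rcases Nat.lt_or_ge k (j + 3) with h | h
  · have : ∀ ω, powSubOne w (Y (k - (j + 2)) ω) = 0 := fun ω => by
      rw [show k - (j + 2) = 0 by omega, hY.zero]; simp [powSubOne]
    simp only [this, norm_zero, zero_mul, integral_zero, mul_zero]
    positivity
  · have hg : BddMeas (past Y (k - (j + 2))) (fun ω => ‖powSubOne w (Y (k - (j + 2)) ω)‖) :=
      hY.comp_past (fun y => ‖powSubOne w y‖) le_rfl
    have hh : BddMeas (future Y (k - j))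
        (fun ω => ∏ i ∈ Finset.range (j + 1), ‖powSubOne w (Y (k - i) ω)‖) :=
      BddMeas.prod _ fun i hi => hY.comp_future (fun y => ‖powSubOne w y‖)
        (by have := Finset.mem_range.mp hi; omega)
    rw [hY.integral_mul (by omega) hg hh, ← blockNorm_one w]
    have h4 := hp (k - (j + 2))
    change 2.02 * (_ * blockNorm μ Y w (j + 1) k) ≤ _
    calc _ ≤ 2.02 * (0.0204 * blockNorm μ Y w (j + 1) k) := by gcongr
      _ ≤ _ := by
        rw [← mul_assoc]; gcongr; norm_num

omit [IsProbabilityMeasure μ] in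
theorem mom₁_zero : mom₁ μ Y 0 = 0 := by simp [mom₁, hY.zero]

theorem mix_le (k : ℕ) : mix μ Y k ≤ B * mom₁ μ Y k := by
  refine integral_mul_le_mul μ ((hY.bddMeas_cast _).mul (hY.bddMeas_cast _)) (hY.bddMeas_cast k)
    fun ω => ?_
  gcongr
  exact hY.le _ ω

theorem recursionData {w : ℂ} (hw : ‖w‖ ^ (B + 1) ≤ 1.01) (h1 : ∀ k, mom₁ μ Y k ≤ 1 / 100)
    (h2 : ∀ k, mom₂ μ Y k ≤ mom₁ μ Y k) (n : ℕ) :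
    RecursionData (w - 1) (B + 2) n (genFun μ Y w) (blockExp μ Y w) (blockNorm μ Y w) (mom₁ μ Y)
      (mom₂ μ Y) (mom₃ μ Y) (mix μ Y) (mix₂ μ Y) (mix₃ μ Y) := by
  have hz := norm_sub_one_le_of_pow hw
  have hnn₁ : ∀ k, 0 ≤ mom₁ μ Y k := fun k => integral_nonneg fun ω => by positivity
  have hE1 : ∀ k, blockNorm μ Y w 1 k ≤ 0.0204 := fun k => by
    refine (hY.blockNorm_one_le hw k).trans ?_
    calc 1.01 * (‖w - 1‖ * mom₁ μ Y k) ≤ 1.01 * (2.01 * (1 / 100)) := by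
          have := hnn₁ k
          gcongr
          exact h1 k
      _ ≤ _ := by norm_num
  have hB : (0 : ℝ) ≤ B := Nat.cast_nonneg B
  refine
    { f_zero := BddOneDep.genFun_zero w
      f_succ := fun k _ => hY.genFun_succ w k
      D_eq_zero := fun j k h => hY.blockExp_eq_zero w h
      D_le := fun j k => BddOneDep.norm_blockExp_le w j k
      E_two := fun j k => hY.blockNorm_add_two_le hw hE1 j k
      E_one := fun j k => hY.blockNorm_succ_le hw (j + 1) k
      E1_le := hE1
      E2_le := fun k => ?_
      z_le := hz
      one_le_K := by linarith
      p_nonneg := hnn₁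
      m₂_nonneg := fun k => integral_nonneg fun ω => natCast_mul_sub_one_nonneg _
      m₃_nonneg := fun k => integral_nonneg fun ω => natCast_mul_sub_one_mul_nonneg _
      q_nonneg := fun k => integral_nonneg fun ω => by positivity
      q₂_nonneg := fun k => add_nonneg
        (integral_nonneg fun ω => mul_nonneg (natCast_mul_sub_one_nonneg _) (Nat.cast_nonneg _))
        (integral_nonneg fun ω => mul_nonneg (Nat.cast_nonneg _) (natCast_mul_sub_one_nonneg _))
      t_nonneg := fun k => integral_nonneg fun ω => by positivity
      p_zero := hY.mom₁_zero
      p_le := h1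
      m₂_le := h2
      q_le := fun k => (hY.mix_le k).trans (by have := hnn₁ k; gcongr; linarith)
      E1_le' := hY.blockNorm_one_le hw
      E2_le' := fun k => ?_
      E3_le' := fun k => ?_
      D1_first := fun k => ?_
      D1_second := fun k => ?_
      D2_second := fun k => ?_ }
  · refine (hY.blockNorm_succ_le hw 1 k).trans ?_
    have := hE1 k
    norm_num at this ⊢
    linarith
  · rw [← mul_assoc]
    refine integral_mul_le_mul μ (hY.bddMeas_block w _ k)
      ((hY.bddMeas_cast _).mul (hY.bddMeas_cast _)) fun ω => ?_
    simp only [Finset.prod_range_succ, Finset.range_zero, Finset.prod_empty, one_mul, Nat.sub_zero]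
    have a1 := norm_powSubOne_le hw (hY.le k ω)
    have a2 := norm_powSubOne_le hw (hY.le (k - 1) ω)
    calc _ ≤ (1.01 * (‖w - 1‖ * Y k ω)) * (1.01 * (‖w - 1‖ * Y (k - 1) ω)) := by gcongr
      _ = 1.01 ^ 2 * (‖w - 1‖ ^ 2 * (Y (k - 1) ω * Y k ω)) := by ring
      _ ≤ 1.03 * (‖w - 1‖ ^ 2 * (Y (k - 1) ω * Y k ω)) := by gcongr; norm_num
      _ = _ := by ring
  · rw [← mul_assoc]
    refine integral_mul_le_mul μ (hY.bddMeas_block w _ k)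
      (((hY.bddMeas_cast _).mul (hY.bddMeas_cast _)).mul (hY.bddMeas_cast _)) fun ω => ?_
    simp only [Finset.prod_range_succ, Finset.range_zero, Finset.prod_empty, one_mul, Nat.sub_zero]
    have a1 := norm_powSubOne_le hw (hY.le k ω)
    have a2 := norm_powSubOne_le hw (hY.le (k - 1) ω)
    have a3 := norm_powSubOne_le hw (hY.le (k - 2) ω)
    calc _ ≤ (1.01 * (‖w - 1‖ * Y k ω)) * (1.01 * (‖w - 1‖ * Y (k - 1) ω))
          * (1.01 * (‖w - 1‖ * Y (k - 2) ω)) := by gcongr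
      _ = 1.01 ^ 3 * (‖w - 1‖ ^ 3 * (Y (k - 2) ω * Y (k - 1) ω * Y k ω)) := by ring
      _ ≤ (B + 2) * (‖w - 1‖ ^ 3 * (Y (k - 2) ω * Y (k - 1) ω * Y k ω)) := by
        gcongr
        norm_num
        linarith
      _ = _ := by ring
  · have e : blockExp μ Y w 1 k - (w - 1) * mom₁ μ Y k
        = ∫ ω, (powSubOne w (Y k ω) - (w - 1) * Y k ω) ∂μ := by
      rw [integral_sub (hY.comp (powSubOne w) k).integrable
        (hY.comp (fun y : ℕ => (w - 1) * (y : ℂ)) k).integrable, integral_const_mul]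
      rw [ofReal_mom₁]
      simp only [blockExp, Finset.prod_range_one, Nat.sub_zero]
    rw [e, ← mul_assoc]
    refine norm_integral_le_mul μ (hY.bddMeas_two k) fun ω => ?_
    rw [mul_assoc]
    exact norm_powSubOne_sub_le hw (hY.le k ω)
  · have e : blockExp μ Y w 1 k - (w - 1) * mom₁ μ Y k - (w - 1) ^ 2 * mom₂ μ Y k / 2
        = ∫ ω, (powSubOne w (Y k ω) - (w - 1) * Y k ω
          - (w - 1) ^ 2 * (Y k ω * (Y k ω - 1)) / 2) ∂μ := by
      rw [integral_sub (hY.comp (fun y => powSubOne w y - (w - 1) * (y : ℂ)) k).integrable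
          (hY.comp (fun y : ℕ => (w - 1) ^ 2 * ((y : ℂ) * (y - 1)) / 2) k).integrable,
        integral_sub (hY.comp (powSubOne w) k).integrable
        (hY.comp (fun y : ℕ => (w - 1) * (y : ℂ)) k).integrable, integral_const_mul,
        integral_div, integral_const_mul]
      rw [ofReal_mom₁, ofReal_mom₂]
      simp only [blockExp, Finset.prod_range_one, Nat.sub_zero]
    rw [e, ← mul_assoc]
    refine norm_integral_le_mul μ (hY.bddMeas_three k) fun ω => ?_
    refine (norm_powSubOne_sub_sub_le hw (hY.le k ω)).trans
      (le_of_le_of_eq (le_mul_of_one_le_left ?_ (by linarith)) (mul_assoc _ _ _).symm)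
    exact mul_nonneg (by positivity) (natCast_mul_sub_one_mul_nonneg _)
  · have e : blockExp μ Y w 2 k - (w - 1) ^ 2 * mix μ Y k
        = ∫ ω, (powSubOne w (Y k ω) * powSubOne w (Y (k - 1) ω)
          - (w - 1) ^ 2 * (Y (k - 1) ω * Y k ω)) ∂μ := by
      rw [integral_sub ((hY.comp (powSubOne w) k).mul (hY.comp (powSubOne w) (k - 1))).integrable
        ((BddMeas.const _).mul ((hY.comp (fun y : ℕ => (y : ℂ)) (k - 1)).mul
          (hY.comp (fun y : ℕ => (y : ℂ)) k))).integrable, integral_const_mul]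
      simp only [blockExp, Finset.prod_range_succ, Finset.range_zero, Finset.prod_empty, one_mul,
        Nat.sub_zero]
      rw [ofReal_mix]
    have i1 := (hY.bddMeas_two (k - 1)).mul (hY.bddMeas_cast k)
    have i2 := (hY.bddMeas_cast (k - 1)).mul (hY.bddMeas_two k)
    have e2 : mix₂ μ Y k = ∫ ω, ((Y (k - 1) ω : ℝ) * (Y (k - 1) ω - 1) * Y k ω
        + (Y (k - 1) ω : ℝ) * (Y k ω * (Y k ω - 1))) ∂μ := by
      rw [integral_add i1.integrable i2.integrable]; rfl
    rw [e, e2, ← mul_assoc]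
    refine norm_integral_le_mul μ (i1.add i2) fun ω => ?_
    set y := Y k ω
    set x := Y (k - 1) ω
    have a1 := norm_powSubOne_sub_le hw (hY.le k ω)
    have a2 := norm_powSubOne_sub_le hw (hY.le (k - 1) ω)
    have a3 := norm_powSubOne_le hw (hY.le (k - 1) ω)
    have b1 := natCast_mul_sub_one_nonneg y
    have b2 := natCast_mul_sub_one_nonneg x
    have a4 : powSubOne w y * powSubOne w x - (w - 1) ^ 2 * (x * y)
        = (powSubOne w y - (w - 1) * y) * powSubOne w x
          + (w - 1) * y * (powSubOne w x - (w - 1) * x) := by ring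
    rw [a4]
    refine (norm_add_le _ _).trans ?_
    rw [norm_mul, norm_mul, norm_mul, Complex.norm_natCast]
    calc _ ≤ (0.51 * (‖w - 1‖ ^ 2 * (y * (y - 1)))) * (1.01 * (‖w - 1‖ * x))
          + ‖w - 1‖ * y * (0.51 * (‖w - 1‖ ^ 2 * (x * (x - 1)))) := by gcongr
      _ = (0.51 * 1.01) * (‖w - 1‖ ^ 3 * (x * (y * (y - 1))))
          + 0.51 * (‖w - 1‖ ^ 3 * (x * (x - 1) * y)) := by ring
      _ ≤ (B + 2) * (‖w - 1‖ ^ 3 * (x * (y * (y - 1))))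
          + (B + 2) * (‖w - 1‖ ^ 3 * (x * (x - 1) * y)) := by
        gcongr
        · norm_num; linarith
        · norm_num; linarith
      _ = _ := by ring

end BddOneDep
end Moments

theorem sum_Icc_one_eq_sum_range {M : Type*} [AddCommMonoid M] (f : ℕ → M) (n : ℕ) :
    ∑ k ∈ Finset.Icc 1 n, f k = ∑ i ∈ Finset.range n, f (i + 1) := by
  rw [Finset.range_eq_Ico, Finset.sum_Ico_add' f 0 n 1]; rfl

theorem sum_Icc_int_eq_sum_range {M : Type*} [AddCommMonoid M] (f : ℤ → M) (n : ℕ) :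
    ∑ k ∈ Finset.Icc (1 : ℤ) n, f k = ∑ i ∈ Finset.range n, f (i + 1) := by
  refine Finset.sum_nbij' (fun k => (k - 1).toNat) (fun i => (i : ℤ) + 1) ?_ ?_ ?_ ?_ ?_
  · intro k hk; simp only [Finset.mem_Icc, Finset.mem_range] at *; omega
  · intro k hk; simp only [Finset.mem_Icc, Finset.mem_range] at *; omega
  · intro k hk; simp only [Finset.mem_Icc] at *; omega
  · intro k hk; simp only [Finset.mem_range] at *; omega
  · intro k hk
    simp only [Finset.mem_Icc] at hk
    congr 1; omega

/-- Used to replace contributions of the preceding index by those of the current one. -/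
theorem sum_range_le_sum_range_succ {u : ℕ → ℝ} (h0 : u 0 = 0) (hu : ∀ k, 0 ≤ u k) (n : ℕ) :
    ∑ k ∈ Finset.range n, u k ≤ ∑ k ∈ Finset.range n, u (k + 1) := by
  have h1 := Finset.sum_range_succ' u n
  have h2 := Finset.sum_range_succ u n
  have := hu n
  linarith

/-! ### Mean, variance and transform of the partial sum -/

section SumTransform
variable {Ω : Type*} {mΩ : MeasurableSpace Ω} {μ : Measure Ω} [IsProbabilityMeasure μ] {B : ℕ}
  {Y : ℕ → Ω → ℕ} (hY : BddOneDep μ B Y)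

namespace BddOneDep
include hY

omit [IsProbabilityMeasure μ] in
theorem S_le (n : ℕ) (ω : Ω) : S Y n ω ≤ n * B := by
  unfold S
  refine (Finset.sum_le_card_nsmul _ _ B fun i _ => hY.le i ω).trans ?_
  simp

omit [IsProbabilityMeasure μ] in
theorem measurable_S (n : ℕ) : Measurable (S Y n) :=
  Finset.measurable_fun_sum _ fun i _ => hY.meas i

theorem hasTransform_pointF (n : ℕ) :
    HasTransform (zeroExt (pointF Y n μ)) (fun s => genFun μ Y (Complex.exp s) n) := by
  refine hasTransform_zeroExt fun s _ => ?_
  generalize Complex.exp s = w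
  have hms : ∀ x : ℕ, MeasurableSet {ω | S Y n ω = x} := fun x =>
    hY.measurable_S n (measurableSet_singleton x)
  have h1 : genFun μ Y w n = ∑ x ∈ Finset.range (n * B + 1), (pointF Y n μ x : ℂ) * w ^ x := by
    have h2 : ∀ ω, ∏ i ∈ Finset.range n, w ^ (Y (i + 1) ω)
        = ∑ x ∈ Finset.range (n * B + 1),
          Set.indicator {ω | S Y n ω = x} (fun _ => w ^ x) ω := by
      intro ω
      have h3 : ∏ i ∈ Finset.range n, w ^ (Y (i + 1) ω) = w ^ S Y n ω := by
        unfold S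
        rw [sum_Icc_one_eq_sum_range, Finset.prod_pow_eq_pow_sum]
      rw [h3, Finset.sum_eq_single (S Y n ω)]
      · simp
      · intro x _ hx
        rw [Set.indicator_of_notMem]
        exact fun h => hx h.symm
      · intro h
        exact absurd (Finset.mem_range.mpr (Nat.lt_succ_of_le (hY.S_le n ω))) h
    unfold genFun
    simp_rw [h2]
    rw [integral_finsetSum _ fun x _ => (integrable_const _).indicator (hms x)]
    refine Finset.sum_congr rfl fun x _ => ?_
    rw [integral_indicator_const _ (hms x), Complex.real_smul]
    rfl
  rw [h1]
  refine hasSum_sum_of_ne_finset_zero fun x hx => ?_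
  have hx' : n * B < x := by simpa using hx
  have : {ω | S Y n ω = x} = ∅ := by
    ext ω
    simp only [Set.mem_ofPred_eq, Set.mem_empty_iff_false, iff_false]
    have := hY.S_le n ω
    omega
  simp [pointF, this]

omit mΩ hY [IsProbabilityMeasure μ] in
theorem bddMeas_sum {m : MeasurableSpace Ω} (n : ℕ)
    (hm : ∀ i < n, BddMeas m (fun ω => (Y (i + 1) ω : ℝ))) :
    BddMeas m (fun ω => ∑ i ∈ Finset.range n, (Y (i + 1) ω : ℝ)) := by
  induction n with
  | zero => simpa using BddMeas.const (0 : ℝ)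
  | succ n ih =>
    simp_rw [Finset.sum_range_succ]
    exact (ih fun i hi => hm i (by omega)).add (hm n (by omega))

theorem integral_sum (n : ℕ) : ∫ ω, ∑ i ∈ Finset.range n, (Y (i + 1) ω : ℝ) ∂μ
    = ∑ i ∈ Finset.range n, mom₁ μ Y (i + 1) :=
  integral_finsetSum _ fun _ _ => (hY.bddMeas_cast _).integrable

/-- Only the neighbouring index is correlated with `Y (n + 1)`: all earlier ones factorize, and the
product of means of the neighbour is replaced by the mixed moment. -/
theorem integral_sum_mul (n : ℕ) : ∫ ω, (∑ i ∈ Finset.range n, (Y (i + 1) ω : ℝ)) * Y (n + 1) ω ∂μ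
    = (∑ i ∈ Finset.range n, mom₁ μ Y (i + 1)) * mom₁ μ Y (n + 1) + mix μ Y (n + 1)
      - mom₁ μ Y n * mom₁ μ Y (n + 1) := by
  cases n with
  | zero => simp [mix, hY.zero, hY.mom₁_zero]
  | succ n =>
    have hg : BddMeas (past Y n) (fun ω => ∑ i ∈ Finset.range n, (Y (i + 1) ω : ℝ)) :=
      bddMeas_sum n fun i hi => hY.comp_past (fun y : ℕ => (y : ℝ)) (by omega)
    have hh : BddMeas (future Y (n + 2)) (fun ω => (Y (n + 2) ω : ℝ)) :=
      hY.comp_future (fun y : ℕ => (y : ℝ)) le_rfl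
    have h1 := hY.integral_mul (by omega) hg hh
    rw [hY.integral_sum] at h1
    simp_rw [Finset.sum_range_succ, add_mul]
    rw [integral_add ((hg.mono (hY.past_le _)).mul (hh.mono (hY.future_le _))).integrable
      ((hY.bddMeas_cast _).mul (hY.bddMeas_cast _)).integrable, h1]
    simp only [mix, Nat.add_sub_cancel]
    unfold mom₁
    ring

theorem integral_sq (k : ℕ) : ∫ ω, (Y k ω : ℝ) ^ 2 ∂μ = mom₂ μ Y k + mom₁ μ Y k := by
  unfold mom₂ mom₁
  rw [← integral_add (hY.bddMeas_two k).integrable (hY.bddMeas_cast k).integrable]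
  congr 1
  funext ω
  ring

theorem integral_sum_sq (n : ℕ) : ∫ ω, (∑ i ∈ Finset.range n, (Y (i + 1) ω : ℝ)) ^ 2 ∂μ
    = (∑ i ∈ Finset.range n, mom₁ μ Y (i + 1)) ^ 2 + ∑ i ∈ Finset.range n, mom₁ μ Y (i + 1)
      + 2 * ∑ i ∈ Finset.range n, gammaCoeff (mom₁ μ Y) (mom₂ μ Y) (mix μ Y) i := by
  induction n with
  | zero => simp
  | succ n ih =>
    have hT : BddMeas mΩ (fun ω => ∑ i ∈ Finset.range n, (Y (i + 1) ω : ℝ)) :=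
      bddMeas_sum n fun i _ => hY.bddMeas_cast _
    have hc := hY.bddMeas_cast (n + 1)
    have h1 : ∀ ω, (∑ i ∈ Finset.range (n + 1), (Y (i + 1) ω : ℝ)) ^ 2
        = ((∑ i ∈ Finset.range n, (Y (i + 1) ω : ℝ)) ^ 2
          + 2 * ((∑ i ∈ Finset.range n, (Y (i + 1) ω : ℝ)) * Y (n + 1) ω))
          + (Y (n + 1) ω : ℝ) ^ 2 := by
      intro ω
      rw [Finset.sum_range_succ]; ring
    simp_rw [h1]
    have i1 : Integrable (fun ω => (∑ i ∈ Finset.range n, (Y (i + 1) ω : ℝ)) ^ 2) μ := by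
      simp_rw [pow_two]; exact (hT.mul hT).integrable
    have i2 : Integrable (fun ω => (Y (n + 1) ω : ℝ) ^ 2) μ := by
      simp_rw [pow_two]; exact (hc.mul hc).integrable
    have i3 : Integrable
        (fun ω => 2 * ((∑ i ∈ Finset.range n, (Y (i + 1) ω : ℝ)) * Y (n + 1) ω)) μ :=
      (hT.mul hc).integrable.const_mul 2
    have i13 : Integrable (fun ω => (∑ i ∈ Finset.range n, (Y (i + 1) ω : ℝ)) ^ 2
        + 2 * ((∑ i ∈ Finset.range n, (Y (i + 1) ω : ℝ)) * Y (n + 1) ω)) μ := i1.add i3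
    rw [integral_add i13 i2, integral_add i1 i3, integral_const_mul, ih,
      hY.integral_sum_mul, hY.integral_sq, Finset.sum_range_succ, Finset.sum_range_succ]
    unfold gammaCoeff
    ring

omit [IsProbabilityMeasure μ] hY in
theorem S_cast (n : ℕ) (ω : Ω) : (S Y n ω : ℝ) = ∑ i ∈ Finset.range n, (Y (i + 1) ω : ℝ) := by
  unfold S
  rw [sum_Icc_one_eq_sum_range]
  push_cast
  rfl

theorem lam_eq (n : ℕ) : lam Y n μ = ∑ i ∈ Finset.range n, mom₁ μ Y (i + 1) := by
  unfold lam
  simp_rw [S_cast]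
  exact hY.integral_sum n

/-- The second order coefficients of the factors add up to `Γ₂` exactly, so the comparison has no
error of order `z²`. -/
theorem Gam_eq (n : ℕ) :
    Gam Y n μ = ∑ i ∈ Finset.range n, gammaCoeff (mom₁ μ Y) (mom₂ μ Y) (mix μ Y) i := by
  unfold Gam
  have hT : BddMeas mΩ (fun ω => ∑ i ∈ Finset.range n, (Y (i + 1) ω : ℝ)) :=
    bddMeas_sum n fun i _ => hY.bddMeas_cast _
  have hL : MemLp (fun ω => (S Y n ω : ℝ)) 2 μ := by
    simp_rw [S_cast]
    obtain ⟨C, hC⟩ := hT.bdd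
    exact MemLp.of_bound hT.meas.aestronglyMeasurable C (Filter.Eventually.of_forall hC)
  rw [variance_eq_sub hL]
  have h1 : ∫ ω, (S Y n ω : ℝ) ∂μ = lam Y n μ := rfl
  have h2 : ∫ ω, ((fun ω => (S Y n ω : ℝ)) ^ 2) ω ∂μ = (lam Y n μ) ^ 2 + lam Y n μ
      + 2 * ∑ i ∈ Finset.range n, gammaCoeff (mom₁ μ Y) (mom₂ μ Y) (mix μ Y) i := by
    simp only [Pi.pow_apply, S_cast]
    rw [hY.lam_eq]
    exact hY.integral_sum_sq n
  rw [h1, h2, hY.lam_eq]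
  ring

theorem sum_thirdOrder_nonneg (h1 : ∀ k, mom₁ μ Y k ≤ 1 / 100)
    (h2 : ∀ k, mom₂ μ Y k ≤ mom₁ μ Y k) (n : ℕ) : 0 ≤ ∑ k ∈ Finset.range n,
      thirdOrder (mom₁ μ Y) (mom₂ μ Y) (mom₃ μ Y) (mix μ Y) (mix₂ μ Y) (mix₃ μ Y) k := by
  have H := hY.recursionData (w := 1) (by norm_num) h1 h2 n
  refine Finset.sum_nonneg fun k _ => ?_
  have := H.p_nonneg k
  have := H.p_nonneg (k + 1)
  have := H.p_nonneg (k - 1)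
  have := H.m₂_nonneg k
  have := H.m₂_nonneg (k + 1)
  have := H.m₃_nonneg (k + 1)
  have := H.q_nonneg k
  have := H.q_nonneg (k + 1)
  have := H.q₂_nonneg (k + 1)
  have := H.t_nonneg (k + 1)
  unfold thirdOrder
  positivity

/-- The generating function is close to the transform of the compound Poisson measure. -/
theorem norm_genFun_sub_compPois_le {n : ℕ} (h1 : ∀ k, mom₁ μ Y k ≤ 1 / 100)
    (h2 : ∀ k, mom₂ μ Y k ≤ mom₁ μ Y k)
    (hM : ∑ k ∈ Finset.range n, majorant (mom₁ μ Y) (mom₂ μ Y) (mix μ Y) k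
      ≤ 9 / 20 * lam Y n μ) {s : ℂ} (hs : InStrip (lam Y n μ) s)
    (hre : |s.re| ≤ 1 / (200 * (B + 1))) :
    ‖genFun μ Y (Complex.exp s) n - Complex.exp (lam Y n μ * (Complex.exp s - 1)
        + Gam Y n μ * (Complex.exp s - 1) ^ 2)‖
      ≤ 16 * (100 * (13 * (B + 2)) ^ 2 + (4 * (13 * (B + 2))) ^ 3 * Real.exp (12 * (13 * (B + 2))))
        * (∑ k ∈ Finset.range n,
          thirdOrder (mom₁ μ Y) (mom₂ μ Y) (mom₃ μ Y) (mix μ Y) (mix₂ μ Y) (mix₃ μ Y) k)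
        * ‖s‖ ^ 3 * Real.exp (gaussExp (lam Y n μ) s) := by
  -- This fixes the admissible shift: `‖exp s‖ ^ (B + 1) ≤ exp (1/200) ≤ 1.01`.
  have hw : ‖Complex.exp s‖ ^ (B + 1) ≤ 1.01 := by
    rw [Complex.norm_exp, ← Real.exp_nat_mul]
    have h3 : ((B + 1 : ℕ) : ℝ) * s.re ≤ 1 / 200 := by
      have h4 := (le_abs_self s.re).trans hre
      rw [le_div_iff₀ (by positivity)] at h4
      push_cast
      linarith
    refine (Real.exp_le_exp.mpr h3).trans ?_
    have := (abs_le.mp (Real.abs_exp_sub_one_sub_id_le (x := 1 / 200)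
      (by rw [abs_of_pos (by norm_num)]; norm_num))).2
    norm_num at this ⊢
    linarith
  have H := hY.recursionData hw h1 h2 n
  have h3 := H.norm_sub_exp_le
  rw [← hY.lam_eq, ← hY.Gam_eq, mul_comm (Complex.exp s - 1)] at h3
  refine h3.trans ?_
  set T := ∑ k ∈ Finset.range n,
          thirdOrder (mom₁ μ Y) (mom₂ μ Y) (mom₃ μ Y) (mix μ Y) (mix₂ μ Y) (mix₃ μ Y) k
  have hT : 0 ≤ T := hY.sum_thirdOrder_nonneg h1 h2 n
  have hexp : lam Y n μ * (Complex.exp s - 1).re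
      + (∑ k ∈ Finset.range n, majorant (mom₁ μ Y) (mom₂ μ Y) (mix μ Y) k)
        * ‖Complex.exp s - 1‖ ^ 2 ≤ gaussExp (lam Y n μ) s := by
    refine le_trans ?_ (hs.le_gaussExp le_rfl)
    gcongr
  set c : ℝ := 100 * (13 * (B + 2)) ^ 2 + (4 * (13 * (B + 2))) ^ 3 * Real.exp (12 * (13 * (B + 2)))
  have hc : 0 ≤ c := by positivity
  calc _ ≤ 2 * c * ((2 * ‖s‖) ^ 3 * T) * Real.exp (gaussExp (lam Y n μ) s) := by
        gcongr
        exact hs.norm_le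
    _ = _ := by ring

end BddOneDep
end SumTransform

/-! ### Approximation of bounded sequences with small moments -/

section Approximation

/-- The sum of the third order contributions of the factors. -/
noncomputable def totalThirdOrder {Ω : Type*} [MeasurableSpace Ω] (μ : Measure Ω)
    (Y : ℕ → Ω → ℕ) (n : ℕ) : ℝ :=
  ∑ k ∈ Finset.range n,
    thirdOrder (mom₁ μ Y) (mom₂ μ Y) (mom₃ μ Y) (mix μ Y) (mix₂ μ Y) (mix₃ μ Y) k

/-- The standing assumptions on a bounded 1-dependent sequence under which its partial sum is
approximated. -/
structure SmallMoments {Ω : Type*} {mΩ : MeasurableSpace Ω} (μ : Measure Ω) (B n : ℕ)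
    (Y : ℕ → Ω → ℕ) : Prop extends BddOneDep μ B Y where
  mom₁_le : ∀ k, mom₁ μ Y k ≤ 1 / 100
  mom₂_le : ∀ k, mom₂ μ Y k ≤ mom₁ μ Y k
  majorant_le : ∑ k ∈ Finset.range n, majorant (mom₁ μ Y) (mom₂ μ Y) (mix μ Y) k
      ≤ 9 / 20 * lam Y n μ
  one_le_lam : 1 ≤ lam Y n μ
  abs_Gam_le : |Gam Y n μ| ≤ 2 / 25 * lam Y n μ

/-- The triangle inequality through `exp (λ z + Γ₂ z²)` reduces each approximation to a comparison
of two explicit functions; the law of the sum enters only through the third order term. -/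
theorem SmallMoments.exists_approx (B : ℕ) :
    ∃ C : ℝ, 0 < C ∧ ∀ {Ω : Type*} [MeasurableSpace Ω] (μ : Measure Ω)
      [IsProbabilityMeasure μ] (n : ℕ) (Y : ℕ → Ω → ℕ), SmallMoments μ B n Y →
      0 ≤ totalThirdOrder μ Y n ∧
      ∀ (A₂ A₃ A₄ : ℝ) (b : ℤ → ℝ) (Q : ℂ → ℂ), 0 ≤ A₂ → 0 ≤ A₃ → 0 ≤ A₄ → HasTransform b Q →
      (∀ s, InStrip (lam Y n μ) s →
        ‖Complex.exp (lam Y n μ * (Complex.exp s - 1)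
          + Gam Y n μ * (Complex.exp s - 1) ^ 2) - Q s‖
          ≤ (A₂ * ‖s‖ ^ 2 + A₃ * ‖s‖ ^ 3 + A₄ * ‖s‖ ^ 4) * Real.exp (gaussExp (lam Y n μ) s)) →
      ∀ x : ℕ, (1 + ((x : ℝ) - lam Y n μ) ^ 2 / lam Y n μ) * |pointF Y n μ x - b x|
        ≤ C * (A₂ / (lam Y n μ * √(lam Y n μ)) + (totalThirdOrder μ Y n + A₃) / lam Y n μ ^ 2
          + A₄ / (lam Y n μ ^ 2 * √(lam Y n μ))) := by
  have hB : (0 : ℝ) ≤ B := Nat.cast_nonneg B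
  set ε : ℝ := 1 / (200 * (B + 1)) with hε
  have hε0 : 0 < ε := by positivity
  have hε1 : ε ≤ 1 / 2 := by
    rw [hε]
    gcongr
    linarith
  obtain ⟨C₁, hC₁, H⟩ := exists_weighted_bound hε0 (by linarith)
  set c : ℝ := 16 * (100 * (13 * (B + 2)) ^ 2
    + (4 * (13 * (B + 2))) ^ 3 * Real.exp (12 * (13 * (B + 2)))) with hc
  have hc1 : 1 ≤ c := by
    have h1 : 0 ≤ (4 * (13 * ((B : ℝ) + 2))) ^ 3 * Real.exp (12 * (13 * (B + 2))) := by positivity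
    rw [hc]
    nlinarith
  refine ⟨C₁ * c, by positivity, fun {Ω} _ μ _ n Y hY => ?_⟩
  set l := lam Y n μ with hl
  have hl1 : 1 ≤ l := hY.one_le_lam
  have hl0 : 0 < l := by linarith
  have hsq0 : 0 < √l := Real.sqrt_pos.mpr hl0
  have hsq1 : 1 ≤ √l := Real.one_le_sqrt.mpr hl1
  set T := totalThirdOrder μ Y n with hT
  have hT0 : 0 ≤ T := hY.toBddOneDep.sum_thirdOrder_nonneg hY.mom₁_le hY.mom₂_le n
  refine ⟨hT0, fun A₂ A₃ A₄ b Q h2 h3 h4 hb hQ x => ?_⟩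
  have key := H l A₂ (c * T + A₃) A₄ (zeroExt (pointF Y n μ)) b _ Q hl1 h2 (by positivity) h4
    (hY.hasTransform_pointF n) hb ?_ x
  · rw [zeroExt_natCast] at key
    push_cast at key
    refine key.trans ?_
    rw [mul_assoc C₁ c]
    refine mul_le_mul_of_nonneg_left ?_ hC₁.le
    rw [mul_add, mul_add]
    have g1 : A₂ / (l * √l) ≤ c * (A₂ / (l * √l)) := le_mul_of_one_le_left (by positivity) hc1
    have g2 : A₄ / (l ^ 2 * √l) ≤ c * (A₄ / (l ^ 2 * √l)) :=
      le_mul_of_one_le_left (by positivity) hc1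
    have g3 : (c * T + A₃) / l ^ 2 ≤ c * ((T + A₃) / l ^ 2) := by
      rw [← mul_div_assoc, mul_add]
      gcongr
      exact le_mul_of_one_le_left h3 hc1
    linarith
  · intro s hre him
    have hre1 : |s.re| ≤ ε := by
      rw [hre]
      exact div_le_self hε0.le hsq1
    have hs : InStrip l s := by
      refine ⟨hl1, hre1.trans hε1, ?_, him⟩
      rw [← sq_abs, hre, div_pow, Real.sq_sqrt hl0.le, mul_div_cancel₀ _ hl0.ne']
      nlinarith
    have e1 := hY.norm_genFun_sub_compPois_le hY.mom₁_le hY.mom₂_le hY.majorant_le hs hre1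
    have e2 := hQ s hs
    refine (norm_sub_le_norm_sub_add_norm_sub _ _ _).trans ((add_le_add e1 e2).trans_eq ?_)
    change c * T * ‖s‖ ^ 3 * _ + _ = _ * Real.exp (gaussExp l s)
    ring

/-- The parameters are tied to `Y` by equations, so that the bounds can be read for another sequence
with the same law of the sum. -/
theorem SmallMoments.exists_bounds (B : ℕ) :
    ∃ C : ℝ, 0 < C ∧ ∀ {Ω : Type*} [MeasurableSpace Ω] (μ : Measure Ω)
      [IsProbabilityMeasure μ] (n : ℕ) (Y : ℕ → Ω → ℕ), SmallMoments μ B n Y →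
      ∀ {T W l g F : ℝ} {x : ℕ}, T = totalThirdOrder μ Y n → l = lam Y n μ → g = Gam Y n μ →
        F = pointF Y n μ x → W = 1 + ((x : ℝ) - l) ^ 2 / l →
      0 ≤ T ∧
      W * |F - pois l x| ≤ C * (|g| / (l * √l) + T / l ^ 2) ∧
      W * |F - pois l x - pois₁ l g x| ≤ C * (g ^ 2 / (l ^ 2 * √l) + T / l ^ 2) ∧
      W * |F - compPois l g x| ≤ C * (T / l ^ 2) ∧
      W * |F - transPois l g x|
        ≤ C * ((T + |g|) / l ^ 2 + Int.fract (-2 * g) / (l * √l)) ∧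
      (0 < g → W * |F - negBin (nbR l g) (nbQ l g) x| ≤ C * (T / l ^ 2 + g ^ 2 / l ^ 3)) ∧
      (g < 0 → W * |F - binom (biN l g) (l / biN l g) x|
        ≤ C * (T / l ^ 2 + g ^ 2 / l ^ 3)) := by
  obtain ⟨C, hC, H⟩ := SmallMoments.exists_approx B
  set M : ℝ := 2000 + 6 * Real.exp 8 with hM
  have hM0 : 2000 ≤ M := by rw [hM]; have := Real.exp_pos 8; linarith
  have hM1 : 6 * Real.exp 8 ≤ M := by rw [hM]; linarith
  clear_value M
  refine ⟨2 * M * C, by positivity, fun {Ω} _ μ _ n Y hY T W l g F x hT hl hg hF hW => ?_⟩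
  obtain ⟨hT0, H⟩ := H μ n Y hY
  have hl1 := hY.one_le_lam
  have hgl := hY.abs_Gam_le
  rw [← hT] at hT0
  rw [← hT, ← hl, ← hg] at H
  rw [← hl] at hl1
  rw [← hl, ← hg] at hgl
  have hl0 : 0 < l := by linarith
  have hsq0 : 0 < √l := Real.sqrt_pos.mpr hl0
  have hsq1 : 1 ≤ √l := Real.one_le_sqrt.mpr hl1
  have hsql : √l ≤ l := Real.sqrt_le_iff.mpr ⟨hl0.le, by nlinarith⟩
  have H' : ∀ {A₂ A₃ A₄ R : ℝ} {b : ℤ → ℝ} {Q : ℂ → ℂ} {v : ℝ}, HasTransform b Q → 0 ≤ A₂ → 0 ≤ A₃ →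
      0 ≤ A₄ → b x = v → (∀ s, InStrip l s → ‖Complex.exp (l * (Complex.exp s - 1)
          + g * (Complex.exp s - 1) ^ 2) - Q s‖
          ≤ (A₂ * ‖s‖ ^ 2 + A₃ * ‖s‖ ^ 3 + A₄ * ‖s‖ ^ 4) * Real.exp (gaussExp l s)) →
      A₂ / (l * √l) + (T + A₃) / l ^ 2 + A₄ / (l ^ 2 * √l) ≤ 2 * M * R →
      W * |F - v| ≤ 2 * M * C * R := by
    intro A₂ A₃ A₄ R b Q v hb h2 h3 h4 hv hQ hR
    have := H A₂ A₃ A₄ b Q h2 h3 h4 hb hQ x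
    rw [← hF, ← hW, hv] at this
    exact this.trans ((mul_le_mul_of_nonneg_left hR hC.le).trans_eq (by ring))
  have hδ0 := Int.fract_nonneg (-2 * g)
  have hTl : 0 ≤ T / l ^ 2 := by positivity
  have hMT : T / l ^ 2 ≤ 2 * M * (T / l ^ 2) := le_mul_of_one_le_left hTl (by linarith)
  have habs := abs_le.mp hgl
  have mono : ∀ {a v : ℝ}, a ≤ 2 * M → 0 ≤ v → a * v ≤ 2 * M * v := fun h hv =>
    mul_le_mul_of_nonneg_right h hv
  refine ⟨hT0, ?_, ?_, ?_, ?_, fun hg0 => ?_, fun hg0 => ?_⟩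
  · refine H' (A₂ := 4 * |g|) (A₃ := 0) (A₄ := 0) (hasTransform_pois hl0.le) (by positivity) le_rfl
      le_rfl rfl (fun s hs => (norm_compPois_sub_pois_le hs hgl).trans_eq (by ring)) ?_
    have := mono (a := 4) (v := |g| / (l * √l)) (by linarith) (by positivity)
    rw [add_zero, zero_div, add_zero, mul_add, mul_div_assoc]
    linarith
  · rw [sub_sub]
    refine H' (A₂ := 0) (A₃ := 0) (A₄ := 16 * g ^ 2)
      ((hasTransform_pois hl0.le).add (hasTransform_pois₁ hl0.le g)) le_rfl le_rfl (by positivity)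
      rfl (fun s hs => (norm_compPois_sub_pois₁_le hs hgl).trans_eq (by ring)) ?_
    have := mono (a := 16) (v := g ^ 2 / (l ^ 2 * √l)) (by linarith) (by positivity)
    rw [add_zero, zero_div, zero_add, mul_add, mul_div_assoc]
    linarith
  · refine H' (A₂ := 0) (A₃ := 0) (A₄ := 0) (hasTransform_compPois l g) le_rfl le_rfl le_rfl
      (zeroExt_natCast _ _) (fun s hs => by simp) ?_
    simpa using hMT
  · set δ := Int.fract (-2 * g) with hδ
    refine H' (A₂ := 4 * δ) (A₃ := 6 * Real.exp 8 * (|g| + δ)) (A₄ := 0)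
      (hasTransform_transPois (by linarith)) (by positivity) (by positivity) le_rfl rfl
      (fun s hs => (norm_compPois_sub_transPois_le hs hgl).trans_eq (by ring)) ?_
    -- The cubic contribution of `δ` is of smaller order than its quadratic one, as `√l ≤ l`.
    have e1 : δ / l ^ 2 ≤ δ / (l * √l) := by
      rw [pow_two]; gcongr
    have e2 := mono (a := 6 * Real.exp 8) (v := |g| / l ^ 2) (by linarith) (by positivity)
    have e3 := mul_le_mul hM1 e1 (by positivity) (by linarith)
    have e4 : 0 ≤ δ / (l * √l) := by positivity
    have e5 : 4 * (δ / (l * √l)) ≤ M * (δ / (l * √l)) := by gcongr; linarith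
    calc _ = 4 * (δ / (l * √l)) + T / l ^ 2 + 6 * Real.exp 8 * (|g| / l ^ 2)
            + 6 * Real.exp 8 * (δ / l ^ 2) := by ring
      _ ≤ M * (δ / (l * √l)) + 2 * M * (T / l ^ 2) + 2 * M * (|g| / l ^ 2)
            + M * (δ / (l * √l)) := by linarith
      _ = _ := by ring
  · refine H' (A₂ := 0) (A₃ := 32 * (g ^ 2 / l)) (A₄ := 0)
      (hasTransform_negBin hl0 hg0 (by linarith)) le_rfl (by positivity) le_rfl
      (zeroExt_natCast _ _)
      (fun s hs => (norm_compPois_sub_negBin_le hs hg0 habs.2).trans_eq (by ring)) ?_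
    have := mono (a := 32) (v := g ^ 2 / l ^ 3) (by linarith) (by positivity)
    calc _ = T / l ^ 2 + 32 * (g ^ 2 / l ^ 3) := by field_simp; ring
      _ ≤ 2 * M * (T / l ^ 2) + 2 * M * (g ^ 2 / l ^ 3) := by linarith
      _ = _ := by ring
  · refine H' (A₂ := 32 * (g ^ 2 / l ^ 2)) (A₃ := 1000 * (g ^ 2 / l)) (A₄ := 0)
      (hasTransform_binom _ _) (by positivity) (by positivity) le_rfl
      (zeroExt_natCast _ _)
      (fun s hs => (norm_compPois_sub_binom_le hs hg0 (by linarith)).trans_eq (by ring)) ?_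
    have e1 := mono (a := 1032) (v := g ^ 2 / l ^ 3) (by linarith) (by positivity)
    have e2 : g ^ 2 / l ^ 2 / (l * √l) ≤ g ^ 2 / l ^ 3 := by
      rw [div_div]
      gcongr
      nlinarith [pow_pos hl0 3]
    calc _ = 32 * (g ^ 2 / l ^ 2 / (l * √l)) + T / l ^ 2 + 1000 * (g ^ 2 / l ^ 3) := by
          field_simp; ring
      _ ≤ 2 * M * (T / l ^ 2) + 2 * M * (g ^ 2 / l ^ 3) := by linarith
      _ = _ := by ring

end Approximation

/-! ### Bounds for the remainder terms and the smallness conditions -/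

section MomentBounds
variable {Ω : Type*} {mΩ : MeasurableSpace Ω} {μ : Measure Ω} {B : ℕ} {Y : ℕ → Ω → ℕ}

theorem mom₁_nonneg (k : ℕ) : 0 ≤ mom₁ μ Y k := integral_nonneg fun _ => Nat.cast_nonneg _

theorem mom₂_nonneg (k : ℕ) : 0 ≤ mom₂ μ Y k :=
  integral_nonneg fun _ => natCast_mul_sub_one_nonneg _

theorem mom₃_nonneg (k : ℕ) : 0 ≤ mom₃ μ Y k :=
  integral_nonneg fun _ => natCast_mul_sub_one_mul_nonneg _

theorem mix_nonneg (k : ℕ) : 0 ≤ mix μ Y k := integral_nonneg fun _ => by positivity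

theorem mix₂_nonneg (k : ℕ) : 0 ≤ mix₂ μ Y k := add_nonneg
  (integral_nonneg fun _ => mul_nonneg (natCast_mul_sub_one_nonneg _) (Nat.cast_nonneg _))
  (integral_nonneg fun _ => mul_nonneg (Nat.cast_nonneg _) (natCast_mul_sub_one_nonneg _))

theorem mix₃_nonneg (k : ℕ) : 0 ≤ mix₃ μ Y k := integral_nonneg fun _ => by positivity

/-- The contribution of one summand to the first order remainder. -/
noncomputable def secondOrder (μ : Measure Ω) (Y : ℕ → Ω → ℕ) (k : ℕ) : ℝ :=
  mom₂ μ Y k + mom₁ μ Y k ^ 2 + mix μ Y k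

theorem secondOrder_nonneg (k : ℕ) : 0 ≤ secondOrder μ Y k :=
  add_nonneg (add_nonneg (mom₂_nonneg k) (sq_nonneg _)) (mix_nonneg k)

namespace BddOneDep
variable [IsProbabilityMeasure μ] (hY : BddOneDep μ B Y)
include hY

theorem mom₃_le (k : ℕ) : mom₃ μ Y k ≤ B * mom₂ μ Y k := by
  refine integral_mul_le_mul μ (hY.bddMeas_three k) (hY.bddMeas_two k) fun ω => ?_
  rw [mul_comm]
  have h1 := natCast_mul_sub_one_nonneg (Y k ω)
  have h2 : (Y k ω : ℝ) ≤ B := Nat.cast_le.mpr (hY.le k ω)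
  gcongr
  linarith

theorem mix₂_le (k : ℕ) : mix₂ μ Y k ≤ 2 * B * mix μ Y k := by
  have hq := (hY.bddMeas_cast (k - 1)).mul (hY.bddMeas_cast k)
  have h1 := integral_mul_le_mul (c := B) μ ((hY.bddMeas_two (k - 1)).mul (hY.bddMeas_cast k)) hq
    fun ω => by
      have h2 : (Y (k - 1) ω : ℝ) ≤ B := Nat.cast_le.mpr (hY.le _ ω)
      have h3 : (0 : ℝ) ≤ Y (k - 1) ω * Y k ω := by positivity
      nlinarith
  have h1' := integral_mul_le_mul (c := B) μ ((hY.bddMeas_cast (k - 1)).mul (hY.bddMeas_two k)) hq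
    fun ω => by
      have h2 : (Y k ω : ℝ) ≤ B := Nat.cast_le.mpr (hY.le _ ω)
      have h3 : (0 : ℝ) ≤ Y (k - 1) ω * Y k ω := by positivity
      nlinarith
  unfold mix₂ mix
  linarith

theorem mix₃_le (k : ℕ) : mix₃ μ Y k ≤ B * mix μ Y k := by
  refine integral_mul_le_mul μ (((hY.bddMeas_cast (k - 2)).mul (hY.bddMeas_cast (k - 1))).mul
    (hY.bddMeas_cast k)) ((hY.bddMeas_cast (k - 1)).mul (hY.bddMeas_cast k)) fun ω => ?_
  rw [mul_assoc]
  gcongr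
  exact hY.le _ ω

omit [IsProbabilityMeasure μ] in
theorem sum_secondOrder_le (n : ℕ) : ∑ k ∈ Finset.range n, secondOrder μ Y k
    ≤ ∑ k ∈ Finset.range n, secondOrder μ Y (k + 1) :=
  sum_range_le_sum_range_succ (by simp [secondOrder, mom₂, mom₁, mix, hY.zero])
    secondOrder_nonneg n

variable (h1 : ∀ k, mom₁ μ Y k ≤ 1 / 100)
include h1

/-- Each third order moment loses one factor, bounded by `B` inside an expectation and by `1/100`
when it is a mean. This makes the Poisson error depend on `R₀` alone. -/
theorem thirdOrder_le (k : ℕ) :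
    thirdOrder (mom₁ μ Y) (mom₂ μ Y) (mom₃ μ Y) (mix μ Y) (mix₂ μ Y) (mix₃ μ Y) k
      ≤ (3 * B + 1) * secondOrder μ Y (k + 1) + secondOrder μ Y k := by
  have hB : (0 : ℝ) ≤ B := Nat.cast_nonneg B
  have e : ∀ i {v : ℝ}, 0 ≤ v → mom₁ μ Y i * v ≤ 1 / 100 * v := fun i v hv =>
    mul_le_mul_of_nonneg_right (h1 i) hv
  have a1 := e (k + 1) (sq_nonneg (mom₁ μ Y (k + 1)))
  have a2 := e k (sq_nonneg (mom₁ μ Y k))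
  have a3 := e (k + 1) (mom₂_nonneg (μ := μ) (Y := Y) (k + 1))
  have a4 := hY.mom₃_le (k + 1)
  have a5 := e (k - 1) (mix_nonneg (μ := μ) (Y := Y) (k + 1))
  have a6 := e k (mix_nonneg (μ := μ) (Y := Y) (k + 1))
  have a7 := e (k + 1) (mix_nonneg (μ := μ) (Y := Y) (k + 1))
  have a8 := hY.mix₂_le (k + 1)
  have a9 := e (k + 1) (mom₂_nonneg (μ := μ) (Y := Y) k)
  have a10 := e k (mom₂_nonneg (μ := μ) (Y := Y) (k + 1))
  have a11 := hY.mix₃_le (k + 1)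
  have a12 := e (k + 1) (mix_nonneg (μ := μ) (Y := Y) k)
  have a13 := e (k - 1) (mul_nonneg (mom₁_nonneg (μ := μ) (Y := Y) k)
    (mom₁_nonneg (μ := μ) (Y := Y) (k + 1)))
  have a14 := two_mul_le_add_sq (mom₁ μ Y k) (mom₁ μ Y (k + 1))
  have b1 := mom₂_nonneg (μ := μ) (Y := Y) k
  have b2 := mom₂_nonneg (μ := μ) (Y := Y) (k + 1)
  have b3 := mix_nonneg (μ := μ) (Y := Y) k
  have b4 := mix_nonneg (μ := μ) (Y := Y) (k + 1)
  have b5 := sq_nonneg (mom₁ μ Y k)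
  have b6 := sq_nonneg (mom₁ μ Y (k + 1))
  have c1 := mul_nonneg hB b2
  have c2 := mul_nonneg hB b6
  unfold thirdOrder secondOrder
  linarith

theorem totalThirdOrder_le (n : ℕ) : totalThirdOrder μ Y n
    ≤ (3 * B + 2) * ∑ k ∈ Finset.range n, secondOrder μ Y (k + 1) := by
  refine (Finset.sum_le_sum fun k _ => hY.thirdOrder_le h1 k).trans ?_
  rw [Finset.sum_add_distrib, ← Finset.mul_sum]
  have := hY.sum_secondOrder_le n
  linarith

omit h1 in
theorem abs_Gam_le_sum (n : ℕ) :
    |Gam Y n μ| ≤ 2 * ∑ k ∈ Finset.range n, secondOrder μ Y (k + 1) := by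
  rw [hY.Gam_eq]
  have h2 : ∀ k, |gammaCoeff (mom₁ μ Y) (mom₂ μ Y) (mix μ Y) k|
      ≤ secondOrder μ Y (k + 1) + secondOrder μ Y k := by
    intro k
    have a14 := two_mul_le_add_sq (mom₁ μ Y k) (mom₁ μ Y (k + 1))
    have b1 := mom₂_nonneg (μ := μ) (Y := Y) k
    have b2 := mom₂_nonneg (μ := μ) (Y := Y) (k + 1)
    have b3 := mix_nonneg (μ := μ) (Y := Y) k
    have b4 := mix_nonneg (μ := μ) (Y := Y) (k + 1)
    have b5 := sq_nonneg (mom₁ μ Y k)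
    have b6 := sq_nonneg (mom₁ μ Y (k + 1))
    have b7 := mul_nonneg (mom₁_nonneg (μ := μ) (Y := Y) k)
      (mom₁_nonneg (μ := μ) (Y := Y) (k + 1))
    unfold gammaCoeff secondOrder
    rw [abs_le]
    constructor <;> linarith
  refine (Finset.abs_sum_le_sum_abs _ _).trans ((Finset.sum_le_sum fun k _ => h2 k).trans ?_)
  rw [Finset.sum_add_distrib]
  have := hY.sum_secondOrder_le n
  linarith

theorem smallMoments {n : ℕ} (h2 : ∀ k, mom₂ μ Y k ≤ mom₁ μ Y k) (hl : 1 ≤ lam Y n μ)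
    (hm : ∑ k ∈ Finset.range n, mom₂ μ Y (k + 1) ≤ lam Y n μ / 20)
    (hc : ∑ k ∈ Finset.range n, |mix μ Y (k + 1) - mom₁ μ Y k * mom₁ μ Y (k + 1)|
      ≤ lam Y n μ / 20) : SmallMoments μ B n Y := by
  have hsum := hY.lam_eq n
  have hsq : ∀ k, mom₁ μ Y (k + 1) ^ 2 ≤ 1 / 100 * mom₁ μ Y (k + 1) := fun k => by
    rw [pow_two]
    exact mul_le_mul_of_nonneg_right (h1 _) (mom₁_nonneg _)
  have hpp : ∀ k, mom₁ μ Y k * mom₁ μ Y (k + 1) ≤ 1 / 100 * mom₁ μ Y (k + 1) := fun k =>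
    mul_le_mul_of_nonneg_right (h1 _) (mom₁_nonneg _)
  have hmix : ∀ k, mix μ Y (k + 1) ≤ |mix μ Y (k + 1) - mom₁ μ Y k * mom₁ μ Y (k + 1)|
      + 1 / 100 * mom₁ μ Y (k + 1) := fun k => by
    have := le_abs_self (mix μ Y (k + 1) - mom₁ μ Y k * mom₁ μ Y (k + 1))
    have := hpp k
    linarith
  -- `6/100 = 1/20 + 1/100`: the covariances and the products of neighbouring means.
  have hq : ∑ k ∈ Finset.range n, mix μ Y (k + 1) ≤ 6 / 100 * lam Y n μ := by
    refine (Finset.sum_le_sum fun k _ => hmix k).trans ?_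
    rw [Finset.sum_add_distrib, ← Finset.mul_sum, ← hsum]
    linarith
  have hq' := sum_range_le_sum_range_succ (u := mix μ Y) (by simp [mix, hY.zero]) mix_nonneg n
  refine { hY with mom₁_le := h1, mom₂_le := h2, one_le_lam := hl, majorant_le := ?_,
                    abs_Gam_le := ?_ }
  -- The sums add up to `0.03 + 0.285 + 0.003 + 0.02 = 0.338` times `λ`, below `9/20`.
  · have : ∀ k, majorant (mom₁ μ Y) (mom₂ μ Y) (mix μ Y) k
        ≤ 0.6 * mom₂ μ Y (k + 1) + 4.75 * mix μ Y (k + 1) + 0.05 * mix μ Y k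
          + 0.02 * mom₁ μ Y (k + 1) := by
      intro k
      have := hsq k
      have := hpp k
      unfold majorant
      linarith
    refine (Finset.sum_le_sum fun k _ => this k).trans ?_
    rw [Finset.sum_add_distrib, Finset.sum_add_distrib, Finset.sum_add_distrib, ← Finset.mul_sum,
      ← Finset.mul_sum, ← Finset.mul_sum, ← Finset.mul_sum, ← hsum]
    linarith
  -- The sums add up to `0.025 + 0.005 + 0.05`, exactly `2/25`, times `λ`.
  · have : ∀ k, |gammaCoeff (mom₁ μ Y) (mom₂ μ Y) (mix μ Y) k|
        ≤ 1 / 2 * mom₂ μ Y (k + 1) + 1 / 200 * mom₁ μ Y (k + 1)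
          + |mix μ Y (k + 1) - mom₁ μ Y k * mom₁ μ Y (k + 1)| := by
      intro k
      have := hsq k
      have := sq_nonneg (mom₁ μ Y (k + 1))
      have := mom₁_nonneg (μ := μ) (Y := Y) (k + 1)
      have := mom₂_nonneg (μ := μ) (Y := Y) (k + 1)
      have := le_abs_self (mix μ Y (k + 1) - mom₁ μ Y k * mom₁ μ Y (k + 1))
      have := neg_abs_le (mix μ Y (k + 1) - mom₁ μ Y k * mom₁ μ Y (k + 1))
      unfold gammaCoeff
      rw [abs_le]
      constructor <;> linarith
    rw [hY.Gam_eq]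
    refine (Finset.abs_sum_le_sum_abs _ _).trans ((Finset.sum_le_sum fun k _ => this k).trans ?_)
    rw [Finset.sum_add_distrib, Finset.sum_add_distrib, ← Finset.mul_sum, ← Finset.mul_sum, ← hsum]
    linarith

end BddOneDep
end MomentBounds

/-! ### Reduction to surely bounded sequences indexed by all naturals -/

section Truncation
variable {Ω : Type*} {mΩ : MeasurableSpace Ω} {μ : Measure Ω} {n : ℕ} {X : ℕ → Ω → ℕ}

/-- The variables with index between `1` and `n`, truncated at `B`, the others being `0`. -/
def truncate (n B : ℕ) (X : ℕ → Ω → ℕ) (k : ℕ) (ω : Ω) : ℕ :=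
  if k ∈ Finset.Icc 1 n then min (X k ω) B else 0

theorem truncate_of_notMem {k : ℕ} (B : ℕ) (hk : k ∉ Finset.Icc 1 n) :
    truncate n B X k = fun _ => 0 := by
  funext ω
  simp only [truncate, hk, if_false]

theorem truncate_of_mem {k : ℕ} (B : ℕ) (hk : k ∈ Finset.Icc 1 n) :
    truncate n B X k = fun ω => min (X k ω) B := by
  funext ω
  simp only [truncate, hk, if_true]

theorem comap_truncate_of_notMem {k : ℕ} (B : ℕ) (hk : k ∉ Finset.Icc 1 n) :
    MeasurableSpace.comap (truncate n B X k) ⊤ = ⊥ := by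
  rw [truncate_of_notMem B hk, MeasurableSpace.comap_const]

theorem comap_truncate_le {k : ℕ} (B : ℕ) (hk : k ∈ Finset.Icc 1 n) :
    MeasurableSpace.comap (truncate n B X k) ⊤ ≤ MeasurableSpace.comap (X k) ⊤ := by
  rw [truncate_of_mem B hk]
  rintro _ ⟨s, -, rfl⟩
  exact ⟨(fun y => min y B) ⁻¹' s, trivial, rfl⟩

/-- Indices outside `1, …, n` generate the trivial σ-algebra, so the past or the future is trivial
whenever `s = 0` or `t > n`, the cases not covered by `MDependent`. -/
theorem bddOneDep_truncate [IsProbabilityMeasure μ] (B : ℕ)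
    (hX : ∀ k ∈ Finset.Icc 1 n, Measurable (X k)) (hdep : MDependent 1 n X μ) :
    BddOneDep μ B (truncate n B X) where
  meas k := by
    by_cases hk : k ∈ Finset.Icc 1 n
    · rw [truncate_of_mem B hk]
      exact (hX k hk).min measurable_const
    · rw [truncate_of_notMem B hk]
      exact measurable_const
  le k ω := by
    unfold truncate
    split_ifs
    · exact min_le_right _ _
    · exact Nat.zero_le _
  zero ω := by simp [truncate]
  indep s t hst := by
    by_cases hs : 1 ≤ s
    · by_cases ht : t ≤ n
      · refine indep_of_indep_of_le (hdep s t hs hst ht) (iSup₂_le fun i hi => ?_)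
          (iSup₂_le fun i hi => ?_)
        · by_cases hi' : i ∈ Finset.Icc 1 n
          · refine (comap_truncate_le B hi').trans ?_
            exact le_iSup₂_of_le (f := fun i (_ : i ∈ Finset.Icc 1 s) =>
              MeasurableSpace.comap (X i) ⊤) i
              (Finset.mem_Icc.mpr ⟨(Finset.mem_Icc.mp hi').1, hi⟩) le_rfl
          · rw [comap_truncate_of_notMem B hi']
            exact bot_le
        · by_cases hi' : i ∈ Finset.Icc 1 n
          · refine (comap_truncate_le B hi').trans ?_
            exact le_iSup₂_of_le (f := fun i (_ : i ∈ Finset.Icc t n) =>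
              MeasurableSpace.comap (X i) ⊤) i
              (Finset.mem_Icc.mpr ⟨hi, (Finset.mem_Icc.mp hi').2⟩) le_rfl
          · rw [comap_truncate_of_notMem B hi']
            exact bot_le
      · have : future (truncate n B X) t ≤ ⊥ := iSup₂_le fun i hi => by
          rw [comap_truncate_of_notMem B]
          have : t ≤ i := hi
          simp only [Finset.mem_Icc]; omega
        rw [le_bot_iff.mp this]
        exact indep_bot_right _
    · have : past (truncate n B X) s ≤ ⊥ := iSup₂_le fun i hi => by
        rw [comap_truncate_of_notMem B]
        have : i ≤ s := hi
        simp only [Finset.mem_Icc]; omega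
      rw [le_bot_iff.mp this]
      exact indep_bot_left _

/-- For nonpositive `m` both sides vanish, as `toNat` sends `m` to the index `0`, where the
truncated variable is `0`. -/
theorem ae_rv_eq_truncate {B : ℕ} (hB : ∀ k ∈ Finset.Icc 1 n, ∀ᵐ ω ∂μ, X k ω ≤ B) :
    ∀ᵐ ω ∂μ, ∀ m : ℤ, m ≤ n → rv X m ω = truncate n B X m.toNat ω := by
  have h := (Finset.eventually_all _).mpr hB
  filter_upwards [h] with ω hω m hm
  unfold rv
  split_ifs with h0
  · have hk : m.toNat ∈ Finset.Icc 1 n := by simp only [Finset.mem_Icc]; omega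
    rw [truncate_of_mem B hk]
    simp only [min_eq_left (hω _ hk)]
  · rw [truncate_of_notMem B (by simp only [Finset.mem_Icc]; omega)]
    simp

end Truncation

/-! ### Transfer of moments and remainder terms to the truncated sequence -/

section Transfer
variable {Ω : Type*} {mΩ : MeasurableSpace Ω} {μ : Measure Ω} {n B : ℕ} {X Y : ℕ → Ω → ℕ}
  (hXY : ∀ᵐ ω ∂μ, ∀ m : ℤ, m ≤ n → rv X m ω = Y m.toNat ω)
include hXY

theorem rv_ae_eq {m : ℤ} {k : ℕ} (hm : m ≤ n) (hk : m.toNat = k) :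
    rv X m =ᵐ[μ] fun ω => (Y k ω : ℝ) := by
  filter_upwards [hXY] with ω hω
  rw [hω m hm, hk]

theorem nu_one_eq {m : ℤ} {k : ℕ} (hm : m ≤ n) (hk : m.toNat = k) : nu X μ 1 m = mom₁ μ Y k := by
  refine integral_congr_ae ?_
  filter_upwards [rv_ae_eq hXY hm hk] with ω hω
  simp [hω]

theorem nu_two_eq {m : ℤ} {k : ℕ} (hm : m ≤ n) (hk : m.toNat = k) : nu X μ 2 m = mom₂ μ Y k := by
  refine integral_congr_ae ?_
  filter_upwards [rv_ae_eq hXY hm hk] with ω hω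
  simp [hω, Finset.prod_range_succ]

theorem nu_three_eq {m : ℤ} {k : ℕ} (hm : m ≤ n) (hk : m.toNat = k) :
    nu X μ 3 m = mom₃ μ Y k := by
  refine integral_congr_ae ?_
  filter_upwards [rv_ae_eq hXY hm hk] with ω hω
  simp [hω, Finset.prod_range_succ]

theorem S_ae_eq : S X n =ᵐ[μ] S Y n := by
  filter_upwards [hXY] with ω hω
  refine Finset.sum_congr rfl fun k hk => ?_
  have hk' := Finset.mem_Icc.mp hk
  have h := hω k (by omega)
  rw [rv, if_pos (by omega), Int.toNat_natCast] at h
  exact_mod_cast h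

theorem lam_congr : lam X n μ = lam Y n μ := by
  refine integral_congr_ae ?_
  filter_upwards [S_ae_eq hXY] with ω hω
  rw [hω]

theorem Gam_congr : Gam X n μ = Gam Y n μ := by
  have h : (fun ω => (S X n ω : ℝ)) =ᵐ[μ] fun ω => (S Y n ω : ℝ) := by
    filter_upwards [S_ae_eq hXY] with ω hω
    rw [hω]
  rw [Gam, Gam, variance_congr h, lam_congr hXY]

theorem pointF_congr (x : ℕ) : pointF X n μ x = pointF Y n μ x := by
  refine measureReal_congr ?_
  filter_upwards [S_ae_eq hXY] with ω hω
  change (S X n ω = x) = (S Y n ω = x)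
  rw [hω]

theorem integral_rv_mul_rv {k : ℕ} (hk : k < n) :
    ∫ ω, rv X ((k : ℤ) + 1 - 1) ω * rv X (k + 1) ω ∂μ = mix μ Y (k + 1) := by
  refine integral_congr_ae ?_
  filter_upwards [rv_ae_eq hXY (m := (k : ℤ) + 1 - 1) (k := k + 1 - 1) (by omega) (by omega),
    rv_ae_eq hXY (m := (k : ℤ) + 1) (k := k + 1) (by omega) (by omega)] with ω h1 h2
  rw [h1, h2]

theorem integral_rv_mul_rv_mul_rv {k : ℕ} (hk : k < n) :
    ∫ ω, rv X ((k : ℤ) + 1 - 2) ω * rv X ((k : ℤ) + 1 - 1) ω * rv X (k + 1) ω ∂μ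
      = mix₃ μ Y (k + 1) := by
  refine integral_congr_ae ?_
  filter_upwards [rv_ae_eq hXY (m := (k : ℤ) + 1 - 2) (k := k + 1 - 2) (by omega) (by omega),
    rv_ae_eq hXY (m := (k : ℤ) + 1 - 1) (k := k + 1 - 1) (by omega) (by omega),
    rv_ae_eq hXY (m := (k : ℤ) + 1) (k := k + 1) (by omega) (by omega)] with ω h1 h2 h3
  rw [h1, h2, h3]

theorem integral_rv {m : ℤ} {k : ℕ} (hm : m ≤ n) (hk : m.toNat = k) :
    ∫ ω, rv X m ω ∂μ = mom₁ μ Y k := integral_congr_ae (rv_ae_eq hXY hm hk)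

theorem integral_rv_two {m : ℤ} {k : ℕ} (hm : m ≤ n) (hk : m.toNat = k) :
    ∫ ω, rv X m ω * (rv X m ω - 1) ∂μ = mom₂ μ Y k := by
  refine integral_congr_ae ?_
  filter_upwards [rv_ae_eq hXY hm hk] with ω hω
  rw [hω]

theorem EPlusTwo_rv {k : ℕ} (hk : k < n) :
    EPlusTwo μ (rv X ((k : ℤ) + 1 - 1)) (rv X (k + 1))
      = mix₂ μ Y (k + 1) + mom₂ μ Y k * mom₁ μ Y (k + 1) + mom₁ μ Y k * mom₂ μ Y (k + 1) := by
  have h1 := rv_ae_eq hXY (m := (k : ℤ) + 1 - 1) (k := k + 1 - 1) (by omega) (by omega)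
  have h2 := rv_ae_eq hXY (m := (k : ℤ) + 1) (k := k + 1) (by omega) (by omega)
  unfold EPlusTwo EPlusPair mix₂
  beta_reduce
  rw [integral_rv hXY (m := (k : ℤ) + 1 - 1) (k := k) (by omega) (by omega),
    integral_rv hXY (m := (k : ℤ) + 1) (k := k + 1) (by omega) (by omega),
    integral_rv_two hXY (m := (k : ℤ) + 1 - 1) (k := k) (by omega) (by omega),
    integral_rv_two hXY (m := (k : ℤ) + 1) (k := k + 1) (by omega) (by omega)]
  have e1 : ∫ ω, rv X ((k : ℤ) + 1 - 1) ω * (rv X ((k : ℤ) + 1 - 1) ω - 1) * rv X (k + 1) ω ∂μ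
      = ∫ ω, (Y (k + 1 - 1) ω : ℝ) * (Y (k + 1 - 1) ω - 1) * Y (k + 1) ω ∂μ := by
    refine integral_congr_ae ?_
    filter_upwards [h1, h2] with ω h1 h2
    rw [h1, h2]
  have e2 : ∫ ω, rv X ((k : ℤ) + 1 - 1) ω * (rv X (k + 1) ω * (rv X (k + 1) ω - 1)) ∂μ
      = ∫ ω, (Y (k + 1 - 1) ω : ℝ) * (Y (k + 1) ω * (Y (k + 1) ω - 1)) ∂μ := by
    refine integral_congr_ae ?_
    filter_upwards [h1, h2] with ω h1 h2
    rw [h1, h2]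
  rw [e1, e2]
  ring

theorem EPlusTriple_rv {k : ℕ} (hk : k < n) :
    EPlusTriple μ (rv X ((k : ℤ) + 1 - 2)) (rv X ((k : ℤ) + 1 - 1)) (rv X (k + 1))
      = mix₃ μ Y (k + 1) + mom₁ μ Y (k - 1) * mix μ Y (k + 1)
        + (mix μ Y k + mom₁ μ Y (k - 1) * mom₁ μ Y k) * mom₁ μ Y (k + 1) := by
  have e1 : ∫ ω, rv X ((k : ℤ) + 1 - 2) ω * rv X ((k : ℤ) + 1 - 1) ω ∂μ = mix μ Y k := by
    refine integral_congr_ae ?_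
    filter_upwards [rv_ae_eq hXY (m := (k : ℤ) + 1 - 2) (k := k - 1) (by omega) (by omega),
      rv_ae_eq hXY (m := (k : ℤ) + 1 - 1) (k := k) (by omega) (by omega)] with ω h1 h2
    rw [h1, h2]
  unfold EPlusTriple EPlusPair
  rw [integral_rv_mul_rv_mul_rv hXY hk, integral_rv_mul_rv hXY hk, e1,
    integral_rv hXY (m := (k : ℤ) + 1 - 2) (k := k - 1) (by omega) (by omega),
    integral_rv hXY (m := (k : ℤ) + 1 - 1) (k := k) (by omega) (by omega),
    integral_rv hXY (m := (k : ℤ) + 1) (k := k + 1) (by omega) (by omega)]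

theorem R₀_eq_sum : R₀ X n μ = ∑ k ∈ Finset.range n, secondOrder μ Y (k + 1) := by
  unfold R₀
  rw [sum_Icc_int_eq_sum_range]
  refine Finset.sum_congr rfl fun k hk => ?_
  have hk' := Finset.mem_range.mp hk
  rw [nu_two_eq hXY (k := k + 1) (by omega) (by omega),
    nu_one_eq hXY (k := k + 1) (by omega) (by omega), integral_rv_mul_rv hXY hk']
  rfl

/-- All third order terms occur in `R₁` with the same index except the cube of the preceding mean.
-/
theorem totalThirdOrder_le_R₁ (hY : BddOneDep μ B Y) : totalThirdOrder μ Y n ≤ 2 * R₁ X n μ := by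
  -- The added difference of cubes turns the two cubes into `2 p (k + 1)³`; its sum over `k` is
  -- nonnegative because the mean at index `0` is `0`.
  have h1 : ∀ k ∈ Finset.range n,
      thirdOrder (mom₁ μ Y) (mom₂ μ Y) (mom₃ μ Y) (mix μ Y) (mix₂ μ Y) (mix₃ μ Y) k
        + (mom₁ μ Y (k + 1) ^ 3 - mom₁ μ Y k ^ 3)
      ≤ 2 * (nu X μ 1 ((k : ℤ) + 1) ^ 3 + nu X μ 1 ((k : ℤ) + 1) * nu X μ 2 ((k : ℤ) + 1)
        + nu X μ 3 ((k : ℤ) + 1)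
        + (nu X μ 1 ((k : ℤ) + 1 - 2) + nu X μ 1 ((k : ℤ) + 1 - 1) + nu X μ 1 ((k : ℤ) + 1))
          * ∫ ω, rv X ((k : ℤ) + 1 - 1) ω * rv X ((k : ℤ) + 1) ω ∂μ
        + EPlusTwo μ (rv X ((k : ℤ) + 1 - 1)) (rv X ((k : ℤ) + 1))
        + EPlusTriple μ (rv X ((k : ℤ) + 1 - 2)) (rv X ((k : ℤ) + 1 - 1))
          (rv X ((k : ℤ) + 1))) := by
    intro k hk
    have hk' := Finset.mem_range.mp hk
    rw [EPlusTwo_rv hXY hk', EPlusTriple_rv hXY hk', integral_rv_mul_rv hXY hk',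
      nu_one_eq hXY (m := (k : ℤ) + 1) (k := k + 1) (by omega) (by omega),
      nu_two_eq hXY (m := (k : ℤ) + 1) (k := k + 1) (by omega) (by omega),
      nu_three_eq hXY (m := (k : ℤ) + 1) (k := k + 1) (by omega) (by omega),
      nu_one_eq hXY (m := (k : ℤ) + 1 - 1) (k := k) (by omega) (by omega),
      nu_one_eq hXY (m := (k : ℤ) + 1 - 2) (k := k - 1) (by omega) (by omega)]
    have p1 := mom₁_nonneg (μ := μ) (Y := Y) (k - 1)
    have p2 := mom₁_nonneg (μ := μ) (Y := Y) k
    have p3 := mom₁_nonneg (μ := μ) (Y := Y) (k + 1)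
    have m1 := mom₂_nonneg (μ := μ) (Y := Y) k
    have m2 := mom₂_nonneg (μ := μ) (Y := Y) (k + 1)
    have m3 := mom₃_nonneg (μ := μ) (Y := Y) (k + 1)
    have q1 := mix_nonneg (μ := μ) (Y := Y) k
    have q2 := mix_nonneg (μ := μ) (Y := Y) (k + 1)
    have q3 := mix₂_nonneg (μ := μ) (Y := Y) (k + 1)
    have q4 := mix₃_nonneg (μ := μ) (Y := Y) (k + 1)
    have r1 := mul_nonneg p3 m2
    have r2 := mul_nonneg p1 q2
    have r3 := mul_nonneg p2 q2
    have r4 := mul_nonneg p3 q2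
    have r5 := mul_nonneg m1 p3
    have r6 := mul_nonneg p2 m2
    have r7 := mul_nonneg p3 q1
    have r8 := mul_nonneg (mul_nonneg p1 p2) p3
    unfold thirdOrder
    linarith
  have h2 := Finset.sum_le_sum h1
  rw [Finset.sum_add_distrib, Finset.sum_sub_distrib, ← Finset.mul_sum] at h2
  have h3 := sum_range_le_sum_range_succ (u := fun k => mom₁ μ Y k ^ 3)
    (by simp [hY.mom₁_zero]) (fun k => pow_nonneg (mom₁_nonneg k) 3) n
  unfold R₁
  rw [sum_Icc_int_eq_sum_range]
  unfold totalThirdOrder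
  linarith

theorem covariance_rv [IsProbabilityMeasure μ] (hY : BddOneDep μ B Y) {k : ℕ} (hk : k < n) :
    cov[rv X ((k : ℤ) + 1 - 1), rv X (k + 1); μ]
      = mix μ Y (k + 1) - mom₁ μ Y k * mom₁ μ Y (k + 1) := by
  have h1 := rv_ae_eq hXY (m := (k : ℤ) + 1 - 1) (k := k) (by omega) (by omega)
  have h2 := rv_ae_eq hXY (m := (k : ℤ) + 1) (k := k + 1) (by omega) (by omega)
  have hL : ∀ j, MemLp (fun ω => (Y j ω : ℝ)) 2 μ := fun j => by
    obtain ⟨C, hC⟩ := (hY.bddMeas_cast j).bdd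
    exact MemLp.of_bound (hY.bddMeas_cast j).meas.aestronglyMeasurable C
      (Filter.Eventually.of_forall hC)
  rw [covariance_eq_sub ((hL k).ae_eq h1.symm) ((hL (k + 1)).ae_eq h2.symm), integral_congr_ae h1,
    integral_congr_ae h2]
  have := integral_rv_mul_rv hXY hk
  rw [← this]
  rfl

end Transfer

/-! ### Assembly of the theorem -/

theorem rv_of_nonpos {Ω : Type*} (X : ℕ → Ω → ℕ) {k : ℤ} (hk : k ≤ 0) : rv X k = 0 := by
  funext ω
  simp [rv, hk]

theorem sum_Icc_two_covariance {Ω : Type*} [MeasurableSpace Ω] (μ : Measure Ω) (n : ℕ)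
    (X : ℕ → Ω → ℕ) : ∑ k ∈ Finset.Icc (2 : ℤ) n, |cov[rv X (k - 1), rv X k; μ]|
      = ∑ k ∈ Finset.range n, |cov[rv X ((k : ℤ) + 1 - 1), rv X (k + 1); μ]| := by
  rw [← sum_Icc_int_eq_sum_range (fun k => |cov[rv X (k - 1), rv X k; μ]|)]
  refine Finset.sum_subset (Finset.Icc_subset_Icc_left (by norm_num)) fun k hk hk' => ?_
  simp only [Finset.mem_Icc] at hk hk'
  -- Only `k = 1` is added, and there the left variable is identically `0`.
  rw [rv_of_nonpos X (k := k - 1) (by omega), covariance_zero_left, abs_zero]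

theorem theorem3 (C₀ : ℝ) :
    ∃ C : ℝ, 0 < C ∧
      ∀ {Ω : Type*} [MeasurableSpace Ω] (μ : Measure Ω) [IsProbabilityMeasure μ]
        (n : ℕ) (X : ℕ → Ω → ℕ),
        (∀ k ∈ Finset.Icc 1 n, Measurable (X k)) →
        MDependent 1 n X μ →
        (∀ k ∈ Finset.Icc 1 n,
          nu X μ 1 k ≤ 1 / 100 ∧ nu X μ 2 k ≤ nu X μ 1 k ∧ ∀ᵐ ω ∂μ, (X k ω : ℝ) ≤ C₀) →
        1 ≤ lam X n μ →
        ∑ k ∈ Finset.Icc (1 : ℤ) n, nu X μ 2 k ≤ lam X n μ / 20 →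
        ∑ k ∈ Finset.Icc (2 : ℤ) n, |cov[rv X (k - 1), rv X k; μ]| ≤ lam X n μ / 20 →
        ∀ x : ℕ,
          (1 + ((x : ℝ) - lam X n μ) ^ 2 / lam X n μ)
              * |pointF X n μ x - pois (lam X n μ) x|
            ≤ C * (R₀ X n μ / (lam X n μ * √(lam X n μ))) ∧
          (1 + ((x : ℝ) - lam X n μ) ^ 2 / lam X n μ)
              * |pointF X n μ x - pois (lam X n μ) x - pois₁ (lam X n μ) (Gam X n μ) x|
            ≤ C * (R₀ X n μ ^ 2 / (lam X n μ ^ 2 * √(lam X n μ)) + R₁ X n μ / lam X n μ ^ 2) ∧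
          (1 + ((x : ℝ) - lam X n μ) ^ 2 / lam X n μ)
              * |pointF X n μ x - compPois (lam X n μ) (Gam X n μ) x|
            ≤ C * (R₁ X n μ / lam X n μ ^ 2) ∧
          (1 + ((x : ℝ) - lam X n μ) ^ 2 / lam X n μ)
              * |pointF X n μ x - transPois (lam X n μ) (Gam X n μ) x|
            ≤ C * ((R₁ X n μ + |Gam X n μ|) / lam X n μ ^ 2
                + Int.fract (-2 * Gam X n μ) / (lam X n μ * √(lam X n μ))) ∧
          (0 < Gam X n μ →
            (1 + ((x : ℝ) - lam X n μ) ^ 2 / lam X n μ)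
                * |pointF X n μ x
                    - negBin (nbR (lam X n μ) (Gam X n μ)) (nbQ (lam X n μ) (Gam X n μ)) x|
              ≤ C * (R₁ X n μ / lam X n μ ^ 2 + Gam X n μ ^ 2 / lam X n μ ^ 3)) ∧
          (Gam X n μ < 0 →
            (1 + ((x : ℝ) - lam X n μ) ^ 2 / lam X n μ)
                * |pointF X n μ x
                    - binom (biN (lam X n μ) (Gam X n μ))
                        (lam X n μ / biN (lam X n μ) (Gam X n μ)) x|
              ≤ C * (R₁ X n μ / lam X n μ ^ 2 + Gam X n μ ^ 2 / lam X n μ ^ 3)) := by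

  obtain ⟨C, hC, H⟩ := SmallMoments.exists_bounds ⌊C₀⌋₊
  set B : ℕ := ⌊C₀⌋₊
  have hB : (0 : ℝ) ≤ B := Nat.cast_nonneg B
  -- For the Poisson bound, `3 B + 2` comes from the third order terms and `2` from `|Γ₂| ≤ 2 R₀`;
  -- the other bounds need at most a factor `4`.
  refine ⟨(3 * B + 4) * C, by positivity,
    fun {Ω} _ μ _ n X hX hdep hmom hl hm hc x => ?_⟩
  set Y := truncate n B X
  have hY : BddOneDep μ B Y := bddOneDep_truncate B hX hdep
  have hXY : ∀ᵐ ω ∂μ, ∀ m : ℤ, m ≤ n → rv X m ω = Y m.toNat ω :=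
    ae_rv_eq_truncate fun k hk => by
      filter_upwards [(hmom k hk).2.2] with ω hω
      exact Nat.le_floor hω
  have hY0 : ∀ k ∉ Finset.Icc 1 n, Y k = fun _ => 0 := fun k hk => truncate_of_notMem B hk
  have h1 : ∀ k, mom₁ μ Y k ≤ 1 / 100 := fun k => by
    by_cases hk : k ∈ Finset.Icc 1 n
    · have := (hmom k hk).1
      rwa [nu_one_eq hXY (k := k) (by exact_mod_cast (Finset.mem_Icc.mp hk).2) (by simp)] at this
    · simp [mom₁, hY0 k hk]
  have h2 : ∀ k, mom₂ μ Y k ≤ mom₁ μ Y k := fun k => by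
    by_cases hk : k ∈ Finset.Icc 1 n
    · have hkn : (k : ℤ) ≤ n := by exact_mod_cast (Finset.mem_Icc.mp hk).2
      have := (hmom k hk).2.1
      rwa [nu_one_eq hXY (k := k) hkn (by simp), nu_two_eq hXY (k := k) hkn (by simp)] at this
    · simp [mom₁, mom₂, hY0 k hk]
  have hlam := lam_congr hXY
  have hS : SmallMoments μ B n Y := by
    refine hY.smallMoments h1 h2 (hlam ▸ hl) ?_ ?_
    · rw [← hlam]
      refine le_of_eq_of_le ?_ hm
      rw [sum_Icc_int_eq_sum_range]
      refine Finset.sum_congr rfl fun k hk => ?_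
      have := Finset.mem_range.mp hk
      rw [nu_two_eq hXY (k := k + 1) (by omega) (by omega)]
    · rw [← hlam]
      refine le_of_eq_of_le ?_ hc
      rw [sum_Icc_two_covariance]
      refine Finset.sum_congr rfl fun k hk => ?_
      rw [covariance_rv hXY hY (Finset.mem_range.mp hk)]
  obtain ⟨hT0, b1, b2, b3, b4, b5, b6⟩ := H μ n Y hS rfl hlam (Gam_congr hXY)
    (pointF_congr hXY x) rfl
  have hT1 := totalThirdOrder_le_R₁ hXY hY
  have hT2 := hY.totalThirdOrder_le h1 n
  have hG := hY.abs_Gam_le_sum n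
  rw [← R₀_eq_sum hXY] at hT2 hG
  rw [← Gam_congr hXY] at hG
  generalize lam X n μ = l at *
  generalize Gam X n μ = g at *
  generalize totalThirdOrder μ Y n = T at *
  generalize R₀ X n μ = r₀ at *
  generalize R₁ X n μ = r₁ at *
  have hl0 : 0 < l := by linarith
  have hsq0 : 0 < √l := Real.sqrt_pos.mpr hl0
  have hsql : √l ≤ l := Real.sqrt_le_iff.mpr ⟨hl0.le, by nlinarith⟩
  have hr₁ : 0 ≤ r₁ := by linarith
  have hr₀ : 0 ≤ r₀ := by have := abs_nonneg g; linarith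
  have hg2 : g ^ 2 ≤ 4 * r₀ ^ 2 := by
    rw [← sq_abs]
    calc |g| ^ 2 ≤ (2 * r₀) ^ 2 := by gcongr
      _ = _ := by ring
  have hTl : T / l ^ 2 ≤ 2 * (r₁ / l ^ 2) := by rw [← mul_div_assoc]; gcongr
  have hr₁l : 0 ≤ r₁ / l ^ 2 := by positivity
  have hδ := Int.fract_nonneg (-2 * g)
  have mono : ∀ {u v w : ℝ}, w ≤ C * u → u ≤ (3 * B + 4) * v → w ≤ (3 * B + 4) * C * v :=
    fun {u v w} h h' => h.trans ((mul_le_mul_of_nonneg_left h' hC.le).trans_eq (by ring))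
  have two : ∀ {v : ℝ}, 0 ≤ v → 2 * v ≤ (3 * B + 4) * v := fun hv => by gcongr; linarith
  have one : ∀ {v : ℝ}, 0 ≤ v → v ≤ (3 * B + 4) * v := fun hv =>
    le_mul_of_one_le_left hv (by linarith)
  have hgl : 0 ≤ g ^ 2 / l ^ 3 := by positivity
  refine ⟨mono b1 ?_, mono b2 ?_, mono b3 (hTl.trans (two hr₁l)), mono b4 ?_,
    fun h => mono (b5 h) ?_, fun h => mono (b6 h) ?_⟩
  · have e1 : |g| / (l * √l) ≤ 2 * (r₀ / (l * √l)) := by rw [← mul_div_assoc]; gcongr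
    -- Since `√l ≤ l`, the denominator `l²` may be weakened to `l √l`.
    have e2 : T / l ^ 2 ≤ (3 * B + 2) * (r₀ / (l * √l)) := by
      rw [← mul_div_assoc, pow_two]; gcongr
    linarith
  · have e1 : g ^ 2 / (l ^ 2 * √l) ≤ 4 * (r₀ ^ 2 / (l ^ 2 * √l)) := by
      rw [← mul_div_assoc]; gcongr
    have e2 : 4 * (r₀ ^ 2 / (l ^ 2 * √l)) ≤ (3 * B + 4) * (r₀ ^ 2 / (l ^ 2 * √l)) := by
      gcongr; linarith
    have := two hr₁l
    linarith
  · have e1 := two hr₁l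
    have e2 := one (v := |g| / l ^ 2) (by positivity)
    have e3 := one (v := Int.fract (-2 * g) / (l * √l)) (by positivity)
    rw [add_div, add_div]
    linarith
  · have := two hr₁l
    have := one hgl
    linarith
  · have := two hr₁l
    have := one hgl
    linarith
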